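/- Let $p_X$ be a probability distribution on an alphabet $\mathcal X$. Then there is a constant $k_p>0$, depending only on $p_X$, such that the following holds for every complex Hilbert space $\mathcal H_B$ (of any dimension), every family $(\rho_B^x)_{x\in\mathcal X}$ of density operators on $\mathcal H_B$, every integer $n\ge 1$ with $n\,p_X(x)\in\{0,1,2,\dots\}$ for all $x\in\mathcal X$, and every integer $M\ge 1$. Notation: $\log$ is the natural logarithm; $R:=\frac1n\log M$; $\rho_{XB}:=\sum_x p_X(x)\,|x\rangle\langle x|\otimes\rho_B^x$, with marginals $\rho_X=\sum_x p_X(x)|x\rangle\langle x|$ and $\rho_B=\sum_x p_X(x)\rho_B^x$; $I(X{:}B)_\rho:=D(\rho_{XB}\,\|\,\rho_X\otimes\rho_B)$, where $D(\rho\|\sigma)=\operatorname{Tr}[\rho(\log\rho-\log\sigma)]$ is the quantum relative entropy. For $\beta\in(0,1)$ let $D_\beta(\rho\|\sigma):=\frac1{\beta-1}\log\operatorname{Tr}[\rho^{\beta}\sigma^{1-\beta}]$ (equal to $+\infty$ if the trace vanishes) and $$\breve I^{\downarrow}_\beta(X{:}B)_\rho:=\sum_{x} p_X(x)\,D_\beta(\rho_B^x\,\|\,\rho_B),\qquad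 0\cdot\infty:=0 .$$ Let $T_p^n\subseteq\mathcal X^n$ be the type class of $p_X$, i.e. the set of sequences $x^n=(x_1,\dots,x_n)$ with empirical distribution $\frac1n\#\{i: x_i=x\}=p_X(x)$ for all $x$; let $\rho_{B^n}^{x^n}:=\rho_B^{x_1}\otimes\cdots\otimes\rho_B^{x_n}$ and $\breve\rho_{B^n}:=\frac1{|T_p^n|}\sum_{x^n\in T_p^n}\rho_{B^n}^{x^n}$. The random constant composition codebook $\breve{\mathcal C}^n=(x^n(1),\dots,x^n(M))$ consists of $M$ codewords drawn independently and uniformly from $T_p^n$, and $\rho_{B^n}^{\breve{\mathcal C}^n}:=\frac1M\sum_{m=1}^M\rho_{B^n}^{x^n(m)}$. The exponent $$\breve E(R):=\sup_{\alpha\in(1/2,1)}\frac{1-\alpha}{\alpha}\Bigl(\breve I^{\downarrow}_{2-1/\alpha}(X{:}B)_\rho-R\Bigr)$$ is finite, $$\frac12\,\mathbb E_{\breve{\mathcal C}^n}\bigl\|\rho_{B^n}^{\breve{\mathcal C}^n}-\breve\rho_{B^n}\bigr\|_1\ \ge\ 1-n^{k_p}\,e^{-n\breve E(R)},$$ and $\breve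 E(R)>0$ if and only if $R<I(X{:}B)_\rho$. -/

import Mathlib

open scoped ENNReal InnerProductSpace

noncomputable section

namespace QSoftCovering

/-! ### Traces of positive operators and density operators on a Hilbert space -/

section Trace

variable (K : Type*) [NormedAddCommGroup K] [InnerProductSpace ℂ K] [CompleteSpace K]

/-- Index set of a fixed orthonormal (Hilbert) basis of `K`. -/
def basisIdx : Set K := (exists_hilbertBasis ℂ K).choose

/-- A fixed orthonormal (Hilbert) basis of `K`. -/
def stdBasis : HilbertBasis (basisIdx K) ℂ K := (exists_hilbertBasis ℂ K).choose_spec.choose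

variable {K}

/-- The trace `Tr T = ∑ i, ⟨b i, T b i⟩ ∈ [0, ∞]` of a positive operator `T`. -/
def ptrace (T : K →L[ℂ] K) : ℝ≥0∞ :=
  ∑' i, ENNReal.ofReal (inner ℂ (stdBasis K i) (T (stdBasis K i))).re

/-- Density operators: positive semidefinite operators of trace one. -/
def IsDensity (T : K →L[ℂ] K) : Prop := 0 ≤ T ∧ ptrace T = 1

/-- The trace norm `‖T‖₁ = Tr |T| ∈ [0, ∞]`. -/
def traceNorm (T : K →L[ℂ] K) : ℝ≥0∞ := ptrace (CFC.abs T)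

/-- The Petz-Rényi divergence `(α - 1)⁻¹ log Tr (ρ ^ α σ ^ (1 - α))` of order `α ∈ (0, 1)`, where
the trace is written, by cyclicity, as the trace of the positive operator
`σ ^ ((1 - α) / 2) ρ ^ α σ ^ ((1 - α) / 2)`. It is `⊤` if the trace vanishes. -/
def petzDiv (α : ℝ) (ρ σ : K →L[ℂ] K) : EReal :=
  (((α - 1)⁻¹ : ℝ) : EReal) *
    ENNReal.log (ptrace (σ ^ ((1 - α) / 2) * ρ ^ α * σ ^ ((1 - α) / 2)))

/-- An orthonormal (Hilbert) basis of eigenvectors of `T`, with the eigenvalues. -/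
structure Eigenbasis (T : K →L[ℂ] K) where
  idx : Set K
  basis : HilbertBasis idx ℂ K
  val : idx → ℝ
  apply_basis : ∀ i, T (basis i) = (val i : ℂ) • basis i

/-- `l log (l / m) - l + m ∈ [0, ∞]` for `l, m ≥ 0`, with `0 log (0 / m) = 0`, and `l log (l / 0) = ∞`
for `l > 0`. -/
def relEntropyTerm (l m : ℝ) : ℝ≥0∞ :=
  if m = 0 ∧ l ≠ 0 then ⊤ else ENNReal.ofReal (l * Real.log (l / m) - l + m)

/-- Umegaki's relative entropy `D(ρ‖σ) = Tr ρ (log ρ - log σ) ∈ [0, ∞]` of density operators, on a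
Hilbert space of any dimension (Lindblad's form). If `e i`, `f j` are orthonormal bases of
eigenvectors of `ρ`, `σ` with eigenvalues `l i`, `m j`, it is the sum of the nonnegative terms
`|⟨e i, f j⟩|² (l i log (l i / m j) - l i + m j)`, where `∑ |⟨e i, f j⟩|² (m j - l i) = Tr σ - Tr ρ = 0`.
The sum does not depend on the bases, so the infimum only removes the choice. -/
def relEntropy (ρ σ : K →L[ℂ] K) : ℝ≥0∞ :=
  ⨅ (e : Eigenbasis ρ) (f : Eigenbasis σ), ∑' i, ∑' j,
    ENNReal.ofReal (‖inner ℂ (e.basis i) (f.basis j)‖ ^ 2) * relEntropyTerm (e.val i) (f.val j)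

end Trace

/-! ### Tensor products -/

/-- The Hilbert space `ℓ²(ι)`. -/
abbrev Ell2 (ι : Type*) : Type _ := lp (fun _ : ι => ℂ) 2

section Ampliation

variable {α ι κ : Type*}

theorem summable_sq (f : Ell2 ι) : Summable fun i => ‖f i‖ ^ 2 := by
  have h := (memℓp_gen_iff (p := 2) (by norm_num)).1 (lp.memℓp f)
  simpa using h

theorem norm_sq_eq (f : Ell2 ι) : ‖f‖ ^ 2 = ∑' i, ‖f i‖ ^ 2 := by
  have h := lp.norm_rpow_eq_tsum (p := 2) (by norm_num) f
  simpa using h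

theorem memℓp_two {f : ι → ℂ} (h : Summable fun i => ‖f i‖ ^ 2) : Memℓp f 2 :=
  memℓp_gen (by simpa using h)

/-- For `α ≃ ι × κ` and `f ∈ ℓ²(α)`, the vector `i ↦ f (i, k)` of `ℓ²(ι)`. -/
def slice (e : α ≃ ι × κ) (f : Ell2 α) (k : κ) : Ell2 ι :=
  ⟨fun i => f (e.symm (i, k)), memℓp_two ((summable_sq f).comp_injective
    (i := fun i => e.symm (i, k)) fun i j h => by simpa using h)⟩

theorem slice_apply (e : α ≃ ι × κ) (f : Ell2 α) (k : κ) (i : ι) :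
    slice e f k i = f (e.symm (i, k)) := rfl

theorem hasSum_slice (e : α ≃ ι × κ) (f : Ell2 α) :
    HasSum (fun k => ‖slice e f k‖ ^ 2) (‖f‖ ^ 2) := by
  have h1 : HasSum (fun a => ‖f a‖ ^ 2) (‖f‖ ^ 2) := norm_sq_eq f ▸ (summable_sq f).hasSum
  have h2 : HasSum (fun q : κ × ι => ‖f (e.symm (q.2, q.1))‖ ^ 2) (‖f‖ ^ 2) :=
    ((Equiv.prodComm κ ι).trans e.symm).hasSum_iff (f := fun a => ‖f a‖ ^ 2) |>.2 h1
  refine h2.prod_fiberwise fun k => ?_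
  rw [norm_sq_eq]
  exact (summable_sq (slice e f k)).hasSum

theorem summable_apply_slice (e : α ≃ ι × κ) (A : Ell2 ι →L[ℂ] Ell2 ι) (f : Ell2 α) :
    Summable fun k => ‖A (slice e f k)‖ ^ 2 := by
  refine Summable.of_nonneg_of_le (fun k => by positivity) (fun k => ?_)
    ((hasSum_slice e f).summable.mul_left (‖A‖ ^ 2))
  rw [← mul_pow]
  exact pow_le_pow_left₀ (norm_nonneg _) (A.le_opNorm _) 2

theorem hasSum_prod (g : κ → Ell2 ι) (h : Summable fun k => ‖g k‖ ^ 2) :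
    HasSum (fun q : κ × ι => ‖g q.1 q.2‖ ^ 2) (∑' k, ‖g k‖ ^ 2) := by
  have h0 : (fun k => ‖g k‖ ^ 2) = fun k => ∑' i, ‖g k i‖ ^ 2 := funext fun k => norm_sq_eq _
  have h1 : Summable fun q : κ × ι => ‖g q.1 q.2‖ ^ 2 := by
    refine (summable_prod_of_nonneg (f := fun q : κ × ι => ‖g q.1 q.2‖ ^ 2)
      fun q => sq_nonneg _).2 ⟨fun k => summable_sq (g k), ?_⟩
    rwa [h0] at h
  rw [h0]
  have h2 : ∑' q : κ × ι, ‖g q.1 q.2‖ ^ 2 = ∑' k, ∑' i, ‖g k i‖ ^ 2 := h1.tsum_prod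
  rw [← h2]
  exact h1.hasSum

theorem hasSum_ampl (e : α ≃ ι × κ) (A : Ell2 ι →L[ℂ] Ell2 ι) (f : Ell2 α) :
    HasSum (fun a => ‖A (slice e f (e a).2) (e a).1‖ ^ 2) (∑' k, ‖A (slice e f k)‖ ^ 2) :=
  (e.trans (Equiv.prodComm ι κ)).hasSum_iff.2
    (hasSum_prod (fun k => A (slice e f k)) (summable_apply_slice e A f))

/-- For `α ≃ ι × κ`, i.e. `ℓ²(α) ≅ ℓ²(ι) ⊗ ℓ²(κ)`, the operator `A ⊗ 1` on `ℓ²(α)`. -/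
def ampl (e : α ≃ ι × κ) (A : Ell2 ι →L[ℂ] Ell2 ι) : Ell2 α →L[ℂ] Ell2 α :=
  LinearMap.mkContinuous
    { toFun := fun f => ⟨fun a => A (slice e f (e a).2) (e a).1, memℓp_two (hasSum_ampl e A f).summable⟩
      map_add' := fun f g => by
        ext a
        have h : slice e (f + g) (e a).2 = slice e f (e a).2 + slice e g (e a).2 := by
          ext i; rfl
        change A (slice e (f + g) (e a).2) (e a).1 = _
        rw [h, map_add]; rfl
      map_smul' := fun c f => by
        ext a
        have h : slice e (c • f) (e a).2 = c • slice e f (e a).2 := by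
          ext i; rfl
        change A (slice e (c • f) (e a).2) (e a).1 = _
        rw [h, map_smul]; rfl } ‖A‖ fun f => by
    refine le_of_sq_le_sq ?_ (by positivity)
    rw [norm_sq_eq, mul_pow]
    change ∑' a, ‖A (slice e f (e a).2) (e a).1‖ ^ 2 ≤ _
    rw [(hasSum_ampl e A f).tsum_eq, ← (hasSum_slice e f).tsum_eq, ← tsum_mul_left]
    refine (summable_apply_slice e A f).tsum_le_tsum (fun k => ?_)
      ((hasSum_slice e f).summable.mul_left _)
    rw [← mul_pow]
    exact pow_le_pow_left₀ (norm_nonneg _) (A.le_opNorm _) 2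

end Ampliation

/-- The tensor product `A ⊗ B` on `ℓ²(ι) ⊗ ℓ²(κ) ≅ ℓ²(ι × κ)`, as `(A ⊗ 1) (1 ⊗ B)`. -/
def tensor {ι κ : Type*} (A : Ell2 ι →L[ℂ] Ell2 ι) (B : Ell2 κ →L[ℂ] Ell2 κ) :
    Ell2 (ι × κ) →L[ℂ] Ell2 (ι × κ) :=
  ampl (Equiv.refl _) A * ampl (Equiv.prodComm ι κ) B

section ClassicalQuantum

variable {H : Type*} [NormedAddCommGroup H] [InnerProductSpace ℂ H] [CompleteSpace H]

/-- An operator on `H`, carried to `ℓ²` by the coordinates of the fixed basis of `H`. -/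
def toEll2 (A : H →L[ℂ] H) : Ell2 (basisIdx H) →L[ℂ] Ell2 (basisIdx H) :=
  ((stdBasis H).repr : H →L[ℂ] Ell2 (basisIdx H)) ∘L A ∘L
    ((stdBasis H).repr.symm : Ell2 (basisIdx H) →L[ℂ] H)

/-- The Hilbert space `H ^ ⊗ n`: its orthonormal basis consists of the product vectors
`b (i 1) ⊗ ⋯ ⊗ b (i n)`, where `b` is the fixed basis of `H`. -/
abbrev TensorPow (H : Type*) [NormedAddCommGroup H] [InnerProductSpace ℂ H] [CompleteSpace H]
    (n : ℕ) : Type _ :=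
  Ell2 (Fin n → basisIdx H)

/-- The tensor product `A 1 ⊗ ⋯ ⊗ A n` on `H ^ ⊗ n`, as the product over `k` of the operators
`1 ⊗ ⋯ ⊗ A k ⊗ ⋯ ⊗ 1`. -/
def tensorProd {n : ℕ} (A : Fin n → H →L[ℂ] H) : TensorPow H n →L[ℂ] TensorPow H n :=
  (List.ofFn fun k => ampl (Equiv.funSplitAt k (basisIdx H)) (toEll2 (A k))).prod

variable {𝒳 : Type*}

/-! ### Information quantities of a classical-quantum state -/

/-- The marginal `ρ_B = ∑ x, p x ρ x`. -/
def marginal (p : PMF 𝒳) (ρ : 𝒳 → H →L[ℂ] H) : H →L[ℂ] H :=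
  ∑' x, ((p x).toReal : ℂ) • ρ x

open Classical in
/-- The projection `|x⟩⟨x|` on `ℓ²(𝒳)`. -/
def ketbra (x : 𝒳) : Ell2 𝒳 →L[ℂ] Ell2 𝒳 :=
  InnerProductSpace.rankOne ℂ (lp.single 2 x (1 : ℂ) : Ell2 𝒳) (lp.single 2 x (1 : ℂ) : Ell2 𝒳)

/-- `ρ_X = ∑ x, p x |x⟩⟨x|`. -/
def classicalState (p : PMF 𝒳) : Ell2 𝒳 →L[ℂ] Ell2 𝒳 :=
  ∑' x, ((p x).toReal : ℂ) • ketbra x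

/-- `ρ_XB = ∑ x, p x |x⟩⟨x| ⊗ ρ x`. -/
def cqState (p : PMF 𝒳) (ρ : 𝒳 → H →L[ℂ] H) :
    Ell2 (𝒳 × basisIdx H) →L[ℂ] Ell2 (𝒳 × basisIdx H) :=
  ∑' x, ((p x).toReal : ℂ) • tensor (ketbra x) (toEll2 (ρ x))

/-- The quantum mutual information `I(X:B) = D(ρ_XB ‖ ρ_X ⊗ ρ_B)`. -/
def mutualInfo (p : PMF 𝒳) (ρ : 𝒳 → H →L[ℂ] H) : ℝ≥0∞ :=
  relEntropy (cqState p ρ) (tensor (classicalState p) (toEll2 (marginal p ρ)))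

/-- The Petz-type Augustin information `∑ x, p x D_α(ρ x ‖ ρ_B)` of order `α ∈ (0, 1)`, with
`0 * ∞ = 0`. -/
def augustinDown (α : ℝ) (p : PMF 𝒳) (ρ : 𝒳 → H →L[ℂ] H) : EReal :=
  ∑' x, ((p x : ℝ≥0∞) : EReal) * petzDiv α (ρ x) (marginal p ρ)

/-- `sup_{α ∈ (1/2, 1)} (1 - α) / α * (I_{2 - 1/α} - R)`, with the Petz-type Augustin information. -/
def scExponent (p : PMF 𝒳) (ρ : 𝒳 → H →L[ℂ] H) (R : ℝ) : EReal :=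
  ⨆ α ∈ Set.Ioo (1 / 2 : ℝ) 1,
    (((1 - α) / α : ℝ) : EReal) * (augustinDown (2 - 1 / α) p ρ - (R : EReal))

/-! ### Random constant composition codebooks -/

open Classical in
/-- The empirical distribution of a sequence. -/
def empirical {n : ℕ} (x : Fin n → 𝒳) (a : 𝒳) : ℝ≥0∞ :=
  (∑ i, if a = x i then 1 else 0) / n

/-- The type class of `p`: the sequences of length `n` with empirical distribution `p`. -/
def typeClass (p : PMF 𝒳) (n : ℕ) : Set (Fin n → 𝒳) :=
  {x | ∀ a, empirical x a = p a}

/-- The uniform distribution on the type class. -/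
def typeUniform (p : PMF 𝒳) (n : ℕ) : (Fin n → 𝒳) → ℝ≥0∞ :=
  (typeClass p n).indicator fun _ => ((typeClass p n).ncard : ℝ≥0∞)⁻¹

/-- The output state `∑ x, p̆ x ρ^x` on `H ^ ⊗ n`, where `p̆` is uniform on the type class and
`ρ^x = ρ (x 1) ⊗ ⋯ ⊗ ρ (x n)`. -/
def typeOutput (p : PMF 𝒳) (ρ : 𝒳 → H →L[ℂ] H) (n : ℕ) : TensorPow H n →L[ℂ] TensorPow H n :=
  ∑' x : Fin n → 𝒳, ((typeUniform p n x).toReal : ℂ) • tensorProd fun i => ρ (x i)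

/-- The state `(1 / M) ∑ m, ρ^(c m)` induced by the codebook `c = (c 1, …, c M)`. -/
def codebookState (ρ : 𝒳 → H →L[ℂ] H) {n M : ℕ} (c : Fin M → Fin n → 𝒳) :
    TensorPow H n →L[ℂ] TensorPow H n :=
  (M : ℂ)⁻¹ • ∑ m, tensorProd fun i => ρ (c m i)

/-- The expected trace distance between the state induced by a codebook of `M` codewords, drawn
independently and uniformly from the type class, and the output state. -/
def expectedTraceDist (p : PMF 𝒳) (ρ : 𝒳 → H →L[ℂ] H) (n M : ℕ) : ℝ≥0∞ :=
  2⁻¹ * ∑' c : Fin M → Fin n → 𝒳,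
    (∏ m, typeUniform p n (c m)) * traceNorm (codebookState ρ c - typeOutput p ρ n)

end ClassicalQuantum

end QSoftCovering

end

open scoped ENNReal InnerProductSpace

noncomputable section

namespace QSoftCovering


set_option linter.unusedSectionVars false

/-! ### The trace of positive operators and the pairing `trMul`. -/

section TraceTheory

variable {K : Type*} [NormedAddCommGroup K] [InnerProductSpace ℂ K] [CompleteSpace K]
variable {ι κ : Type*}

/-! The converse is a hypothesis test. Suppose that each codeword state `ρ ω` has a test `T ω` for
which `Tr ρ ω (1 - T ω) + M * Tr σ (T ω) ≤ δ`, where `σ` is the average state. For a codebook, the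
tests of its codewords are merged into one test `G = 4 S (1 + S)⁻²` with `S = ∑ m, T (c m)`. It
satisfies `G ≤ 4 S`, so `σ` rarely passes it, and `1 - G ≤ 2 (1 - T) + 2 R` for each splitting `S =
T + R`, so the codebook state mostly passes it (`exists_soft_union`). Since distinct codewords are
independent, averaging over codebooks replaces the cross terms by traces against `σ`, and the
expected trace distance is at least `1 - 6 δ` (`card_pow_le_sum_traceNorm`).

The individual tests come from the quantum Chernoff bound `ptrace_le_trMul_rpow_add`. The type class
has probability at least `(n + 1) ^ (-|S|)` under the product distribution, with `S` now the support
of `p`, so the average state is at most `(n + 1) ^ |S|` times the tensor power of the marginal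
(`typeOutput_le`). Testing a codeword state against this tensor power gives a product of one-site
traces `Tr (ρ x) ^ (1 - s) ρ_B ^ s`, one per letter. The result is `exp (-n (F s - s R))` up to a
polynomial in `n`, where `F` is `augustinFun`, for every `s` in `(0, 1)`. The substitution `s = (1 -
α) / α` turns the supremum over `s` into the exponent (`scExponent_eq_iSup`). It is finite because
`p x • ρ x ≤ ρ_B` bounds `F s` by `s` times the entropy of `p`.

The exponent is positive exactly when `R < F s / s` for some `s`, so it remains to see that the
supremum of `F s / s` is the mutual information. The relative entropy is the supremum of the Tsallis
quantities `(1 - Tr A ^ (1 - s) B ^ s) / s` along orders `s → 0` (`relEntropy_eq_iSup`, by Fatou's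
lemma). The Rényi divergences lie between the Tsallis quantities and the relative entropy.
Classical-quantum states are block diagonal, so these traces and the relative entropy are averages
over the letters (`exists_cq_eigenbases`).

In infinite dimension all traces take values in `[0, ∞]`. Positive trace class operators are
diagonalised in Hilbert bases, so that trace identities become identities between double sums over
eigenvalues weighted with squared overlaps (`IsEigen.trMul_eq`). -/

theorem HilbertBasis.tsum_ofReal_norm_inner_sq (b : HilbertBasis ι ℂ K) (v : K) :
    ∑' i, ENNReal.ofReal (‖inner ℂ (b i) v‖ ^ 2) = ENNReal.ofReal (‖v‖ ^ 2) := by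
  have h1 : ∀ i, inner ℂ (b i) v = b.repr v i := fun i => (b.repr_apply_apply v i).symm
  have h2 := norm_sq_eq (b.repr v)
  rw [b.repr.norm_map] at h2
  simp_rw [h1]
  rw [h2, ENNReal.ofReal_tsum_of_nonneg (fun i => by positivity) (summable_sq (b.repr v))]

/-- Both sides are the double sum of the squared matrix entries, by Parseval. This makes the
Hilbert-Schmidt norm, and with it the trace, independent of the basis. -/
theorem tsum_norm_sq_adjoint (b : HilbertBasis ι ℂ K) (c : HilbertBasis κ ℂ K) (X : K →L[ℂ] K) :
    ∑' i, ENNReal.ofReal (‖X (b i)‖ ^ 2) = ∑' j, ENNReal.ofReal (‖star X (c j)‖ ^ 2) := by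
  simp_rw [← HilbertBasis.tsum_ofReal_norm_inner_sq c (X _),
    ← HilbertBasis.tsum_ofReal_norm_inner_sq b (star X _)]
  rw [ENNReal.tsum_comm]
  refine tsum_congr fun j => tsum_congr fun i => ?_
  rw [ContinuousLinearMap.star_eq_adjoint, ContinuousLinearMap.adjoint_inner_right,
    ← inner_conj_symm, RCLike.norm_conj]

theorem star_mul_self_re_inner (X : K →L[ℂ] K) (v : K) :
    (inner ℂ v ((star X * X) v)).re = ‖X v‖ ^ 2 := by
  rw [mul_apply_eq_comp, ContinuousLinearMap.star_eq_adjoint,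
    ContinuousLinearMap.adjoint_inner_right, inner_self_eq_norm_sq_to_K]
  norm_cast

theorem re_inner_nonneg_of_nonneg {T : K →L[ℂ] K} (hT : 0 ≤ T) (v : K) :
    0 ≤ (inner ℂ v (T v)).re :=
  ((ContinuousLinearMap.nonneg_iff_isPositive T).1 hT).re_inner_nonneg_right v

theorem nonneg_iff_star_mul_self {T : K →L[ℂ] K} : 0 ≤ T ↔ ∃ X, T = star X * X :=
  CStarAlgebra.nonneg_iff_eq_star_mul_self

theorem ptrace_star_mul_self (b : HilbertBasis ι ℂ K) (X : K →L[ℂ] K) :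
    ptrace (star X * X) = ∑' i, ENNReal.ofReal (‖X (b i)‖ ^ 2) := by
  simp_rw [ptrace, star_mul_self_re_inner]
  rw [tsum_norm_sq_adjoint (stdBasis K) b, tsum_norm_sq_adjoint b b, star_star]

theorem ptrace_eq_tsum (b : HilbertBasis ι ℂ K) {T : K →L[ℂ] K} (hT : 0 ≤ T) :
    ptrace T = ∑' i, ENNReal.ofReal (inner ℂ (b i) (T (b i))).re := by
  obtain ⟨X, rfl⟩ := nonneg_iff_star_mul_self.1 hT
  simp_rw [ptrace_star_mul_self b, star_mul_self_re_inner]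

theorem ptrace_mul_star_self (X : K →L[ℂ] K) : ptrace (X * star X) = ptrace (star X * X) := by
  have h := ptrace_star_mul_self (stdBasis K) (star X)
  rw [star_star] at h
  rw [h, ptrace_star_mul_self (stdBasis K), tsum_norm_sq_adjoint (stdBasis K) (stdBasis K) X]

theorem ptrace_add {S T : K →L[ℂ] K} (hS : 0 ≤ S) (hT : 0 ≤ T) :
    ptrace (S + T) = ptrace S + ptrace T := by
  simp only [ptrace]
  rw [← ENNReal.tsum_add]
  refine tsum_congr fun i => ?_
  rw [← ENNReal.ofReal_add (re_inner_nonneg_of_nonneg hS _) (re_inner_nonneg_of_nonneg hT _)]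
  simp

theorem ptrace_zero : ptrace (0 : K →L[ℂ] K) = 0 := by simp [ptrace]

theorem ptrace_mono {S T : K →L[ℂ] K} (h : S ≤ T) : ptrace S ≤ ptrace T := by
  refine ENNReal.tsum_le_tsum fun i => ENNReal.ofReal_le_ofReal ?_
  have := re_inner_nonneg_of_nonneg (sub_nonneg.2 h) (stdBasis K i)
  simpa [inner_sub_right] using this

theorem ptrace_smul {c : ℝ} (hc : 0 ≤ c) (T : K →L[ℂ] K) :
    ptrace ((c : ℂ) • T) = ENNReal.ofReal c * ptrace T := by
  simp only [ptrace]
  rw [← ENNReal.tsum_mul_left]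
  refine tsum_congr fun i => ?_
  rw [← ENNReal.ofReal_mul hc]
  simp

open scoped ComplexOrder in
theorem smul_nonneg' {c : ℝ} (hc : 0 ≤ c) {T : K →L[ℂ] K} (hT : 0 ≤ T) : 0 ≤ (c : ℂ) • T := by
  rw [ContinuousLinearMap.nonneg_iff_isPositive] at hT ⊢
  exact hT.smul_of_nonneg (by exact_mod_cast hc)

theorem smul_le_smul' {c : ℝ} (hc : 0 ≤ c) {S T : K →L[ℂ] K} (h : S ≤ T) :
    (c : ℂ) • S ≤ (c : ℂ) • T := by
  have := smul_nonneg' hc (sub_nonneg.2 h)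
  rwa [smul_sub, sub_nonneg] at this

theorem ptrace_sum (s : Finset ι) {T : ι → K →L[ℂ] K} (hT : ∀ i ∈ s, 0 ≤ T i) :
    ptrace (∑ i ∈ s, T i) = ∑ i ∈ s, ptrace (T i) := by
  classical
  induction s using Finset.induction_on with
  | empty => simp [ptrace_zero]
  | insert a s ha ih =>
    rw [Finset.sum_insert ha, Finset.sum_insert ha,
      ptrace_add (hT a (by simp)) (Finset.sum_nonneg fun i hi => hT i (by simp [hi])),
      ih fun i hi => hT i (by simp [hi])]

/-- `Tr (A B) ∈ [0, ∞]` for positive `A` and `B`, as the trace of a positive operator. -/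
def trMul (A B : K →L[ℂ] K) : ℝ≥0∞ := ptrace (CFC.sqrt A * B * CFC.sqrt A)

theorem star_sqrt (A : K →L[ℂ] K) : star (CFC.sqrt A) = CFC.sqrt A :=
  (CFC.sqrt_nonneg A).isSelfAdjoint

theorem sqrt_conj_nonneg (A : K →L[ℂ] K) {B : K →L[ℂ] K} (hB : 0 ≤ B) :
    0 ≤ CFC.sqrt A * B * CFC.sqrt A := by
  have := star_left_conjugate_nonneg hB (CFC.sqrt A)
  rwa [star_sqrt] at this

/-- Cyclicity of the trace, in the form `ptrace_mul_star_self`, applied to `X * CFC.sqrt A`. It is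
what makes `trMul` symmetric, hence additive and monotone in both arguments. -/
theorem trMul_star_mul_self {A : K →L[ℂ] K} (hA : 0 ≤ A) (X : K →L[ℂ] K) :
    trMul A (star X * X) = ptrace (X * A * star X) := by
  have h1 : CFC.sqrt A * (star X * X) * CFC.sqrt A = star (X * CFC.sqrt A) * (X * CFC.sqrt A) := by
    rw [star_mul, star_sqrt]; simp only [mul_assoc]
  rw [trMul, h1, ← ptrace_mul_star_self, star_mul, star_sqrt]
  congr 1
  calc X * CFC.sqrt A * (CFC.sqrt A * star X) = X * (CFC.sqrt A * CFC.sqrt A) * star X := by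
        simp only [mul_assoc]
    _ = _ := by rw [CFC.sqrt_mul_sqrt_self A hA]

theorem trMul_comm {A B : K →L[ℂ] K} (hA : 0 ≤ A) (hB : 0 ≤ B) : trMul A B = trMul B A := by
  have h := trMul_star_mul_self hA (CFC.sqrt B)
  rwa [star_sqrt, CFC.sqrt_mul_sqrt_self B hB] at h

theorem trMul_add_right (A : K →L[ℂ] K) {B C : K →L[ℂ] K} (hB : 0 ≤ B) (hC : 0 ≤ C) :
    trMul A (B + C) = trMul A B + trMul A C := by
  rw [trMul, mul_add, add_mul, ptrace_add (sqrt_conj_nonneg A hB) (sqrt_conj_nonneg A hC)]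
  rfl

theorem trMul_add_left {A B C : K →L[ℂ] K} (hA : 0 ≤ A) (hB : 0 ≤ B) (hC : 0 ≤ C) :
    trMul (A + B) C = trMul A C + trMul B C := by
  rw [trMul_comm (add_nonneg hA hB) hC, trMul_add_right C hA hB, trMul_comm hC hA,
    trMul_comm hC hB]

theorem trMul_mono_right (A : K →L[ℂ] K) {B C : K →L[ℂ] K} (h : B ≤ C) :
    trMul A B ≤ trMul A C := by
  refine ptrace_mono ?_
  have := sqrt_conj_nonneg A (sub_nonneg.2 h)
  rw [mul_sub, sub_mul] at this
  exact sub_nonneg.1 this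

theorem trMul_mono_left {A B C : K →L[ℂ] K} (hA : 0 ≤ A) (hC : 0 ≤ C) (h : A ≤ B) :
    trMul A C ≤ trMul B C := by
  rw [trMul_comm hA hC, trMul_comm (hA.trans h) hC]
  exact trMul_mono_right C h

theorem trMul_smul_right {c : ℝ} (hc : 0 ≤ c) (A B : K →L[ℂ] K) :
    trMul A ((c : ℂ) • B) = ENNReal.ofReal c * trMul A B := by
  rw [trMul, mul_smul_comm, smul_mul_assoc, ptrace_smul hc, trMul]

theorem trMul_smul_left {c : ℝ} (hc : 0 ≤ c) {A B : K →L[ℂ] K} (hA : 0 ≤ A) (hB : 0 ≤ B) :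
    trMul ((c : ℂ) • A) B = ENNReal.ofReal c * trMul A B := by
  rw [trMul_comm (smul_nonneg' hc hA) hB, trMul_smul_right hc, trMul_comm hB hA]

theorem trMul_sum_right (A : K →L[ℂ] K) (s : Finset ι) {B : ι → K →L[ℂ] K}
    (hB : ∀ i ∈ s, 0 ≤ B i) : trMul A (∑ i ∈ s, B i) = ∑ i ∈ s, trMul A (B i) := by
  rw [trMul, Finset.mul_sum, Finset.sum_mul, ptrace_sum s fun i hi => sqrt_conj_nonneg A (hB i hi)]
  rfl

theorem trMul_sum_left {B : K →L[ℂ] K} (hB : 0 ≤ B) (s : Finset ι) {A : ι → K →L[ℂ] K}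
    (hA : ∀ i ∈ s, 0 ≤ A i) : trMul (∑ i ∈ s, A i) B = ∑ i ∈ s, trMul (A i) B := by
  rw [trMul_comm (Finset.sum_nonneg hA) hB, trMul_sum_right B s hA]
  exact Finset.sum_congr rfl fun i hi => trMul_comm hB (hA i hi)

theorem trMul_one {A : K →L[ℂ] K} (hA : 0 ≤ A) : trMul A 1 = ptrace A := by
  rw [trMul, mul_one, CFC.sqrt_mul_sqrt_self A hA]

theorem trMul_le_ptrace {A B : K →L[ℂ] K} (hA : 0 ≤ A) (hB : B ≤ 1) :
    trMul A B ≤ ptrace A :=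
  (trMul_mono_right A hB).trans_eq (trMul_one hA)

theorem trMul_add_trMul_one_sub {A B : K →L[ℂ] K} (hA : 0 ≤ A) (hB : 0 ≤ B) (hB1 : B ≤ 1) :
    trMul A B + trMul A (1 - B) = ptrace A := by
  rw [← trMul_add_right A hB (sub_nonneg.2 hB1), add_sub_cancel, trMul_one hA]

/-! ### Powers -/

/-- The power `A ^ s`. -/
def opPow (A : K →L[ℂ] K) (s : ℝ) : K →L[ℂ] K := A ^ s

theorem opPow_nonneg (A : K →L[ℂ] K) (s : ℝ) : 0 ≤ opPow A s := CFC.rpow_nonneg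

/-- Strictly positive exponents leave no convention at the eigenvalue `0`, so no invertibility is
needed. -/
theorem rpow_mul_rpow (A : K →L[ℂ] K) {s t : ℝ} (hs : 0 < s) (ht : 0 < t) :
    A ^ s * A ^ t = A ^ (s + t) := by
  lift s to NNReal using hs.le
  lift t to NNReal using ht.le
  have hs' : 0 < s := by exact_mod_cast hs
  have ht' : 0 < t := by exact_mod_cast ht
  rw [← CFC.nnrpow_eq_rpow hs', ← CFC.nnrpow_eq_rpow ht', ← CFC.nnrpow_add hs' ht',
    CFC.nnrpow_eq_rpow (add_pos hs' ht'), NNReal.coe_add]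

theorem sqrt_rpow (A : K →L[ℂ] K) {s : ℝ} (hs : 0 ≤ s) :
    CFC.sqrt (A ^ s) = A ^ (s / 2) := by
  lift s to NNReal using hs
  rw [CFC.sqrt_rpow_nnreal]

theorem trMul_rpow_rpow_one_sub {A : K →L[ℂ] K} (hA : 0 ≤ A) {s : ℝ} (h0 : 0 < s) (h1 : s < 1) :
    trMul (A ^ s) (A ^ (1 - s)) = ptrace A := by
  rw [trMul, sqrt_rpow A h0.le, rpow_mul_rpow A (by positivity) (by linarith),
    rpow_mul_rpow A (by linarith) (by positivity)]
  ring_nf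
  rw [CFC.rpow_one A hA]

theorem petzDiv_eq_trMul {A B : K →L[ℂ] K} {s : ℝ} (h0 : 0 ≤ s) :
    petzDiv (1 - s) A B = (((-s)⁻¹ : ℝ) : EReal) * ENNReal.log (trMul (opPow B s) (opPow A (1 - s))) := by
  rw [petzDiv, trMul, opPow, opPow, sqrt_rpow B h0]
  ring_nf

end TraceTheory


/-! ### Bases of eigenvectors of positive trace class operators. -/

section Eigen

variable {K : Type*} [NormedAddCommGroup K] [InnerProductSpace ℂ K] [CompleteSpace K]
variable {ι κ : Type*}

/-- `e` is a basis of eigenvectors of `T` with eigenvalues `a`. -/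
def IsEigen (T : K →L[ℂ] K) (e : HilbertBasis ι ℂ K) (a : ι → ℝ) : Prop :=
  ∀ i, T (e i) = (a i : ℂ) • e i

theorem norm_hilbertBasis (e : HilbertBasis ι ℂ K) (i : ι) : ‖e i‖ = 1 := e.orthonormal.1 i

theorem hilbertBasis_ne_zero (e : HilbertBasis ι ℂ K) (i : ι) : e i ≠ 0 := by
  intro h
  simpa [h] using norm_hilbertBasis e i

theorem re_inner_eigenvector {T : K →L[ℂ] K} {v : K} {l : ℝ} (h : T v = (l : ℂ) • v) :
    (inner ℂ v (T v)).re = l * ‖v‖ ^ 2 := by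
  rw [h, inner_smul_right, inner_self_eq_norm_sq_to_K]
  change ((l : ℂ) * (‖v‖ : ℂ) ^ 2).re = _
  rw [← Complex.ofReal_pow, ← Complex.ofReal_mul, Complex.ofReal_re]

theorem eigenvalue_nonneg {T : K →L[ℂ] K} (hT : 0 ≤ T) {v : K} (hv : v ≠ 0) {l : ℝ}
    (h : T v = (l : ℂ) • v) : 0 ≤ l := by
  have h1 := re_inner_nonneg_of_nonneg hT v
  rw [re_inner_eigenvector h] at h1
  have : 0 < ‖v‖ ^ 2 := by positivity
  nlinarith [mul_nonneg_iff_of_pos_right this |>.1 h1]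

theorem IsEigen.nonneg {T : K →L[ℂ] K} (hT : 0 ≤ T) {e : HilbertBasis ι ℂ K} {a : ι → ℝ}
    (h : IsEigen T e a) (i : ι) : 0 ≤ a i :=
  eigenvalue_nonneg hT (hilbertBasis_ne_zero e i) (h i)

theorem IsEigen.ptrace_eq {T : K →L[ℂ] K} (hT : 0 ≤ T) {e : HilbertBasis ι ℂ K} {a : ι → ℝ}
    (h : IsEigen T e a) : ptrace T = ∑' i, ENNReal.ofReal (a i) := by
  rw [ptrace_eq_tsum e hT]
  refine tsum_congr fun i => ?_
  rw [re_inner_eigenvector (h i), norm_hilbertBasis]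
  simp

theorem eigenvalue_mem_spectrum {T : K →L[ℂ] K} {v : K} (hv : v ≠ 0) {l : ℝ}
    (h : T v = (l : ℂ) • v) : l ∈ spectrum ℝ T := by
  intro hu
  rw [spectrum.mem_resolventSet_iff] at hu
  obtain ⟨u, hu⟩ := hu
  have h1 : (u : K →L[ℂ] K) v = 0 := by
    rw [hu, sub_apply, h, Algebra.algebraMap_eq_smul_one, smul_apply]
    simp
  have h2 : ((↑u⁻¹ : K →L[ℂ] K) * (u : K →L[ℂ] K)) v = v := by simp
  rw [mul_apply_eq_comp, h1, map_zero] at h2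
  exact hv h2.symm

/-- The functions with this property form a closed subalgebra containing the constants and the
identity, so Stone-Weierstrass gives all continuous functions. -/
theorem cfcHom_apply_eigenvector {T : K →L[ℂ] K} (hT : IsSelfAdjoint T) {v : K} {l : ℝ}
    (hl : l ∈ spectrum ℝ T) (h : T v = (l : ℂ) • v) (f : C(spectrum ℝ T, ℝ)) :
    cfcHom hT f v = ((f ⟨l, hl⟩ : ℝ) : ℂ) • v := by
  induction f using ContinuousMap.induction_on_of_compact with
  | const r =>
    have : (ContinuousMap.const (spectrum ℝ T) r) = algebraMap ℝ C(spectrum ℝ T, ℝ) r := rfl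
    rw [this, AlgHomClass.commutes, Algebra.algebraMap_eq_smul_one]
    simp
  | id =>
    rw [cfcHom_id hT, h]; rfl
  | star_id =>
    rw [map_star, cfcHom_id hT, hT.star_eq, h]; rfl
  | add f g hf hg =>
    simp [hf, hg, add_smul]
  | mul f g hf hg =>
    rw [map_mul, mul_apply_eq_comp, hg, map_smul, hf, smul_smul]
    simp [mul_comm]
  | frequently f hf =>
    refine hf.mem_of_closed (isClosed_eq ?_ ?_)
    · have : Continuous (cfcHom hT : C(spectrum ℝ T, ℝ) → K →L[ℂ] K) := cfcHom_continuous hT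
      fun_prop
    · have : Continuous fun g : C(spectrum ℝ T, ℝ) => g ⟨l, hl⟩ := by fun_prop
      fun_prop

theorem rpow_apply_eigenvector {T : K →L[ℂ] K} (hT : 0 ≤ T) {v : K} {l : ℝ}
    (h : T v = (l : ℂ) • v) {s : ℝ} (hs : 0 ≤ s) : (T ^ s) v = ((l ^ s : ℝ) : ℂ) • v := by
  rcases eq_or_ne v 0 with rfl | hv
  · simp
  have hT' : IsSelfAdjoint T := hT.isSelfAdjoint
  have hf : ContinuousOn (fun x : ℝ => x ^ s) (spectrum ℝ T) :=
    (Real.continuous_rpow_const hs).continuousOn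
  rw [CFC.rpow_eq_cfc_real hT, cfc_apply (fun x : ℝ => x ^ s) T hT' hf,
    cfcHom_apply_eigenvector hT' (eigenvalue_mem_spectrum hv h) h]
  rfl

theorem IsEigen.opPow {T : K →L[ℂ] K} (hT : 0 ≤ T) {e : HilbertBasis ι ℂ K} {a : ι → ℝ}
    (h : IsEigen T e a) {s : ℝ} (hs : 0 ≤ s) : IsEigen (opPow T s) e fun i => a i ^ s :=
  fun i => rpow_apply_eigenvector hT (h i) hs

/-- Expanding the trace in the basis `e` extracts the factor `a i`; Parseval in the basis `f`,
applied to `CFC.sqrt B (e i)`, then gives the weights and the `b j`. -/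
theorem IsEigen.trMul_eq {A B : K →L[ℂ] K} (hA : 0 ≤ A) (hB : 0 ≤ B) {e : HilbertBasis ι ℂ K}
    {f : HilbertBasis κ ℂ K} {a : ι → ℝ} {b : κ → ℝ} (ha : IsEigen A e a) (hb : IsEigen B f b) :
    trMul A B = ∑' i, ∑' j, ENNReal.ofReal (‖inner ℂ (e i) (f j)‖ ^ 2) *
      ENNReal.ofReal (a i * b j) := by
  rw [trMul, ptrace_eq_tsum e (sqrt_conj_nonneg A hB)]
  refine tsum_congr fun i => ?_
  have ha' : CFC.sqrt A (e i) = ((a i ^ (1 / 2 : ℝ) : ℝ) : ℂ) • e i := by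
    rw [CFC.sqrt_eq_rpow]; exact rpow_apply_eigenvector hA (ha i) (by norm_num)
  have ha0 := ha.nonneg hA i
  have h1 : inner ℂ (e i) ((CFC.sqrt A * B * CFC.sqrt A) (e i)) =
      ((a i : ℝ) : ℂ) * inner ℂ (e i) (B (e i)) := by
    have h2 : inner ℂ (e i) ((CFC.sqrt A * B * CFC.sqrt A) (e i)) =
        inner ℂ (CFC.sqrt A (e i)) (B (CFC.sqrt A (e i))) := by
      conv_rhs => rw [← star_sqrt A]
      rw [ContinuousLinearMap.star_eq_adjoint, ContinuousLinearMap.adjoint_inner_left,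
        ← ContinuousLinearMap.star_eq_adjoint, star_sqrt]
      rfl
    rw [h2, ha', map_smul, inner_smul_left, inner_smul_right, ← mul_assoc, Complex.conj_ofReal,
      ← Complex.ofReal_mul, ← Real.rpow_add_of_nonneg ha0 (by norm_num) (by norm_num)]
    norm_num
  rw [h1, Complex.re_ofReal_mul, ENNReal.ofReal_mul ha0]
  have h3 : ENNReal.ofReal (inner ℂ (e i) (B (e i))).re =
      ∑' j, ENNReal.ofReal (‖inner ℂ (e i) (f j)‖ ^ 2) * ENNReal.ofReal (b j) := by
    have hB2 := CFC.sqrt_mul_sqrt_self B hB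
    have h4 := star_mul_self_re_inner (CFC.sqrt B) (e i)
    rw [star_sqrt, hB2] at h4
    rw [h4, ← HilbertBasis.tsum_ofReal_norm_inner_sq f]
    refine tsum_congr fun j => ?_
    have hb' : CFC.sqrt B (f j) = ((b j ^ (1 / 2 : ℝ) : ℝ) : ℂ) • f j := by
      rw [CFC.sqrt_eq_rpow]; exact rpow_apply_eigenvector hB (hb j) (by norm_num)
    have hb0 := hb.nonneg hB j
    have hn : ‖((b j ^ (1 / 2 : ℝ) : ℝ) : ℂ)‖ ^ 2 = b j := by
      rw [Complex.norm_real, Real.norm_of_nonneg (by positivity), ← Real.rpow_mul_natCast hb0]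
      norm_num
    rw [← star_sqrt B, ContinuousLinearMap.star_eq_adjoint,
      ContinuousLinearMap.adjoint_inner_right, hb', inner_smul_left, norm_mul, mul_pow,
      RCLike.norm_conj, hn, ← inner_conj_symm (f j), RCLike.norm_conj, mul_comm,
      ENNReal.ofReal_mul (by positivity)]
  rw [h3, ← ENNReal.tsum_mul_left]
  refine tsum_congr fun j => ?_
  rw [ENNReal.ofReal_mul ha0]
  ring

theorem eq_of_apply_eq (e : HilbertBasis ι ℂ K) {S T : K →L[ℂ] K}
    (h : ∀ i, S (e i) = T (e i)) : S = T := by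
  refine ContinuousLinearMap.ext_on (s := Set.range e) ?_ ?_
  · exact Submodule.dense_iff_topologicalClosure_eq_top.2 e.dense_span
  · rintro _ ⟨i, rfl⟩
    exact h i

/-- A Hilbert-Schmidt operator is the norm limit of its finite rank truncations, the error being
controlled by the tail of the sum. -/
theorem isCompactOperator_of_tsum_ne_top (b : HilbertBasis ι ℂ K) {X : K →L[ℂ] K}
    (h : ∑' i, ENNReal.ofReal (‖star X (b i)‖ ^ 2) ≠ ⊤) : IsCompactOperator X := by
  classical
  let F : Finset ι → K →L[ℂ] K := fun s => ∑ i ∈ s, InnerProductSpace.rankOne ℂ (b i) (star X (b i))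
  have hF : ∀ s, IsCompactOperator (F s) := by
    intro s
    refine (compactOperator (RingHom.id ℂ) K K).sum_mem fun i _ => ?_
    change IsCompactOperator _
    have h1 : IsCompactOperator (ContinuousLinearMap.toSpanSingleton ℂ (b i)) :=
      isCompactOperator_of_locallyCompactSpace_rng (ContinuousLinearMap.toSpanSingleton ℂ (b i))
    exact h1.comp_clm (innerSL ℂ (star X (b i)))
  have hsum : Summable fun i => ‖star X (b i)‖ ^ 2 := by
    have := ENNReal.summable_toReal h
    simpa [ENNReal.toReal_ofReal] using this
  have hbound : ∀ s v, ‖(X - F s) v‖ ^ 2 ≤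
      (∑' i : {i // i ∉ s}, ‖star X (b i)‖ ^ 2) * ‖v‖ ^ 2 := by
    intro s v
    have hw : ∀ i, b.repr ((X - F s) v) i = if i ∈ s then 0 else inner ℂ (star X (b i)) v := by
      intro i
      rw [b.repr_apply_apply]
      have hX : inner ℂ (b i) (X v) = inner ℂ (star X (b i)) v := by
        rw [ContinuousLinearMap.star_eq_adjoint, ContinuousLinearMap.adjoint_inner_left]
      have hb := orthonormal_iff_ite.1 b.orthonormal i
      simp only [sub_apply, inner_sub_right, hX, F, sum_apply, InnerProductSpace.rankOne_apply,
        inner_sum, inner_smul_right, hb]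
      by_cases hi : i ∈ s <;> simp [hi]
    have h0 := norm_sq_eq (b.repr ((X - F s) v))
    rw [b.repr.norm_map] at h0
    rw [h0, ← tsum_mul_right]
    have h1 : (fun i => ‖b.repr ((X - F s) v) i‖ ^ 2) = Set.indicator {i | i ∉ s}
        (fun i => ‖inner ℂ (star X (b i)) v‖ ^ 2) := by
      ext i
      rw [hw]
      by_cases hi : i ∈ s <;> simp [hi, Set.indicator]
    have h2 : Summable fun i => ‖inner ℂ (star X (b i)) v‖ ^ 2 := by
      refine Summable.of_nonneg_of_le (fun _ => by positivity) (fun i => ?_)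
        (hsum.mul_right (‖v‖ ^ 2))
      rw [← mul_pow]
      exact pow_le_pow_left₀ (norm_nonneg _) (norm_inner_le_norm _ _) 2
    rw [h1, ← tsum_subtype]
    refine Summable.tsum_le_tsum (fun i => ?_) (h2.subtype _) ((hsum.subtype _).mul_right _)
    rw [← mul_pow]
    exact pow_le_pow_left₀ (norm_nonneg _) (norm_inner_le_norm _ _) 2
  have hle : ∀ s, ‖F s - X‖ ≤ Real.sqrt (∑' i : {i // i ∉ s}, ‖star X (b i)‖ ^ 2) := by
    intro s
    rw [norm_sub_rev]
    refine ContinuousLinearMap.opNorm_le_bound _ (Real.sqrt_nonneg _) fun v => ?_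
    have h0 : 0 ≤ ∑' i : {i // i ∉ s}, ‖star X (b i)‖ ^ 2 := tsum_nonneg fun _ => by positivity
    refine le_of_sq_le_sq ?_ (by positivity)
    rw [mul_pow, Real.sq_sqrt h0]
    exact hbound s v
  refine isCompactOperator_of_tendsto (l := Filter.atTop) (F := F) ?_ (Filter.Eventually.of_forall hF)
  rw [tendsto_iff_norm_sub_tendsto_zero]
  refine squeeze_zero (fun _ => norm_nonneg _) hle ?_
  have := (tendsto_tsum_compl_atTop_zero fun i => ‖star X (b i)‖ ^ 2)
  have h3 := (Real.continuous_sqrt.tendsto 0).comp this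
  rwa [Real.sqrt_zero] at h3

theorem isCompactOperator_of_ptrace_ne_top {T : K →L[ℂ] K} (hT : 0 ≤ T) (h : ptrace T ≠ ⊤) :
    IsCompactOperator T := by
  have h1 := CFC.sqrt_mul_sqrt_self T hT
  have h2 := ptrace_star_mul_self (stdBasis K) (star (CFC.sqrt T))
  simp only [star_sqrt, h1] at h2
  have h3 : IsCompactOperator (CFC.sqrt T : K →L[ℂ] K) :=
    isCompactOperator_of_tsum_ne_top (stdBasis K) (by rw [star_sqrt, ← h2]; exact h)
  have h4 : IsCompactOperator (CFC.sqrt T * CFC.sqrt T : K →L[ℂ] K) :=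
    h3.comp_clm (CFC.sqrt T : K →L[ℂ] K)
  rwa [h1] at h4

/-- `Eigenbasis` is indexed by a subset of `K`; an arbitrary index type is moved there along the
injection `e`. -/
theorem IsEigen.nonempty_eigenbasis {T : K →L[ℂ] K} {e : HilbertBasis ι ℂ K} {a : ι → ℝ}
    (h : IsEigen T e a) : Nonempty (Eigenbasis T) := by
  have hinj : Function.Injective e := e.orthonormal.linearIndependent.injective
  let g := Equiv.ofInjective e hinj
  have ho : Orthonormal ℂ ((↑) : Set.range e → K) := e.orthonormal.toSubtypeRange
  have hd : ⊤ ≤ (Submodule.span ℂ (Set.range ((↑) : Set.range e → K))).topologicalClosure := by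
    rw [Subtype.range_coe, e.dense_span]
  refine ⟨⟨Set.range e, HilbertBasis.mk ho hd, fun i => a (g.symm i), fun i => ?_⟩⟩
  obtain ⟨j, rfl⟩ := g.surjective i
  rw [HilbertBasis.coe_mk, Equiv.symm_apply_apply]
  exact h j

/-- A positive operator of finite trace is compact and symmetric, so its eigenspaces span a dense
subspace; orthonormal bases of the eigenspaces are glued together. -/
theorem exists_eigenbasis {T : K →L[ℂ] K} (hT : 0 ≤ T) (h : ptrace T ≠ ⊤) :
    Nonempty (Eigenbasis T) := by
  classical
  have hc := isCompactOperator_of_ptrace_ne_top hT h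
  have hs : (T : K →ₗ[ℂ] K).IsSymmetric :=
    ((ContinuousLinearMap.nonneg_iff_isPositive T).1 hT).isSymmetric
  have hbot := ContinuousLinearMap.orthogonalComplement_iSup_eigenspaces_eq_bot hc hs
  have ho := hs.orthogonalFamily_eigenspaces
  have hcl : ∀ μ, CompleteSpace (Module.End.eigenspace (T : K →ₗ[ℂ] K) μ) := by
    intro μ
    refine IsClosed.completeSpace_coe (hs := ?_)
    have : (Module.End.eigenspace (T : K →ₗ[ℂ] K) μ : Set K) = {v | T v = μ • v} := by
      ext v; simp
    rw [this]
    exact isClosed_eq T.continuous (continuous_const_smul μ)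
  choose w b hb using fun μ => exists_hilbertBasis ℂ (Module.End.eigenspace (T : K →ₗ[ℂ] K) μ)
  let v : (Σ μ, w μ) → K := fun i => (b i.1 i.2 : K)
  have hv : Orthonormal ℂ v := ho.orthonormal_sigma_orthonormal fun μ => (b μ).orthonormal
  have hTv : ∀ i, T (v i) = i.1 • v i := fun i =>
    Module.End.mem_eigenspace_iff.1 (b i.1 i.2).2
  have htot : (Submodule.span ℂ (Set.range v))ᗮ = ⊥ := by
    rw [eq_bot_iff, ← hbot]
    intro x hx
    rw [Submodule.mem_orthogonal] at hx ⊢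
    have hx' : ∀ μ, ∀ y : Module.End.eigenspace (T : K →ₗ[ℂ] K) μ, inner ℂ (y : K) x = 0 := by
      intro μ y
      have hd := (b μ).dense_span
      have hcont : IsClosed {y : Module.End.eigenspace (T : K →ₗ[ℂ] K) μ | inner ℂ (y : K) x = 0} :=
        isClosed_eq (by fun_prop) continuous_const
      have hsub : ((Submodule.span ℂ (Set.range (b μ))).topologicalClosure : Set _) ⊆
          {y : Module.End.eigenspace (T : K →ₗ[ℂ] K) μ | inner ℂ (y : K) x = 0} := by
        refine closure_minimal ?_ hcont
        intro y hy
        induction hy using Submodule.span_induction with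
        | mem y hy =>
          obtain ⟨i, rfl⟩ := hy
          exact hx _ (Submodule.subset_span ⟨⟨μ, i⟩, rfl⟩)
        | zero => simp
        | add y z _ _ hy hz =>
          simp only [Set.mem_ofPred_eq] at hy hz ⊢
          simp [hy, hz]
        | smul c y _ hy =>
          simp only [Set.mem_ofPred_eq] at hy ⊢
          simp [hy]
      rw [hd] at hsub
      exact hsub trivial
    intro u hu
    induction hu using Submodule.iSup_induction' with
    | mem μ y hy => exact hx' μ ⟨y, hy⟩
    | zero => simp
    | add y z _ _ hy hz => simp [inner_add_left, hy, hz]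
  let e := HilbertBasis.mkOfOrthogonalEqBot hv htot
  have he : ∀ i, e i = v i := fun i => by rw [HilbertBasis.coe_mkOfOrthogonalEqBot]
  refine IsEigen.nonempty_eigenbasis (e := e) (a := fun i => i.1.re) fun i => ?_
  have h1 := hTv i
  rw [he, h1]
  have h2 : (inner ℂ (v i) (T (v i))) = i.1 := by
    rw [h1, inner_smul_right, inner_self_eq_norm_sq_to_K, hv.1 i]
    simp
  -- The eigenvalues of a symmetric operator are real.
  have h3 : (i.1.re : ℂ) = i.1 := by
    rw [← Complex.conj_eq_iff_re, ← h2]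
    rw [inner_conj_symm]
    exact hs _ _
  rw [h3]

end Eigen


/-! ### Hypothesis tests for two positive operators, and the merging of tests. -/

section OneShot

variable {K : Type*} [NormedAddCommGroup K] [InnerProductSpace ℂ K] [CompleteSpace K]

theorem conj_nonneg_of_selfAdjoint {A X : K →L[ℂ] K} (hA : 0 ≤ A) (hX : star X = X) :
    0 ≤ X * A * X := by
  have := star_left_conjugate_nonneg hA X
  rwa [hX] at this

theorem trMul_eq_zero_of_mul_eq_zero {A T : K →L[ℂ] K} (hA : 0 ≤ A) (hT : star T = T)
    (hT2 : T * T = T) (h : A * T = 0) : trMul A T = 0 := by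
  have h1 := trMul_star_mul_self hA T
  have h2 : T * A = 0 := by
    have := congrArg star h
    rwa [star_mul, hT, hA.isSelfAdjoint.star_eq, star_zero] at this
  rw [hT, hT2, h2, zero_mul, ptrace_zero] at h1
  exact h1

theorem trMul_eq_ptrace_of_mul_eq {A T : K →L[ℂ] K} (hA : 0 ≤ A) (hT : star T = T)
    (hT2 : T * T = T) (h : T * A = A) : trMul A T = ptrace A := by
  have h1 := trMul_star_mul_self hA T
  have h2 : A * T = A := by
    have := congrArg star h
    rwa [star_mul, hT, hA.isSelfAdjoint.star_eq] at this
  rwa [hT, hT2, h, h2] at h1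

/-- The projection onto the closed range of a positive operator. -/
theorem exists_support_projection {P N : K →L[ℂ] K} (hP : 0 ≤ P) (hN : 0 ≤ N) (h : P * N = 0) :
    ∃ T : K →L[ℂ] K, 0 ≤ T ∧ T ≤ 1 ∧ trMul P T = ptrace P ∧ trMul N T = 0 := by
  let U : Submodule ℂ K := (LinearMap.range (P : K →ₗ[ℂ] K)).topologicalClosure
  have : CompleteSpace U :=
    (Submodule.isClosed_topologicalClosure _).completeSpace_coe
  have hproj := isStarProjection_starProjection (U := U)
  have hs : star U.starProjection = U.starProjection := hproj.isSelfAdjoint.star_eq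
  have hi : U.starProjection * U.starProjection = U.starProjection := hproj.isIdempotentElem
  have hNP : N * P = 0 := by
    have := congrArg star h
    rwa [star_mul, hP.isSelfAdjoint.star_eq, hN.isSelfAdjoint.star_eq, star_zero] at this
  refine ⟨U.starProjection, hproj.nonneg, ?_, ?_, ?_⟩
  · exact sub_nonneg.1 hproj.one_sub.nonneg
  -- The witness is the projection onto the closure of the range of `P`: it fixes `P`, and it
  -- annihilates `N` because this closure lies in the kernel of `N`.
  · refine trMul_eq_ptrace_of_mul_eq hP hs hi ?_
    ext v
    rw [mul_apply_eq_comp, Submodule.starProjection_eq_self_iff]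
    exact Submodule.le_topologicalClosure _ ⟨v, rfl⟩
  · refine trMul_eq_zero_of_mul_eq_zero hN hs hi ?_
    ext v
    rw [mul_apply_eq_comp]
    have hcl : IsClosed {y : K | N y = 0} := isClosed_eq N.continuous continuous_const
    have hsub : (U : Set K) ⊆ {y : K | N y = 0} := by
      refine closure_minimal ?_ hcl
      rintro _ ⟨y, rfl⟩
      exact congrArg (fun X : K →L[ℂ] K => X y) hNP
    exact hsub (Submodule.starProjection_apply_mem U v)

/-- The Jordan decomposition of `A - B`, and a test that separates its two parts. -/
theorem exists_jordan_test {A B : K →L[ℂ] K} (hA : 0 ≤ A) (hB : 0 ≤ B) :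
    ∃ P N T : K →L[ℂ] K, 0 ≤ P ∧ 0 ≤ N ∧ A + N = B + P ∧ CFC.abs (A - B) = P + N ∧
      0 ≤ T ∧ T ≤ 1 ∧ trMul A T = trMul B T + ptrace P := by
  have hD : IsSelfAdjoint (A - B) := hA.isSelfAdjoint.sub hB.isSelfAdjoint
  have hP := CFC.posPart_nonneg (A - B)
  have hN := CFC.negPart_nonneg (A - B)
  have h1 := CFC.posPart_sub_negPart (A - B) hD
  obtain ⟨T, hT0, hT1, hT2, hT3⟩ :=
    exists_support_projection hP hN (CFC.posPart_mul_negPart (A - B))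
  have h2 : A + (A - B)⁻ = B + (A - B)⁺ := by
    rw [sub_eq_iff_eq_add] at h1
    rw [h1]; abel
  refine ⟨_, _, T, hP, hN, h2, (CFC.posPart_add_negPart (A - B) hD).symm, hT0, hT1, ?_⟩
  have h3 : trMul (A + (A - B)⁻) T = trMul (B + (A - B)⁺) T := by rw [h2]
  rwa [trMul_add_left hA hN hT0, trMul_add_left hB hP hT0, hT3, hT2, add_zero] at h3

/-- The quantum Chernoff bound. -/
theorem ptrace_le_trMul_rpow_add {A B P N : K →L[ℂ] K} (hA : 0 ≤ A) (hB : 0 ≤ B) (hP : 0 ≤ P)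
    (hN : 0 ≤ N) (h : A + N = B + P) (hBf : ptrace B ≠ ⊤) {s : ℝ} (h0 : 0 < s) (h1 : s < 1) :
    ptrace A ≤ trMul (B ^ s) (A ^ (1 - s)) + ptrace P := by
  -- With `C = B + P`, operator monotonicity of `t ^ s` and `t ^ (1 - s)` gives `Tr A ≤ Tr C^s
  -- A^(1-s) = Tr B^s A^(1-s) + Tr (C^s - B^s) A^(1-s)`. The last term is at most `Tr (C^s - B^s)
  -- C^(1-s) = Tr C - Tr B^s C^(1-s) ≤ Tr C - Tr B = Tr P`. In `[0, ∞]` the subtraction of `Tr B` is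
  -- a cancellation, which needs `Tr B` finite.
  have hAC : A ≤ B + P := h ▸ le_add_of_nonneg_right hN
  have hBC : B ≤ B + P := le_add_of_nonneg_right hP
  have hC : 0 ≤ B + P := add_nonneg hB hP
  have hs : s ∈ Set.Icc (0 : ℝ) 1 := ⟨h0.le, h1.le⟩
  have hs' : 1 - s ∈ Set.Icc (0 : ℝ) 1 := ⟨by linarith, by linarith⟩
  have hY : 0 ≤ (B + P) ^ s - B ^ s := sub_nonneg.2 (CFC.rpow_le_rpow hs hBC)
  have hBs : 0 ≤ B ^ s := CFC.rpow_nonneg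
  have hY2 : B ^ s + ((B + P) ^ s - B ^ s) = (B + P) ^ s := by abel
  have e1 : trMul ((B + P) ^ s) (A ^ (1 - s)) =
      trMul (B ^ s) (A ^ (1 - s)) + trMul ((B + P) ^ s - B ^ s) (A ^ (1 - s)) := by
    rw [← trMul_add_left hBs hY CFC.rpow_nonneg, hY2]
  have e2 : ptrace B + ptrace P = trMul (B ^ s) ((B + P) ^ (1 - s)) +
      trMul ((B + P) ^ s - B ^ s) ((B + P) ^ (1 - s)) := by
    rw [← trMul_add_left hBs hY CFC.rpow_nonneg, hY2, trMul_rpow_rpow_one_sub hC h0 h1,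
      ptrace_add hB hP]
  have e3 : ptrace B ≤ trMul (B ^ s) ((B + P) ^ (1 - s)) := by
    rw [← trMul_rpow_rpow_one_sub hB h0 h1]
    exact trMul_mono_right _ (CFC.rpow_le_rpow hs' hBC)
  have e4 : trMul ((B + P) ^ s - B ^ s) ((B + P) ^ (1 - s)) ≤ ptrace P := by
    have : ptrace B + trMul ((B + P) ^ s - B ^ s) ((B + P) ^ (1 - s)) ≤ ptrace B + ptrace P := by
      rw [e2]; gcongr
    exact (ENNReal.add_le_add_iff_left hBf).1 this
  calc ptrace A = trMul (A ^ s) (A ^ (1 - s)) := (trMul_rpow_rpow_one_sub hA h0 h1).symm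
    _ ≤ trMul ((B + P) ^ s) (A ^ (1 - s)) :=
        trMul_mono_left CFC.rpow_nonneg CFC.rpow_nonneg (CFC.rpow_le_rpow hs hAC)
    _ ≤ _ := by
        rw [e1]
        gcongr
        exact (trMul_mono_right _ (CFC.rpow_le_rpow hs' hAC)).trans e4

/-- The Jordan test has error sum `Tr A - Tr P`, where `P` is the positive part of `A - B`, and the
Chernoff bound estimates exactly this difference. -/
theorem exists_test {A B : K →L[ℂ] K} (hA : 0 ≤ A) (hB : 0 ≤ B) (hAf : ptrace A ≠ ⊤)
    (hBf : ptrace B ≠ ⊤) {s : ℝ} (h0 : 0 < s) (h1 : s < 1) :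
    ∃ T : K →L[ℂ] K, 0 ≤ T ∧ T ≤ 1 ∧
      trMul A (1 - T) + trMul B T ≤ trMul (opPow B s) (opPow A (1 - s)) := by
  obtain ⟨P, N, T, hP, hN, h, -, hT0, hT1, hT⟩ := exists_jordan_test hA hB
  have hsum := trMul_add_trMul_one_sub hA hT0 hT1
  have hPf : ptrace P ≠ ⊤ := by
    refine ne_top_of_le_ne_top hAf ?_
    rw [← hsum, hT]
    exact le_add_self.trans le_self_add
  refine ⟨T, hT0, hT1, ?_⟩
  have := ptrace_le_trMul_rpow_add hA hB hP hN h hBf h0 h1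
  rw [← hsum, hT] at this
  refine (ENNReal.add_le_add_iff_right hPf).1 (le_trans (le_of_eq ?_) this)
  ring

theorem one_le_add_traceNorm {A B T : K →L[ℂ] K} (hA : IsDensity A) (hB : IsDensity B)
    (hT0 : 0 ≤ T) (hT1 : T ≤ 1) :
    1 ≤ trMul A (1 - T) + trMul B T + 2⁻¹ * traceNorm (A - B) := by
  obtain ⟨P, N, -, hP, hN, h, habs, -⟩ := exists_jordan_test hA.1 hB.1
  have htr := congrArg ptrace h
  rw [ptrace_add hA.1 hN, ptrace_add hB.1 hP, hA.2, hB.2] at htr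
  -- Equal traces of `A` and `B` force the two Jordan parts to have equal trace, so half the trace
  -- norm is `Tr P`.
  have hPN : ptrace N = ptrace P := (ENNReal.add_right_inj ENNReal.one_ne_top).1 htr
  have hnorm : 2⁻¹ * traceNorm (A - B) = ptrace P := by
    rw [traceNorm, habs, ptrace_add hP hN, hPN, ← two_mul, ← mul_assoc,
      ENNReal.inv_mul_cancel (by norm_num) (by norm_num), one_mul]
  have h3 : trMul A T ≤ trMul B T + ptrace P :=
    calc trMul A T ≤ trMul (A + N) T := by
          rw [trMul_add_left hA.1 hN hT0]; exact le_self_add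
      _ = trMul B T + trMul P T := by rw [h, trMul_add_left hB.1 hP hT0]
      _ ≤ _ := by gcongr; exact trMul_le_ptrace hP hT1
  rw [hnorm, ← hA.2, ← trMul_add_trMul_one_sub hA.1 hT0 hT1, add_assoc, add_comm (trMul A T)]
  gcongr

theorem traceNorm_sub_le {A B : K →L[ℂ] K} (hA : IsDensity A) (hB : IsDensity B) :
    2⁻¹ * traceNorm (A - B) ≤ 1 := by
  obtain ⟨P, N, T, hP, hN, h, habs, hT0, hT1, hT⟩ := exists_jordan_test hA.1 hB.1
  have htr := congrArg ptrace h
  rw [ptrace_add hA.1 hN, ptrace_add hB.1 hP, hA.2, hB.2] at htr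
  have hPN : ptrace N = ptrace P := (ENNReal.add_right_inj ENNReal.one_ne_top).1 htr
  rw [traceNorm, habs, ptrace_add hP hN, hPN, ← two_mul, ← mul_assoc,
    ENNReal.inv_mul_cancel (by norm_num) (by norm_num), one_mul, ← hA.2]
  exact (le_add_self.trans_eq hT.symm).trans (trMul_le_ptrace hA.1 hT1)

/-- The operator `G = 4 S (1 + S)⁻²`. -/
theorem exists_soft_union {S : K →L[ℂ] K} (hS : 0 ≤ S) :
    ∃ G : K →L[ℂ] K, 0 ≤ G ∧ G ≤ 1 ∧ G ≤ (4 : ℝ) • S ∧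
      ∀ T R : K →L[ℂ] K, 0 ≤ T → T ≤ 1 → 0 ≤ R → S = T + R →
        1 - G ≤ (2 : ℝ) • (1 - T) + (2 : ℝ) • R := by
  have hu : IsUnit (1 + S) :=
    CStarAlgebra.isUnit_of_le (1 : K →L[ℂ] K) (le_add_of_nonneg_right hS)
  obtain ⟨u, hu⟩ := hu
  -- With `Z = (1 + S)⁻¹` one has `S (1 + S)⁻² = Z - Z * Z`, so everything below is an identity in
  -- `Z` and `S`, which commute. Each order relation is proved by displaying the difference as a sum
  -- of positive terms.
  set Z : K →L[ℂ] K := ↑u⁻¹ with hZdef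
  have hZ1 : Z * (1 + S) = 1 := by rw [← hu]; exact u.inv_mul
  have hZ2 : (1 + S) * Z = 1 := by rw [← hu]; exact u.mul_inv
  have hSs : star S = S := hS.isSelfAdjoint.star_eq
  have hZs : star Z = Z := by
    have h := congrArg star hZ2
    rw [star_mul, star_add, star_one, hSs] at h
    exact left_inv_eq_right_inv h hZ2
  have hZS : Z * S = 1 - Z := by rw [mul_add, mul_one] at hZ1; rw [← hZ1]; abel
  have hSZ : S * Z = 1 - Z := by rw [add_mul, one_mul] at hZ2; rw [← hZ2]; abel
  have hZSZ : Z * S * Z = Z - Z * Z := by rw [hZS, sub_mul, one_mul]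
  have hp1 : 0 ≤ Z - Z * Z := hZSZ ▸ conj_nonneg_of_selfAdjoint hS hZs
  have hZZ : 0 ≤ Z * Z := by
    have := star_mul_self_nonneg Z
    rwa [hZs] at this
  have hZ0 : 0 ≤ Z := by
    have := add_nonneg hp1 hZZ
    rwa [sub_add_cancel] at this
  have hZle : 0 ≤ 1 - Z := by
    have h : star (S * Z) * (S * Z) = 1 - Z - (Z - Z * Z) := by
      rw [star_mul, hZs, hSs, hSZ, hZS]; noncomm_ring
    have h2 := add_nonneg (star_mul_self_nonneg (S * Z)) hp1
    rwa [h, sub_add_cancel] at h2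
  -- Completing the square: `1 - G = (2 Z - 1)²`. This gives `G ≤ 1` and is the form in which `1 -
  -- G` is estimated.
  have hGe : (4 : ℝ) • (Z - Z * Z) = 1 - star (2 • Z - 1) * (2 • Z - 1) := by
    rw [star_sub, star_nsmul, hZs, star_one]
    have : (4 : ℝ) • (Z - Z * Z) = 4 • (Z - Z * Z) := by
      rw [← Nat.cast_smul_eq_nsmul ℝ]; norm_num
    rw [this]
    noncomm_ring
  refine ⟨(4 : ℝ) • (Z - Z * Z), smul_nonneg (by norm_num) hp1, ?_, ?_, ?_⟩
  · rw [hGe]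
    exact sub_le_self _ (star_mul_self_nonneg _)
  · refine smul_le_smul_of_nonneg_left ?_ (by norm_num)
    rw [← sub_nonneg]
    have h1 : S - (Z - Z * Z) = S * Z * S + star (S * Z) * (S * Z) := by
      rw [star_mul, hZs, hSs, hSZ, hZS, sub_mul, sub_mul, mul_sub, hZS]
      noncomm_ring
    rw [h1]
    exact add_nonneg (conj_nonneg_of_selfAdjoint hZ0 hSs) (star_mul_self_nonneg _)
  · intro T R hT0 hT1 hR hSTR
    have hRs : star R = R := hR.isSelfAdjoint.star_eq
    have hTs : star T = T := hT0.isSelfAdjoint.star_eq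
    -- Uses `Z (1 + T + R) = 1`. It splits the square root of `1 - G` into a part from the failure
    -- of `T` and a part from the competing tests `R`.
    have hW : 2 • Z - 1 = Z * (1 - T) - Z * R := by
      have : Z * (1 - T) - Z * R = Z + Z - Z * (1 + S) := by rw [hSTR]; noncomm_ring
      rw [this, hZ1, two_smul]
    rw [hGe, sub_sub_cancel, hW]
    set a := Z * (1 - T) with ha
    set b := Z * R with hb
    -- The parallelogram identity separates the two parts, at the price of the factor `2`. It
    -- remains to bound `(1 - T) Z² (1 - T)` by `1 - T`, and `R Z² R` by `R`.
    have key : star (a - b) * (a - b) + star (a + b) * (a + b) =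
        2 • (star a * a) + 2 • (star b * b) := by
      simp only [star_sub, star_add]
      noncomm_ring
    have hab : star (a - b) * (a - b) ≤ 2 • (star a * a) + 2 • (star b * b) := by
      rw [← key]; exact le_add_of_nonneg_right (star_mul_self_nonneg _)
    have ha2 : star a * a ≤ 1 - T := by
      have e : star a * a = (1 - T) * (Z * Z) * (1 - T) := by
        rw [ha, star_mul, hZs, star_sub, star_one, hTs]; noncomm_ring
      have p1 := conj_nonneg_of_selfAdjoint (add_nonneg hZle hp1)
        (X := 1 - T) (by rw [star_sub, star_one, hTs])
      have p2 : 0 ≤ CFC.sqrt T * (1 - T) * CFC.sqrt T := sqrt_conj_nonneg T (sub_nonneg.2 hT1)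
      have e2 : CFC.sqrt T * (1 - T) * CFC.sqrt T = T - T * T := by
        have h : ∀ q : K →L[ℂ] K, q * (1 - q * q) * q = q * q - q * q * (q * q) := fun q => by
          noncomm_ring
        have h := h (CFC.sqrt T)
        rwa [CFC.sqrt_mul_sqrt_self T hT0] at h
      rw [e2] at p2
      rw [e, ← sub_nonneg]
      have e3 : 1 - T - (1 - T) * (Z * Z) * (1 - T) =
          (T - T * T) + (1 - T) * (1 - Z + (Z - Z * Z)) * (1 - T) := by noncomm_ring
      rw [e3]
      exact add_nonneg p2 p1
    have hb2 : star b * b ≤ R := by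
      have e : star b * b = R * (Z * Z) * R := by
        rw [hb, star_mul, hZs, hRs]; noncomm_ring
      have p1 := conj_nonneg_of_selfAdjoint hp1 hRs
      have p2 := star_left_conjugate_nonneg hR (1 - Z * R)
      have p3 := star_left_conjugate_nonneg (add_nonneg zero_le_one hT0) (Z * R)
      -- The gap `R - R Z R` is positive because `Z` is the inverse of `1 + T + R`, which dominates
      -- `R`; the two squares make this explicit.
      have e2 : star (1 - Z * R) * R * (1 - Z * R) + star (Z * R) * (1 + T) * (Z * R) =
          R - R * Z * R := by
        have hT : 1 + T = (1 + S) - R := by rw [hSTR]; abel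
        rw [hT, star_sub, star_one, star_mul, hZs, hRs]
        have : R * Z * (1 + S - R) * (Z * R) = R * (Z * (1 + S)) * (Z * R) - R * Z * R * (Z * R) := by
          noncomm_ring
        rw [this, hZ1]
        noncomm_ring
      have p4 := add_nonneg p2 p3
      rw [e2] at p4
      rw [e, ← sub_nonneg]
      have e3 : R - R * (Z * Z) * R = (R - R * Z * R) + R * (Z - Z * Z) * R := by noncomm_ring
      rw [e3]
      exact add_nonneg p4 p1
    refine hab.trans ?_
    have h2 : ∀ X : K →L[ℂ] K, (2 : ℝ) • X = 2 • X := fun X => by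
      rw [← Nat.cast_smul_eq_nsmul ℝ]; norm_num
    rw [h2, h2]
    gcongr

end OneShot


/-! ### The one-shot converse for random codebooks. -/

section RandomCoding

variable {K : Type*} [NormedAddCommGroup K] [InnerProductSpace ℂ K] [CompleteSpace K]

/-- Exchanging the letter `c m` with the spare letter `ω` is an involution of the pairs `(c, ω)`. -/
theorem sum_update_eq {Ω : Type*} [Fintype Ω] {M : ℕ} (m : Fin M)
    (f : (Fin M → Ω) → ℝ≥0∞) :
    ∑ c, ∑ ω, f (Function.update c m ω) = Fintype.card Ω * ∑ c, f c := by
  have h1 : ∑ q : (Fin M → Ω) × Ω, f (Function.update q.1 m q.2) =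
      ∑ q : (Fin M → Ω) × Ω, f q.1 := by
    have hinv : Function.Involutive fun q : (Fin M → Ω) × Ω =>
        (Function.update q.1 m q.2, q.1 m) := by
      rintro ⟨c, ω⟩
      simp
    exact Equiv.sum_comp hinv.toPerm fun q => f q.1
  rw [Fintype.sum_prod_type, Fintype.sum_prod_type] at h1
  rw [h1, Finset.mul_sum]
  simp

theorem trMul_real_smul_right {c : ℝ} (hc : 0 ≤ c) (A B : K →L[ℂ] K) :
    trMul A (c • B) = ENNReal.ofReal c * trMul A B := by
  rw [← trMul_smul_right hc, Complex.coe_smul]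

theorem isDensity_average {Ω : Type*} [Fintype Ω] [Nonempty Ω] {ρ : Ω → K →L[ℂ] K}
    (hρ : ∀ ω, IsDensity (ρ ω)) :
    IsDensity ((((Fintype.card Ω : ℝ)⁻¹ : ℝ) : ℂ) • ∑ ω, ρ ω) := by
  have h0 : 0 ≤ ∑ ω, ρ ω := Finset.sum_nonneg fun ω _ => (hρ ω).1
  refine ⟨smul_nonneg' (by positivity) h0, ?_⟩
  have hc : (Fintype.card Ω : ℝ) ≠ 0 := by positivity
  rw [ptrace_smul (by positivity), ptrace_sum _ fun ω _ => (hρ ω).1,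
    Finset.sum_congr rfl fun ω _ => (hρ ω).2, ENNReal.ofReal_inv_of_pos (by positivity)]
  simp only [ENNReal.ofReal_natCast, Finset.sum_const, Finset.card_univ, nsmul_eq_mul, mul_one]
  exact ENNReal.inv_mul_cancel (by simp) (by simp)

/-- This is independence of the codewords: an operator that ignores the codeword `m` sees only the
average of `ρ (c m)`. Sums over all codebooks stand for expectations. -/
theorem sum_trMul_resample {Ω : Type*} [Fintype Ω] [Nonempty Ω] {M : ℕ} {ρ : Ω → K →L[ℂ] K}
    (hρ : ∀ ω, 0 ≤ ρ ω) (m : Fin M) {Y : (Fin M → Ω) → K →L[ℂ] K} (hY : ∀ c, 0 ≤ Y c)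
    (hm : ∀ c ω, Y (Function.update c m ω) = Y c) :
    ∑ c, trMul (ρ (c m)) (Y c) =
      ∑ c, trMul ((((Fintype.card Ω : ℝ)⁻¹ : ℝ) : ℂ) • ∑ ω, ρ ω) (Y c) := by
  have h0 : 0 ≤ ∑ ω, ρ ω := Finset.sum_nonneg fun ω _ => hρ ω
  have h1 := sum_update_eq m fun c => trMul (ρ (c m)) (Y c)
  simp only [Function.update_self, hm] at h1
  have h2 : ∀ c, ∑ ω, trMul (ρ ω) (Y c) = Fintype.card Ω *
      trMul ((((Fintype.card Ω : ℝ)⁻¹ : ℝ) : ℂ) • ∑ ω, ρ ω) (Y c) := by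
    intro c
    rw [trMul_smul_left (by positivity) h0 (hY c), trMul_sum_left (hY c) _ fun ω _ => hρ ω,
      ENNReal.ofReal_inv_of_pos (by positivity), ENNReal.ofReal_natCast, ← mul_assoc,
      ENNReal.mul_inv_cancel (by simp) (by simp), one_mul]
  rw [Finset.sum_congr rfl fun c _ => h2 c, ← Finset.mul_sum] at h1
  exact ((ENNReal.mul_right_inj (by simp) (by simp)).1 h1).symm

/-- For each `m`, the sum of all tests is split into the test of codeword `m` and the tests of the
others, and the merged test is compared with this splitting. -/
theorem one_le_traceNorm_codebook {Ω : Type*} {M : ℕ} (hM : 0 < M) {ρ T : Ω → K →L[ℂ] K}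
    (hρ : ∀ ω, IsDensity (ρ ω)) (hT0 : ∀ ω, 0 ≤ T ω) (hT1 : ∀ ω, T ω ≤ 1) {σ : K →L[ℂ] K}
    (hσ : IsDensity σ) (c : Fin M → Ω) :
    1 ≤ (M : ℝ≥0∞)⁻¹ * ∑ m, (2 * trMul (ρ (c m)) (1 - T (c m)) +
        2 * trMul (ρ (c m)) (∑ m' ∈ Finset.univ.erase m, T (c m'))) +
      4 * ∑ m, trMul σ (T (c m)) +
      2⁻¹ * traceNorm ((M : ℂ)⁻¹ • ∑ m, ρ (c m) - σ) := by
  have hne : Nonempty (Fin M) := ⟨⟨0, hM⟩⟩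
  have hA := isDensity_average (Ω := Fin M) (ρ := fun m => ρ (c m)) fun m => hρ _
  have hS : 0 ≤ ∑ m, T (c m) := Finset.sum_nonneg fun m _ => hT0 _
  obtain ⟨G, hG0, hG1, hGS, hG⟩ := exists_soft_union hS
  have h1 := one_le_add_traceNorm hA hσ hG0 hG1
  have hMc : ((((Fintype.card (Fin M) : ℝ)⁻¹ : ℝ)) : ℂ) = (M : ℂ)⁻¹ := by simp
  have h2 : trMul ((((Fintype.card (Fin M) : ℝ)⁻¹ : ℝ) : ℂ) • ∑ m, ρ (c m)) (1 - G) =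
      (M : ℝ≥0∞)⁻¹ * ∑ m, trMul (ρ (c m)) (1 - G) := by
    rw [trMul_smul_left (by positivity) (Finset.sum_nonneg fun m _ => (hρ _).1) (sub_nonneg.2 hG1),
      trMul_sum_left (sub_nonneg.2 hG1) _ fun m _ => (hρ _).1,
      ENNReal.ofReal_inv_of_pos (by simpa using hM)]
    simp
  rw [h2, hMc] at h1
  refine h1.trans ?_
  gcongr with m hm
  · have hR : 0 ≤ ∑ m' ∈ Finset.univ.erase m, T (c m') := Finset.sum_nonneg fun m _ => hT0 _
    have h3 := hG (T (c m)) _ (hT0 _) (hT1 _) hR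
      (Finset.add_sum_erase Finset.univ (fun m => T (c m)) (Finset.mem_univ m)).symm
    refine (trMul_mono_right _ h3).trans_eq ?_
    rw [trMul_add_right _ (smul_nonneg (by norm_num) (sub_nonneg.2 (hT1 _)))
      (smul_nonneg (by norm_num) hR), trMul_real_smul_right (by norm_num),
      trMul_real_smul_right (by norm_num)]
    norm_num
  · refine (trMul_mono_right _ hGS).trans_eq ?_
    rw [trMul_real_smul_right (by norm_num), trMul_sum_right _ _ fun m _ => hT0 _]
    norm_num

/-- One-shot strong converse for soft covering with random codebooks. -/
theorem card_pow_le_sum_traceNorm {Ω : Type*} [Fintype Ω] [Nonempty Ω] {M : ℕ} (hM : 0 < M)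
    {ρ : Ω → K →L[ℂ] K} (hρ : ∀ ω, IsDensity (ρ ω)) {δ : ℝ≥0∞} {σ : K →L[ℂ] K}
    (hσ : σ = (((Fintype.card Ω : ℝ)⁻¹ : ℝ) : ℂ) • ∑ ω, ρ ω)
    (hT : ∀ ω, ∃ T : K →L[ℂ] K, 0 ≤ T ∧ T ≤ 1 ∧ trMul (ρ ω) (1 - T) + M * trMul σ T ≤ δ) :
    (Fintype.card Ω : ℝ≥0∞) ^ M ≤
      ∑ c : Fin M → Ω, 2⁻¹ * traceNorm ((M : ℂ)⁻¹ • ∑ m, ρ (c m) - σ) +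
        (Fintype.card Ω : ℝ≥0∞) ^ M * (6 * δ) := by
  choose T hT0 hT1 hT using hT
  have hσd : IsDensity σ := hσ ▸ isDensity_average hρ
  have h1 := Finset.sum_le_sum fun (c : Fin M → Ω) (_ : c ∈ Finset.univ) =>
    one_le_traceNorm_codebook hM hρ hT0 hT1 hσd c
  have hcard : ∑ c : Fin M → Ω, (1 : ℝ≥0∞) = (Fintype.card Ω : ℝ≥0∞) ^ M := by simp
  rw [hcard, Finset.sum_add_distrib, add_comm] at h1
  refine h1.trans ?_
  gcongr
  rw [Finset.sum_add_distrib, ← Finset.mul_sum, Finset.sum_comm]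
  have h2 : ∀ m : Fin M, ∑ c : Fin M → Ω, (2 * trMul (ρ (c m)) (1 - T (c m)) +
      2 * trMul (ρ (c m)) (∑ m' ∈ Finset.univ.erase m, T (c m'))) ≤
      ∑ c : Fin M → Ω, (2 * trMul (ρ (c m)) (1 - T (c m)) + 2 * ∑ m', trMul σ (T (c m'))) := by
    intro m
    rw [Finset.sum_add_distrib, Finset.sum_add_distrib]
    refine add_le_add_right ?_ _
    rw [← Finset.mul_sum, ← Finset.mul_sum]
    refine mul_le_mul_right ?_ 2
    -- The tests of the other codewords do not involve `c m`, so `ρ (c m)` averages to `σ`.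
    -- Afterwards the omitted test is put back, which only increases the bound.
    rw [sum_trMul_resample (fun ω => (hρ ω).1) m (fun c => Finset.sum_nonneg fun _ _ => hT0 _), ← hσ]
    · gcongr with c
      rw [← trMul_sum_right _ _ fun m _ => hT0 _]
      exact trMul_mono_right _ (Finset.sum_le_sum_of_subset_of_nonneg (Finset.erase_subset _ _)
        fun _ _ _ => hT0 _)
    · intro c ω
      refine Finset.sum_congr rfl fun m' hm' => ?_
      rw [Function.update_of_ne (Finset.ne_of_mem_erase hm')]
  have hM0 : (M : ℝ≥0∞) ≠ 0 := by simpa using hM.ne'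
  have hMt : (M : ℝ≥0∞) ≠ ⊤ := by simp
  calc _ ≤ (M : ℝ≥0∞)⁻¹ * ∑ m : Fin M, ∑ c : Fin M → Ω, (2 * trMul (ρ (c m)) (1 - T (c m)) +
          2 * ∑ m', trMul σ (T (c m'))) + ∑ c : Fin M → Ω, 4 * ∑ m, trMul σ (T (c m)) := by
        exact add_le_add_left (mul_le_mul_right (Finset.sum_le_sum fun m _ => h2 m) _) _
    -- The constant `6` collects the `2` from the cross terms and the `4` from `G ≤ 4 S`.
    _ = ∑ c : Fin M → Ω, (M : ℝ≥0∞)⁻¹ * ∑ m, (2 * trMul (ρ (c m)) (1 - T (c m)) +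
          6 * (M * trMul σ (T (c m)))) := by
        rw [Finset.sum_comm, Finset.mul_sum, ← Finset.sum_add_distrib]
        refine Finset.sum_congr rfl fun c _ => ?_
        simp only [Finset.sum_add_distrib, ← Finset.mul_sum, Finset.sum_const, Finset.card_univ,
          Fintype.card_fin, nsmul_eq_mul]
        set x := ∑ m, trMul σ (T (c m))
        rw [mul_add, mul_add, add_assoc]
        congr 1
        have e : (M : ℝ≥0∞)⁻¹ * (6 * (M * x)) = ((M : ℝ≥0∞)⁻¹ * M) * (6 * x) := by ring
        have e2 : (M : ℝ≥0∞)⁻¹ * (2 * (M * x)) = ((M : ℝ≥0∞)⁻¹ * M) * (2 * x) := by ring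
        rw [e, e2, ENNReal.inv_mul_cancel hM0 hMt]
        ring
    _ ≤ ∑ c : Fin M → Ω, (M : ℝ≥0∞)⁻¹ * ∑ m : Fin M, 6 * δ := by
        gcongr with c _ m _
        calc _ ≤ 6 * trMul (ρ (c m)) (1 - T (c m)) + 6 * (M * trMul σ (T (c m))) := by
              gcongr; norm_num
          _ ≤ _ := by rw [← mul_add]; gcongr; exact hT _
    _ = _ := by
        simp only [Finset.sum_const, Finset.card_univ, Fintype.card_fin, nsmul_eq_mul,
          Fintype.card_pi, Finset.prod_const]
        rw [← mul_assoc (M : ℝ≥0∞)⁻¹, ENNReal.inv_mul_cancel hM0 hMt]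
        push_cast
        ring

end RandomCoding


/-! ### Sums of products over finite products of index types -/

theorem ENNReal.tsum_pi_prod : ∀ {n : ℕ} {ι : Fin n → Type*} (f : ∀ k, ι k → ℝ≥0∞),
    ∑' j : ∀ k, ι k, ∏ k, f k (j k) = ∏ k, ∑' i, f k i
  | 0, ι, f => by
    simp
  | n + 1, ι, f => by
    rw [← (Fin.consEquiv ι).tsum_eq, ENNReal.tsum_prod', Fin.prod_univ_succ, ← ENNReal.tsum_mul_right]
    refine tsum_congr fun i => ?_
    rw [← ENNReal.tsum_pi_prod fun k : Fin n => f k.succ, ← ENNReal.tsum_mul_left]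
    refine tsum_congr fun j => ?_
    simp [Fin.prod_univ_succ, Fin.consEquiv]

theorem summable_norm_and_tsum_pi_prod {R : Type*} [NormedField R] [CompleteSpace R] :
    ∀ {n : ℕ} {ι : Fin n → Type*} (f : ∀ k, ι k → R), (∀ k, Summable fun i => ‖f k i‖) →
      (Summable fun j : ∀ k, ι k => ‖∏ k, f k (j k)‖) ∧
      ∑' j : ∀ k, ι k, ∏ k, f k (j k) = ∏ k, ∑' i, f k i
  | 0, ι, f, _ => by
    refine ⟨(hasSum_fintype _).summable, by simp⟩
  | n + 1, ι, f, h => by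
    obtain ⟨ih1, ih2⟩ := summable_norm_and_tsum_pi_prod (fun k : Fin n => f k.succ) fun k => h k.succ
    have e : ∀ z : ι 0 × (∀ k : Fin n, ι k.succ), ∏ k, f k (Fin.consEquiv ι z k) =
        f 0 z.1 * ∏ k : Fin n, f k.succ (z.2 k) := fun z => by
      simp [Fin.prod_univ_succ, Fin.consEquiv]
    constructor
    · rw [← (Fin.consEquiv ι).summable_iff]
      have := Summable.mul_norm (h 0) ih1
      refine this.congr fun z => ?_
      simp only [Function.comp, e]
    · rw [← (Fin.consEquiv ι).tsum_eq, Fin.prod_univ_succ, ← ih2,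
        tsum_mul_tsum_of_summable_norm (h 0) ih1]
      exact tsum_congr e

/-! ### Bases -/

section Bases

variable {K : Type*} [NormedAddCommGroup K] [InnerProductSpace ℂ K] [CompleteSpace K]
variable {ι κ : Type*}

/-- With `P` the projection onto the orthogonal complement of the span, Bessel's inequality for `b i
- P (b i)` gives `1 ≤ 1 - ‖P (b i)‖²`. Hence `P` vanishes on a basis. This reduces completeness of
an orthonormal family to Parseval sums for a known basis. -/
theorem orthogonal_span_eq_bot (b : HilbertBasis ι ℂ K) {v : κ → K} (hv : Orthonormal ℂ v)
    (h : ∀ i, ∑' j, ENNReal.ofReal (‖inner ℂ (v j) (b i)‖ ^ 2) = 1) :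
    (Submodule.span ℂ (Set.range v))ᗮ = ⊥ := by
  set U := (Submodule.span ℂ (Set.range v))ᗮ with hU
  have hP : ∀ i, U.starProjection (b i) = 0 := by
    intro i
    have h1 : ∀ j, inner ℂ (v j) (b i - U.starProjection (b i)) = inner ℂ (v j) (b i) := by
      intro j
      have h2 : U.starProjection (b i) ∈ U := Submodule.starProjection_apply_mem U _
      have h3 : inner ℂ (v j) (U.starProjection (b i)) = 0 :=
        (Submodule.mem_orthogonal _ _).1 h2 (v j) (Submodule.subset_span ⟨j, rfl⟩)
      rw [inner_sub_right, h3, sub_zero]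
    have h3 := hv.tsum_inner_products_le (b i - U.starProjection (b i))
    simp only [h1] at h3
    have h4 : ∑' j, ‖inner ℂ (v j) (b i)‖ ^ 2 = 1 := by
      have := congrArg ENNReal.toReal (h i)
      rw [ENNReal.tsum_toReal_eq (fun _ => by simp)] at this
      simpa [ENNReal.toReal_ofReal] using this
    have h5 := Submodule.norm_sq_eq_add_norm_sq_starProjection (b i) U
    have h6 : Uᗮ.starProjection (b i) = b i - U.starProjection (b i) :=
      Submodule.starProjection_orthogonal_val _
    rw [h6, norm_hilbertBasis] at h5
    rw [h4] at h3
    have : ‖U.starProjection (b i)‖ ^ 2 ≤ 0 := by linarith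
    rw [← norm_eq_zero]
    exact pow_eq_zero_iff (two_ne_zero) |>.1 (le_antisymm this (by positivity))
  have hP0 : U.starProjection = 0 := eq_of_apply_eq b fun i => by rw [hP i]; rfl
  rw [eq_bot_iff]
  intro w hw
  have := Submodule.starProjection_eq_self_iff.2 hw
  rw [hP0] at this
  simpa using this.symm

/-- The standard basis of `ℓ²(ι)`. -/
def ell2Basis (ι : Type*) : HilbertBasis ι ℂ (Ell2 ι) :=
  HilbertBasis.ofRepr (LinearIsometryEquiv.refl ℂ (Ell2 ι))

theorem inner_ell2Basis (i : ι) (f : Ell2 ι) : inner ℂ (ell2Basis ι i) f = f i := by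
  rw [← HilbertBasis.repr_apply_apply]
  rfl

theorem ell2Basis_apply [DecidableEq ι] (i j : ι) : ell2Basis ι i j = if j = i then 1 else 0 := by
  rw [← inner_ell2Basis j, orthonormal_iff_ite.1 (ell2Basis ι).orthonormal]

/-- The quadratic form of `T` is `∑ i, a i * ‖⟨e i, x⟩‖²`. -/
theorem IsEigen.op_nonneg {T : K →L[ℂ] K} {e : HilbertBasis ι ℂ K} {a : ι → ℝ}
    (h : IsEigen T e a) (ha : ∀ i, 0 ≤ a i) : 0 ≤ T := by
  classical
  have h1 : ∀ i x, inner ℂ (e i) (T x) = (a i : ℂ) * inner ℂ (e i) x := by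
    intro i x
    have h2 : (innerSL ℂ (e i)).comp T = (a i : ℂ) • innerSL ℂ (e i) := by
      refine ContinuousLinearMap.ext_on (s := Set.range e)
        (Submodule.dense_iff_topologicalClosure_eq_top.2 e.dense_span) ?_
      rintro _ ⟨j, rfl⟩
      have hij := orthonormal_iff_ite.1 e.orthonormal
      simp only [ContinuousLinearMap.comp_apply, innerSL_apply_apply, h j, inner_smul_right, hij,
        smul_apply, smul_eq_mul]
      split_ifs with hij
      · rw [hij]
      · simp
    exact congrArg (fun g : K →L[ℂ] ℂ => g x) h2
  rw [ContinuousLinearMap.nonneg_iff_isPositive, ContinuousLinearMap.isPositive_iff_complex]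
  intro x
  have h3 : HasSum (fun i => ((a i * ‖inner ℂ (e i) x‖ ^ 2 : ℝ) : ℂ)) (inner ℂ (T x) x) := by
    have h2 : (fun i => ((a i * ‖inner ℂ (e i) x‖ ^ 2 : ℝ) : ℂ)) =
        fun i => inner ℂ (T x) (e i) * inner ℂ (e i) x := by
      ext i
      rw [← inner_conj_symm (T x) (e i), h1, map_mul, Complex.conj_ofReal, mul_assoc,
        RCLike.conj_mul]
      push_cast
      rfl
    rw [h2]
    exact e.hasSum_inner_mul_inner (T x) x
  have h4 : HasSum (fun i => a i * ‖inner ℂ (e i) x‖ ^ 2) (inner ℂ (T x) x).re := by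
    have := Complex.hasSum_re h3
    simpa only [Complex.ofReal_re] using this
  constructor
  · exact (h3.unique (Complex.hasSum_ofReal.2 h4)).symm
  · exact h4.nonneg fun i => mul_nonneg (ha i) (by positivity)

end Bases

/-! ### Product vectors -/

section ProdVec

variable {I : Type*} {n : ℕ}

theorem memℓp_prod (u : Fin n → Ell2 I) : Memℓp (fun i : Fin n → I => ∏ k, u k (i k)) 2 := by
  refine memℓp_two ?_
  have h := (summable_norm_and_tsum_pi_prod (R := ℝ) (ι := fun _ : Fin n => I)
    (fun k i => ‖u k i‖ ^ 2) fun k => by simpa using summable_sq (u k)).1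
  refine h.congr fun i => ?_
  rw [norm_prod, norm_prod, ← Finset.prod_pow]
  simp

/-- The product vector `u 1 ⊗ ⋯ ⊗ u n`. -/
def prodVec (u : Fin n → Ell2 I) : Ell2 (Fin n → I) :=
  ⟨fun i => ∏ k, u k (i k), memℓp_prod u⟩

theorem prodVec_apply (u : Fin n → Ell2 I) (i : Fin n → I) : prodVec u i = ∏ k, u k (i k) := rfl

theorem inner_prodVec (u v : Fin n → Ell2 I) :
    inner ℂ (prodVec u) (prodVec v) = ∏ k, inner ℂ (u k) (v k) := by
  have hs : ∀ k, Summable fun i => ‖v k i * starRingEnd ℂ (u k i)‖ := fun k => by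
    have h : Summable fun i => inner ℂ (u k i) (v k i) :=
      lp.summable_inner (G := fun _ : I => ℂ) (u k) (v k)
    simpa only [RCLike.inner_apply] using h.norm
  have h := (summable_norm_and_tsum_pi_prod (ι := fun _ : Fin n => I)
    (fun k i => v k i * starRingEnd ℂ (u k i)) hs).2
  have h1 : ∀ k, inner ℂ (u k) (v k) = ∑' i, v k i * starRingEnd ℂ (u k i) := fun k =>
    lp.inner_eq_tsum (G := fun _ : I => ℂ) (u k) (v k)
  have h2 : inner ℂ (prodVec u) (prodVec v) =
      ∑' i, prodVec v i * starRingEnd ℂ (prodVec u i) :=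
    lp.inner_eq_tsum (G := fun _ : Fin n → I => ℂ) (prodVec u) (prodVec v)
  rw [h2, Finset.prod_congr rfl fun k _ => h1 k, ← h]
  refine tsum_congr fun i => ?_
  simp only [prodVec_apply, map_prod, Finset.prod_mul_distrib]

theorem prodVec_smul (c : Fin n → ℂ) (u : Fin n → Ell2 I) :
    prodVec (fun k => c k • u k) = (∏ k, c k) • prodVec u := by
  ext i
  simp [prodVec_apply, Finset.prod_mul_distrib]

theorem prodVec_ell2Basis (i : Fin n → I) :
    prodVec (fun k => ell2Basis I (i k)) = ell2Basis (Fin n → I) i := by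
  classical
  ext j
  simp only [prodVec_apply, ell2Basis_apply, Finset.prod_ite_zero, Finset.mem_univ, true_implies,
    Finset.prod_const_one]
  congr 1
  exact propext funext_iff.symm

/-- Each slice of a product vector along site `k` is a scalar multiple of `u k`. -/
theorem ampl_prodVec (k : Fin n) (A : Ell2 I →L[ℂ] Ell2 I) (u : Fin n → Ell2 I) :
    ampl (Equiv.funSplitAt k I) A (prodVec u) = prodVec (Function.update u k (A (u k))) := by
  ext a
  change A (slice (Equiv.funSplitAt k I) (prodVec u) (Equiv.funSplitAt k I a).2)
    (Equiv.funSplitAt k I a).1 = _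
  have h : slice (Equiv.funSplitAt k I) (prodVec u) (Equiv.funSplitAt k I a).2 =
      (∏ j : {j // j ≠ k}, u j (a j)) • u k := by
    ext i
    rw [slice_apply, prodVec_apply, Fintype.prod_eq_mul_prod_subtype_ne _ k]
    simp only [Equiv.funSplitAt_symm_apply, Equiv.funSplitAt_apply, dite_true]
    rw [mul_comm]
    change _ = (∏ j : {j // j ≠ k}, u j (a j)) * u k i
    congr 1
    refine Finset.prod_congr rfl fun j _ => ?_
    rw [dif_neg j.2]
  rw [h, map_smul, prodVec_apply, Fintype.prod_eq_mul_prod_subtype_ne _ k, Function.update_self,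
    mul_comm]
  change (∏ j : {j // j ≠ k}, u j (a j)) * A (u k) (a k) = _
  congr 1
  refine Finset.prod_congr rfl fun j _ => ?_
  rw [Function.update_of_ne j.2]

/-- The product of orthonormal bases. -/
theorem exists_prodBasis {ι : Fin n → Type*} (e : ∀ k, HilbertBasis (ι k) ℂ (Ell2 I)) :
    ∃ b : HilbertBasis (∀ k, ι k) ℂ (Ell2 (Fin n → I)), ∀ j, b j = prodVec fun k => e k (j k) := by
  classical
  have ho : Orthonormal ℂ fun j : ∀ k, ι k => prodVec fun k => e k (j k) := by
    rw [orthonormal_iff_ite]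
    intro i j
    simp only [inner_prodVec, orthonormal_iff_ite.1 (e _).orthonormal, Finset.prod_ite_zero,
      Finset.mem_univ, true_implies, Finset.prod_const_one]
    congr 1
    exact propext funext_iff.symm
  refine ⟨HilbertBasis.mkOfOrthogonalEqBot ho
    (orthogonal_span_eq_bot (ell2Basis (Fin n → I)) ho fun i => ?_), fun j => by
      rw [HilbertBasis.coe_mkOfOrthogonalEqBot]⟩
  -- Completeness: the Parseval sum of a standard basis vector factors over the sites, and each
  -- factor is `1`.
  have h : ∀ j : ∀ k, ι k, ENNReal.ofReal (‖inner ℂ (prodVec fun k => e k (j k))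
      (ell2Basis (Fin n → I) i)‖ ^ 2) =
      ∏ k, ENNReal.ofReal (‖inner ℂ (e k (j k)) (ell2Basis I (i k))‖ ^ 2) := by
    intro j
    rw [← prodVec_ell2Basis, inner_prodVec, norm_prod, ← Finset.prod_pow,
      ENNReal.ofReal_prod_of_nonneg fun _ _ => by positivity]
  simp_rw [h]
  rw [ENNReal.tsum_pi_prod fun k l => ENNReal.ofReal (‖inner ℂ (e k l) (ell2Basis I (i k))‖ ^ 2)]
  refine Finset.prod_eq_one fun k _ => ?_
  rw [HilbertBasis.tsum_ofReal_norm_inner_sq, norm_hilbertBasis]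
  simp

end ProdVec

/-! ### Tensor products of operators -/

section TensorProd

variable {H : Type*} [NormedAddCommGroup H] [InnerProductSpace ℂ H] [CompleteSpace H]
variable {n : ℕ} {ι κ : Type*}

/-- Each operator in the product acts on one site only. The induction runs over lists of distinct
sites, so no site is hit twice. -/
theorem tensorProd_prodVec (A : Fin n → H →L[ℂ] H) (u : Fin n → Ell2 (basisIdx H)) :
    tensorProd A (prodVec u) = prodVec fun k => toEll2 (A k) (u k) := by
  have h : ∀ l : List (Fin n), l.Nodup →
      (l.map fun k => ampl (Equiv.funSplitAt k (basisIdx H)) (toEll2 (A k))).prod (prodVec u) =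
        prodVec fun k => if k ∈ l then toEll2 (A k) (u k) else u k := by
    intro l hl
    induction l with
    | nil => simp
    | cons m l ih =>
      rw [List.nodup_cons] at hl
      rw [List.map_cons, List.prod_cons, mul_apply_eq_comp, ih hl.2, ampl_prodVec]
      congr 1
      ext1 k
      rcases eq_or_ne k m with rfl | hk
      · simp [hl.1]
      · simp [hk]
  have h1 := h (List.finRange n) (List.nodup_finRange n)
  rw [tensorProd, List.ofFn_eq_map, h1]
  simp

/-- A basis of `H`, in the coordinates of the fixed basis of `H`. -/
def toEll2Basis (e : HilbertBasis ι ℂ H) : HilbertBasis ι ℂ (Ell2 (basisIdx H)) :=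
  HilbertBasis.ofRepr ((stdBasis H).repr.symm.trans e.repr)

theorem toEll2Basis_apply (e : HilbertBasis ι ℂ H) (i : ι) :
    toEll2Basis e i = (stdBasis H).repr (e i) := by
  classical
  have h : (toEll2Basis e).repr ((stdBasis H).repr (e i)) = (toEll2Basis e).repr (toEll2Basis e i) := by
    rw [HilbertBasis.repr_self, ← e.repr_self i]
    simp [toEll2Basis]
  exact ((toEll2Basis e).repr.injective h).symm

theorem inner_toEll2Basis (e : HilbertBasis ι ℂ H) (f : HilbertBasis κ ℂ H) (i : ι) (j : κ) :
    inner ℂ (toEll2Basis e i) (toEll2Basis f j) = inner ℂ (e i) (f j) := by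
  rw [toEll2Basis_apply, toEll2Basis_apply, LinearIsometryEquiv.inner_map_map]

theorem toEll2_repr (A : H →L[ℂ] H) (v : H) :
    toEll2 A ((stdBasis H).repr v) = (stdBasis H).repr (A v) := by
  simp [toEll2]

theorem IsEigen.toEll2 {T : H →L[ℂ] H} {e : HilbertBasis ι ℂ H} {a : ι → ℝ} (h : IsEigen T e a) :
    IsEigen (toEll2 T) (toEll2Basis e) a := fun i => by
  rw [toEll2Basis_apply, toEll2_repr, h i, map_smul]

/-- The tensor products of eigenvectors are eigenvectors. -/
theorem exists_isEigen_tensorProd {ι : Fin n → Type*} {A : Fin n → H →L[ℂ] H}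
    {e : ∀ k, HilbertBasis (ι k) ℂ H} {a : ∀ k, ι k → ℝ} (h : ∀ k, IsEigen (A k) (e k) (a k)) :
    ∃ b : HilbertBasis (∀ k, ι k) ℂ (TensorPow H n),
      (∀ j, b j = prodVec fun k => toEll2Basis (e k) (j k)) ∧
      IsEigen (tensorProd A) b fun j => ∏ k, a k (j k) := by
  obtain ⟨b, hb⟩ := exists_prodBasis fun k => toEll2Basis (e k)
  refine ⟨b, hb, fun j => ?_⟩
  rw [hb, tensorProd_prodVec]
  simp_rw [(h _).toEll2 _]
  rw [prodVec_smul]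
  push_cast
  rfl

/-- The tensor product of positive trace class operators, with its trace. -/
theorem tensorProd_nonneg_and_ptrace {A : Fin n → H →L[ℂ] H} (hA : ∀ k, 0 ≤ A k)
    (hf : ∀ k, ptrace (A k) ≠ ⊤) :
    0 ≤ tensorProd A ∧ ptrace (tensorProd A) = ∏ k, ptrace (A k) := by
  obtain ⟨e⟩ : Nonempty (∀ k, Eigenbasis (A k)) :=
    ⟨fun k => (exists_eigenbasis (hA k) (hf k)).some⟩
  have he : ∀ k, IsEigen (A k) (e k).basis (e k).val := fun k => (e k).apply_basis
  obtain ⟨b, -, hb⟩ := exists_isEigen_tensorProd he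
  have h0 := hb.op_nonneg fun j => Finset.prod_nonneg fun k _ => (he k).nonneg (hA k) (j k)
  refine ⟨h0, ?_⟩
  rw [hb.ptrace_eq h0, Finset.prod_congr rfl fun k _ => (he k).ptrace_eq (hA k),
    ← ENNReal.tsum_pi_prod fun k i => ENNReal.ofReal ((e k).val i)]
  refine tsum_congr fun j => ?_
  rw [ENNReal.ofReal_prod_of_nonneg fun k _ => (he k).nonneg (hA k) (j k)]

/-- In product eigenbases the overlaps and the powers of the eigenvalues are products over the
sites, so the double sum factors. The traces are finite to ensure that eigenbases exist. -/
theorem trMul_opPow_tensorProd {A B : Fin n → H →L[ℂ] H} (hA : ∀ k, 0 ≤ A k) (hB : ∀ k, 0 ≤ B k)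
    (hAf : ∀ k, ptrace (A k) ≠ ⊤) (hBf : ∀ k, ptrace (B k) ≠ ⊤) {s t : ℝ} (hs : 0 ≤ s)
    (ht : 0 ≤ t) :
    trMul (opPow (tensorProd A) s) (opPow (tensorProd B) t) =
      ∏ k, trMul (opPow (A k) s) (opPow (B k) t) := by
  obtain ⟨e⟩ : Nonempty (∀ k, Eigenbasis (A k)) :=
    ⟨fun k => (exists_eigenbasis (hA k) (hAf k)).some⟩
  obtain ⟨f⟩ : Nonempty (∀ k, Eigenbasis (B k)) :=
    ⟨fun k => (exists_eigenbasis (hB k) (hBf k)).some⟩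
  have he : ∀ k, IsEigen (A k) (e k).basis (e k).val := fun k => (e k).apply_basis
  have hf : ∀ k, IsEigen (B k) (f k).basis (f k).val := fun k => (f k).apply_basis
  obtain ⟨b, hb1, hb2⟩ := exists_isEigen_tensorProd he
  obtain ⟨c, hc1, hc2⟩ := exists_isEigen_tensorProd hf
  have hA0 := (tensorProd_nonneg_and_ptrace hA hAf).1
  have hB0 := (tensorProd_nonneg_and_ptrace hB hBf).1
  rw [(hb2.opPow hA0 hs).trMul_eq (opPow_nonneg _ _) (opPow_nonneg _ _) (hc2.opPow hB0 ht),
    Finset.prod_congr rfl fun k _ => ((he k).opPow (hA k) hs).trMul_eq (opPow_nonneg _ _)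
      (opPow_nonneg _ _) ((hf k).opPow (hB k) ht), ← ENNReal.tsum_pi_prod]
  refine tsum_congr fun i => ?_
  rw [← ENNReal.tsum_pi_prod]
  refine tsum_congr fun j => ?_
  have ha : ∀ k, 0 ≤ (e k).val (i k) := fun k => (he k).nonneg (hA k) (i k)
  have hb : ∀ k, 0 ≤ (f k).val (j k) := fun k => (hf k).nonneg (hB k) (j k)
  rw [Finset.prod_mul_distrib, hb1, hc1, inner_prodVec]
  simp_rw [inner_toEll2Basis]
  rw [norm_prod, ← Finset.prod_pow, ENNReal.ofReal_prod_of_nonneg fun _ _ => by positivity,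
    ← Real.finsetProd_rpow _ _ fun k _ => ha k, ← Real.finsetProd_rpow _ _ fun k _ => hb k,
    ← Finset.prod_mul_distrib, ENNReal.ofReal_prod_of_nonneg fun k _ =>
      mul_nonneg (Real.rpow_nonneg (ha k) _) (Real.rpow_nonneg (hb k) _)]

/-- Tensor powers of a linear combination. -/
theorem tensorProd_sum {X : Type*} [DecidableEq X] (s : Finset X) (w : X → ℂ)
    (ρ : X → H →L[ℂ] H) (n : ℕ) :
    tensorProd (fun _ : Fin n => ∑ x ∈ s, w x • ρ x) =
      ∑ x ∈ Fintype.piFinset fun _ : Fin n => s, (∏ k, w (x k)) • tensorProd fun k => ρ (x k) := by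
  refine eq_of_apply_eq (ell2Basis _) fun i => ?_
  rw [← prodVec_ell2Basis, tensorProd_prodVec, sum_apply]
  have h : ∀ v, toEll2 (∑ x ∈ s, w x • ρ x) v = ∑ x ∈ s, w x • toEll2 (ρ x) v := by
    intro v
    obtain ⟨v, rfl⟩ := (stdBasis H).repr.surjective v
    simp only [toEll2_repr, sum_apply, map_sum, smul_apply, map_smul]
  ext j
  simp only [prodVec_apply, h, lp.coeFn_sum, Finset.sum_apply, lp.coeFn_smul, Pi.smul_apply,
    smul_eq_mul, Finset.prod_univ_sum, smul_apply, tensorProd_prodVec, Finset.prod_mul_distrib]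

end TensorProd


/-! ### The size of type classes -/

section Types

open Nat in
-- Taken over all letters, this says that under a distribution of type `N` no type class is more
-- probable than that of `N` itself.
theorem factorial_mul_pow_le_factorial_mul_pow (N k : ℕ) : N ! * N ^ k ≤ k ! * N ^ N := by
  rcases le_total N k with h | h
  · calc N ! * N ^ k = N ! * N ^ (k - N) * N ^ N := by
          rw [mul_assoc, ← pow_add, Nat.sub_add_cancel h]
      _ ≤ _ := Nat.mul_le_mul_right _ (Nat.factorial_mul_pow_sub_le_factorial h)
  · have h1 : N ! ≤ k ! * N ^ (N - k) := by
      rw [← Nat.factorial_mul_descFactorial (Nat.sub_le N k), Nat.sub_sub_self h]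
      exact Nat.mul_le_mul_left _ (Nat.descFactorial_le_pow _ _)
    calc N ! * N ^ k ≤ k ! * N ^ (N - k) * N ^ k := Nat.mul_le_mul_right _ h1
      _ = _ := by rw [mul_assoc, ← pow_add, Nat.sub_add_cancel h]

variable {X : Type*} [DecidableEq X]

/-- The sequences in which `a` occurs `N a` times. -/
def seqsOfType (n : ℕ) (S : Finset X) (N : X → ℕ) : Finset (Fin n → X) :=
  (Fintype.piFinset fun _ => S).filter fun x => ∀ a ∈ S, (Finset.univ.filter (x · = a)).card = N a

theorem exists_mem_seqsOfType {n : ℕ} {S : Finset X} {N : X → ℕ} (h : ∑ a ∈ S, N a = n) :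
    (seqsOfType n S N).Nonempty := by
  have hc : Fintype.card (Σ a : S, Fin (N a)) = n := by
    rw [Fintype.card_sigma]
    simp only [Fintype.card_fin]
    rw [← h]
    exact Finset.sum_coe_sort S N
  let e : (Σ a : S, Fin (N a)) ≃ Fin n := Fintype.equivFinOfCardEq hc
  refine ⟨fun i => (e.symm i).1, ?_⟩
  simp only [seqsOfType, Finset.mem_filter, Fintype.mem_piFinset]
  refine ⟨fun i => (e.symm i).1.2, fun a ha => ?_⟩
  have h1 : (Finset.univ : Finset (Fin (N a))).card =
      (Finset.univ.filter fun i => ((e.symm i).1 : X) = a).card := by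
    refine Finset.card_bij (fun j _ => e ⟨⟨a, ha⟩, j⟩) (by simp) (fun j _ j' _ hj => ?_) ?_
    · simpa using e.injective hj
    · intro i hi
      obtain rfl := (Finset.mem_filter.1 hi).2
      exact ⟨(e.symm i).2, Finset.mem_univ _, by simp⟩
  rw [← h1]
  simp

open Nat in
-- Permuting the positions of one such sequence maps the symmetric group into the type class. Every
-- nonempty fibre is a coset of the stabilizer, which has at most `∏ a, (N a)!` elements.
theorem factorial_le_card_seqsOfType_mul {n : ℕ} {S : Finset X} {N : X → ℕ}
    (h : ∑ a ∈ S, N a = n) : n ! ≤ (∏ a ∈ S, (N a)!) * (seqsOfType n S N).card := by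
  obtain ⟨f, hf⟩ := exists_mem_seqsOfType h
  have hf' := hf
  simp only [seqsOfType, Finset.mem_filter, Fintype.mem_piFinset] at hf'
  obtain ⟨hfS, hfN⟩ := hf'
  have hstab : Fintype.card {g : Equiv.Perm (Fin n) // f ∘ g = f} ≤ ∏ a ∈ S, (N a)! := by
    rw [DomMulAct.stabilizer_card' f]
    have hsub : Finset.univ.image f ⊆ S := by
      intro a ha
      obtain ⟨i, -, rfl⟩ := Finset.mem_image.1 ha
      exact hfS i
    calc ∏ i ∈ Finset.univ.image f, (Fintype.card {a // f a = i})!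
        = ∏ i ∈ Finset.univ.image f, (N i)! := by
          refine Finset.prod_congr rfl fun a ha => ?_
          rw [Fintype.card_subtype, hfN a (hsub ha)]
      _ ≤ _ := Finset.prod_le_prod_of_subset_of_one_le' hsub fun a _ _ => Nat.factorial_pos _
  have hcard : (Finset.univ : Finset (Equiv.Perm (Fin n))).card = n ! := by
    rw [Finset.card_univ, Fintype.card_perm, Fintype.card_fin]
  rw [← hcard]
  refine Finset.card_le_mul_card_image_of_maps_to (f := fun g : Equiv.Perm (Fin n) => f ∘ g)
    (fun g _ => ?_) _ fun b _ => ?_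
  · simp only [seqsOfType, Finset.mem_filter, Fintype.mem_piFinset]
    refine ⟨fun i => hfS _, fun a ha => ?_⟩
    rw [← hfN a ha]
    refine Finset.card_bij (fun i _ => g i) (by simp) (by simp) fun j hj => ⟨g.symm j, ?_, by simp⟩
    simpa using hj
  · refine le_trans ?_ hstab
    rcases (Finset.univ.filter fun g : Equiv.Perm (Fin n) => f ∘ g = b).eq_empty_or_nonempty with
      h1 | ⟨g₀, hg₀⟩
    · rw [h1]
      simp
    · have hg₀ := (Finset.mem_filter.1 hg₀).2
      rw [Fintype.card_subtype]
      refine Finset.card_le_card_of_injOn (fun g => g * g₀⁻¹) (fun g hg => ?_)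
        fun g _ g' _ hgg => by simpa using hgg
      have hg := (Finset.mem_filter.1 hg).2
      rw [← hg₀] at hg
      simp only [Finset.coe_filter, Finset.mem_univ, true_and, Set.mem_ofPred_eq]
      ext i
      have := congrFun hg (g₀⁻¹ i)
      simpa using this

open Nat in
-- The multinomial theorem expands `(∑ a, N a) ^ n` over all types. There are at most `(n + 1) ^
-- |S|` of them, and the term of type `N` dominates. After division by `n ^ n` this is the lower
-- bound `(n + 1) ^ (-|S|)` on the probability of the type class.
theorem pow_le_card_seqsOfType_mul {n : ℕ} {S : Finset X} {N : X → ℕ} (h : ∑ a ∈ S, N a = n) :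
    n ^ n ≤ (n + 1) ^ S.card * ((seqsOfType n S N).card * ∏ a ∈ S, N a ^ N a) := by
  have h1 := Finset.sum_pow_eq_sum_piAntidiag S N n
  rw [h] at h1
  rw [h1]
  have hcard : (Finset.piAntidiag S n).card ≤ (n + 1) ^ S.card := by
    have : (Finset.piAntidiag S n).card ≤ (Fintype.piFinset fun _ : S => Finset.range (n + 1)).card := by
      refine Finset.card_le_card_of_injOn (fun k a => k a) (fun k hk => ?_) ?_
      · have hk := (Finset.mem_piAntidiag.1 hk)
        simp only [Finset.mem_coe, Fintype.mem_piFinset, Finset.mem_range]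
        intro a
        rw [Nat.lt_succ_iff, ← hk.1]
        exact Finset.single_le_sum (f := k) (fun _ _ => Nat.zero_le _) a.2
      · intro k hk l hl hkl
        have hk := (Finset.mem_piAntidiag.1 hk).2
        have hl := (Finset.mem_piAntidiag.1 hl).2
        ext a
        by_cases ha : a ∈ S
        · exact congrFun hkl ⟨a, ha⟩
        · rw [not_imp_comm.1 (hk a) ha, not_imp_comm.1 (hl a) ha]
    simpa using this
  calc _ ≤ ∑ k ∈ Finset.piAntidiag S n, (seqsOfType n S N).card * ∏ a ∈ S, N a ^ N a := by
        refine Finset.sum_le_sum fun k hk => ?_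
        have hk := (Finset.mem_piAntidiag.1 hk).1
        have hpos : 0 < (∏ a ∈ S, (k a)!) * ∏ a ∈ S, (N a)! :=
          mul_pos (Finset.prod_pos fun a _ => Nat.factorial_pos _)
            (Finset.prod_pos fun a _ => Nat.factorial_pos _)
        refine Nat.le_of_mul_le_mul_left ?_ hpos
        have hm := multinomial_spec S k
        rw [hk] at hm
        calc (∏ a ∈ S, (k a)!) * (∏ a ∈ S, (N a)!) * (multinomial S k * ∏ a ∈ S, N a ^ k a)
            = (∏ a ∈ S, (k a)!) * multinomial S k * ((∏ a ∈ S, (N a)!) * ∏ a ∈ S, N a ^ k a) := by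
              ring
          _ = n ! * ∏ a ∈ S, (N a)! * N a ^ k a := by rw [hm, Finset.prod_mul_distrib]
          _ ≤ ((∏ a ∈ S, (N a)!) * (seqsOfType n S N).card) *
              ∏ a ∈ S, (k a)! * N a ^ N a := by
              refine Nat.mul_le_mul (factorial_le_card_seqsOfType_mul h)
                (Finset.prod_le_prod' fun a _ => factorial_mul_pow_le_factorial_mul_pow _ _)
          _ = _ := by rw [Finset.prod_mul_distrib]; ring
    _ ≤ _ := by
        rw [Finset.sum_const, smul_eq_mul]
        exact Nat.mul_le_mul_right _ hcard

theorem prod_of_mem_seqsOfType {R : Type*} [CommMonoid R] {n : ℕ} {S : Finset X} {N : X → ℕ}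
    {x : Fin n → X} (hx : x ∈ seqsOfType n S N) (f : X → R) :
    ∏ i, f (x i) = ∏ a ∈ S, f a ^ N a := by
  simp only [seqsOfType, Finset.mem_filter, Fintype.mem_piFinset] at hx
  rw [← Finset.prod_fiberwise_of_maps_to (s := Finset.univ) (t := S) (g := x) fun i _ => hx.1 i]
  refine Finset.prod_congr rfl fun a ha => ?_
  rw [← hx.2 a ha, ← Finset.prod_const]
  refine Finset.prod_congr rfl fun i hi => ?_
  rw [(Finset.mem_filter.1 hi).2]

end Types


/-! ### Tests against a scaled operator. -/

section

variable {K : Type*} [NormedAddCommGroup K] [InnerProductSpace ℂ K] [CompleteSpace K]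

theorem opPow_smul {B : K →L[ℂ] K} (hB : 0 ≤ B) (hf : ptrace B ≠ ⊤) {c : ℝ} (hc : 0 ≤ c) {s : ℝ}
    (hs : 0 ≤ s) : opPow ((c : ℂ) • B) s = ((c ^ s : ℝ) : ℂ) • opPow B s := by
  obtain ⟨e⟩ := exists_eigenbasis hB hf
  have he : IsEigen B e.basis e.val := e.apply_basis
  have he' : IsEigen ((c : ℂ) • B) e.basis fun i => c * e.val i := fun i => by
    rw [smul_apply, he i, smul_smul, Complex.ofReal_mul]
  refine eq_of_apply_eq e.basis fun i => ?_
  rw [he'.opPow (smul_nonneg' hc hB) hs i, smul_apply, he.opPow hB hs i, smul_smul,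
    ← Complex.ofReal_mul]
  beta_reduce
  rw [Real.mul_rpow hc (he.nonneg hB i)]

theorem exists_test_scaled {A B : K →L[ℂ] K} (hA : 0 ≤ A) (hB : 0 ≤ B) (hAf : ptrace A ≠ ⊤)
    (hBf : ptrace B ≠ ⊤) {c : ℝ} (hc : 0 ≤ c) {s : ℝ} (h0 : 0 < s) (h1 : s < 1) :
    ∃ T : K →L[ℂ] K, 0 ≤ T ∧ T ≤ 1 ∧ trMul A (1 - T) + ENNReal.ofReal c * trMul B T ≤
      ENNReal.ofReal (c ^ s) * trMul (opPow B s) (opPow A (1 - s)) := by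
  obtain ⟨T, hT0, hT1, hT⟩ := exists_test hA (smul_nonneg' hc hB) hAf
    (by rw [ptrace_smul hc]; exact ENNReal.mul_ne_top ENNReal.ofReal_ne_top hBf) h0 h1
  refine ⟨T, hT0, hT1, ?_⟩
  rwa [opPow_smul hB hBf hc h0.le, trMul_smul_left (Real.rpow_nonneg hc _) (opPow_nonneg _ _)
    (opPow_nonneg _ _), trMul_smul_left hc hB hT0] at hT

end

/-! ### The marginal state, and distributions whose weights are multiples of `1 / n`. -/

section Marginal

variable {H : Type*} [NormedAddCommGroup H] [InnerProductSpace ℂ H] [CompleteSpace H]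
variable {𝒳 : Type*} {p : PMF 𝒳} {S : Finset 𝒳} {ρ : 𝒳 → H →L[ℂ] H}

theorem marginal_eq_sum (hS : ∀ x, x ∈ S ↔ p x ≠ 0) (ρ : 𝒳 → H →L[ℂ] H) :
    marginal p ρ = ∑ x ∈ S, ((p x).toReal : ℂ) • ρ x := by
  refine tsum_eq_sum fun x hx => ?_
  rw [hS, not_not] at hx
  simp [hx]

theorem sum_pmf_eq_one (hS : ∀ x, x ∈ S ↔ p x ≠ 0) : ∑ x ∈ S, p x = 1 := by
  rw [← p.tsum_coe]
  refine (tsum_eq_sum fun x hx => ?_).symm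
  rwa [hS, not_not] at hx

theorem isDensity_marginal (hS : ∀ x, x ∈ S ↔ p x ≠ 0) (hρ : ∀ x, IsDensity (ρ x)) :
    IsDensity (marginal p ρ) := by
  have h0 : ∀ x, 0 ≤ ((p x).toReal : ℂ) • ρ x := fun x =>
    smul_nonneg' ENNReal.toReal_nonneg (hρ x).1
  rw [marginal_eq_sum hS]
  refine ⟨Finset.sum_nonneg fun x _ => h0 x, ?_⟩
  rw [ptrace_sum _ fun x _ => h0 x, ← sum_pmf_eq_one hS]
  refine Finset.sum_congr rfl fun x _ => ?_
  rw [ptrace_smul ENNReal.toReal_nonneg, (hρ x).2, mul_one, ENNReal.ofReal_toReal (p.apply_ne_top x)]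

theorem smul_le_marginal (hS : ∀ x, x ∈ S ↔ p x ≠ 0) (hρ : ∀ x, IsDensity (ρ x)) {x : 𝒳}
    (hx : x ∈ S) : ((p x).toReal : ℂ) • ρ x ≤ marginal p ρ := by
  rw [marginal_eq_sum hS]
  exact Finset.single_le_sum (f := fun x => ((p x).toReal : ℂ) • ρ x)
    (fun x _ => smul_nonneg' ENNReal.toReal_nonneg (hρ x).1) hx

/-- The support of a distribution whose weights are multiples of `1 / n`. -/
theorem exists_support_finset {n : ℕ} (hn : 0 < n) {N : 𝒳 → ℕ}
    (hN : ∀ x, (n : ℝ≥0∞) * p x = N x) : ∃ S : Finset 𝒳, ∀ x, x ∈ S ↔ p x ≠ 0 := by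
  have hfin := ENNReal.finite_const_le_of_tsum_ne_top (a := fun x => (n : ℝ≥0∞) * p x)
    (ε := 1) (by
      rw [ENNReal.tsum_mul_left, p.tsum_coe]
      simp) (by simp)
  refine ⟨hfin.toFinset, fun x => ?_⟩
  rw [Set.Finite.mem_toFinset, Set.mem_ofPred_eq, hN]
  constructor
  · intro h hx
    have h1 := hN x
    rw [hx, mul_zero] at h1
    rw [← h1] at h
    simp at h
  · intro h
    have h1 : (N x : ℝ≥0∞) ≠ 0 := by
      rw [← hN]
      exact mul_ne_zero (by simpa using hn.ne') h
    have h2 : N x ≠ 0 := by simpa using h1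
    exact_mod_cast Nat.one_le_iff_ne_zero.2 h2

theorem sum_counts {n : ℕ} {N : 𝒳 → ℕ} (hN : ∀ x, (n : ℝ≥0∞) * p x = N x)
    (hS : ∀ x, x ∈ S ↔ p x ≠ 0) : ∑ x ∈ S, N x = n := by
  have h : ∑ x ∈ S, (N x : ℝ≥0∞) = n := by
    rw [← Finset.sum_congr rfl fun x _ => hN x, ← Finset.mul_sum, sum_pmf_eq_one hS, mul_one]
  exact_mod_cast h

theorem toReal_eq_count_div {n : ℕ} (hn : 0 < n) {N : 𝒳 → ℕ}
    (hN : ∀ x, (n : ℝ≥0∞) * p x = N x) (x : 𝒳) : (p x).toReal = N x / n := by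
  have h := congrArg ENNReal.toReal (hN x)
  rw [ENNReal.toReal_mul, ENNReal.toReal_natCast, ENNReal.toReal_natCast] at h
  rw [← h]
  field_simp

theorem typeClass_eq [DecidableEq 𝒳] {n : ℕ} (hn : 0 < n) {N : 𝒳 → ℕ}
    (hN : ∀ x, (n : ℝ≥0∞) * p x = N x) (hS : ∀ x, x ∈ S ↔ p x ≠ 0) :
    typeClass p n = (seqsOfType n S N : Set (Fin n → 𝒳)) := by
  have hn0 : (n : ℝ≥0∞) ≠ 0 := by simpa using hn.ne'
  have he : ∀ (x : Fin n → 𝒳) a, empirical x a = (Finset.univ.filter (x · = a)).card / n := by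
    intro x a
    rw [empirical, Finset.card_filter, Nat.cast_sum]
    refine congrArg (· / (n : ℝ≥0∞)) (Finset.sum_congr rfl fun i _ => ?_)
    by_cases h : x i = a
    · simp [h]
    · simp [h, Ne.symm h]
  have hp : ∀ (x : Fin n → 𝒳) a, empirical x a = p a ↔ (Finset.univ.filter (x · = a)).card = N a := by
    intro x a
    rw [he, eq_comm, ENNReal.eq_div_iff hn0 (by simp), hN, Nat.cast_inj, eq_comm]
  ext x
  simp only [typeClass, Set.mem_ofPred_eq, hp, seqsOfType, Finset.coe_filter, Fintype.mem_piFinset]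
  have hN0 : ∀ a, a ∉ S → N a = 0 := by
    intro a ha
    rw [hS, not_not] at ha
    have := hN a
    rw [ha, mul_zero] at this
    exact_mod_cast this.symm
  constructor
  · refine fun h => ⟨fun i => ?_, fun a _ => h a⟩
    by_contra hi
    have h1 := h (x i)
    rw [hN0 _ hi, Finset.card_eq_zero] at h1
    have : i ∈ (Finset.univ.filter (x · = x i)) := by simp
    rw [h1] at this
    simp at this
  · rintro ⟨h1, h2⟩ a
    by_cases ha : a ∈ S
    · exact h2 a ha
    · rw [hN0 a ha, Finset.card_eq_zero, Finset.filter_eq_empty_iff]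
      rintro i - rfl
      exact ha (h1 i)

end Marginal

/-! ### The converse for constant composition codebooks at a fixed order. -/

section TypeOutput

variable {H : Type*} [NormedAddCommGroup H] [InnerProductSpace ℂ H] [CompleteSpace H]
variable {𝒳 : Type*} {p : PMF 𝒳} {ρ : 𝒳 → H →L[ℂ] H} {n : ℕ} {T : Finset (Fin n → 𝒳)}

theorem isDensity_tensorProd {A : Fin n → H →L[ℂ] H} (hA : ∀ k, IsDensity (A k)) :
    IsDensity (tensorProd A) := by
  obtain ⟨h1, h2⟩ := tensorProd_nonneg_and_ptrace (fun k => (hA k).1) fun k => by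
    rw [(hA k).2]; simp
  exact ⟨h1, by rw [h2]; simp [(hA _).2]⟩

theorem typeUniform_eq (hT : typeClass p n = T) (x : Fin n → 𝒳) :
    typeUniform p n x = (T : Set (Fin n → 𝒳)).indicator (fun _ => (T.card : ℝ≥0∞)⁻¹) x := by
  rw [typeUniform, hT, Set.ncard_coe_finset]

theorem typeOutput_eq (hT : typeClass p n = T) (ρ : 𝒳 → H →L[ℂ] H) :
    typeOutput p ρ n = (((Fintype.card T : ℝ)⁻¹ : ℝ) : ℂ) •
      ∑ x : T, tensorProd fun i => ρ (x.1 i) := by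
  rw [typeOutput, tsum_eq_sum (s := T), Finset.sum_coe_sort T fun x => tensorProd fun i => ρ (x i),
    Finset.smul_sum]
  · refine Finset.sum_congr rfl fun x hx => ?_
    rw [typeUniform_eq hT, Set.indicator_of_mem (by simpa using hx)]
    simp
  · intro x hx
    rw [typeUniform_eq hT, Set.indicator_of_notMem (by simpa using hx)]
    simp

theorem expectedTraceDist_eq (hT : typeClass p n = T) (ρ : 𝒳 → H →L[ℂ] H) (M : ℕ) :
    expectedTraceDist p ρ n M = ((Fintype.card T : ℝ≥0∞) ^ M)⁻¹ * ∑ c : Fin M → T,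
      2⁻¹ * traceNorm ((M : ℂ)⁻¹ • ∑ m, (tensorProd fun i => ρ ((c m).1 i)) - typeOutput p ρ n) := by
  have hinj : Function.Injective fun (c : Fin M → T) (m : Fin M) => (c m).1 := by
    intro c d h
    ext1 m
    exact Subtype.ext (congrFun h m)
  rw [expectedTraceDist, ← hinj.tsum_eq, tsum_fintype, Finset.mul_sum, Finset.mul_sum]
  · refine Finset.sum_congr rfl fun c _ => ?_
    have h : ∏ m, typeUniform p n (c m).1 = ((Fintype.card T : ℝ≥0∞) ^ M)⁻¹ := by
      rw [ENNReal.inv_pow]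
      simp [typeUniform_eq hT]
    rw [h, codebookState]
    ring
  · intro c hc
    have h1 : ∀ m, c m ∈ T := by
      intro m
      by_contra hm
      refine hc ?_
      have : typeUniform p n (c m) = 0 := by
        rw [typeUniform_eq hT, Set.indicator_of_notMem (by simpa using hm)]
      beta_reduce
      rw [Finset.prod_eq_zero (Finset.mem_univ m) this, zero_mul]
    exact ⟨fun m => ⟨c m, h1 m⟩, rfl⟩

theorem codebook_isDensity {M : ℕ} (hM : 0 < M) (hρ : ∀ x, IsDensity (ρ x))
    (c : Fin M → Fin n → 𝒳) :
    IsDensity ((M : ℂ)⁻¹ • ∑ m, (tensorProd fun i => ρ (c m i))) := by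
  have : Nonempty (Fin M) := ⟨⟨0, hM⟩⟩
  have h := isDensity_average (Ω := Fin M) (ρ := fun m => tensorProd fun i => ρ (c m i))
    fun m => isDensity_tensorProd fun i => hρ _
  simpa using h

/-- In the expansion of the tensor power of the marginal, every sequence of the type class carries
the same weight `w`, and all other terms are positive and can be dropped. What is left is `w * |T|`
times the average state, and `w * |T|`, the probability of the type class, is at least `(n + 1) ^
(-|S|)`. -/
theorem typeOutput_le [DecidableEq 𝒳] (hn : 0 < n) {N : 𝒳 → ℕ} {S : Finset 𝒳}
    (hN : ∀ x, (n : ℝ≥0∞) * p x = N x) (hS : ∀ x, x ∈ S ↔ p x ≠ 0) (hρ : ∀ x, IsDensity (ρ x)) :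
    typeOutput p ρ n ≤ ((((n : ℝ) + 1) ^ S.card : ℝ) : ℂ) •
      tensorProd fun _ : Fin n => marginal p ρ := by
  have hT := typeClass_eq hn hN hS
  set T := seqsOfType n S N with hTdef
  set w : ℝ := ∏ a ∈ S, (p a).toReal ^ N a with hw
  have hw0 : 0 ≤ w := Finset.prod_nonneg fun a _ => by positivity
  have hpos : ∀ x : Fin n → 𝒳, 0 ≤ tensorProd fun i => ρ (x i) := fun x =>
    (isDensity_tensorProd fun i => hρ (x i)).1
  have hTne : 0 < T.card := (exists_mem_seqsOfType (sum_counts hN hS)).card_pos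
  have h1 : (1 : ℝ) ≤ ((n : ℝ) + 1) ^ S.card * (T.card * w) := by
    have h2 := pow_le_card_seqsOfType_mul (sum_counts hN hS)
    have h3 : w = (∏ a ∈ S, (N a : ℝ) ^ N a) / (n : ℝ) ^ n := by
      rw [hw]
      simp_rw [toReal_eq_count_div hn hN, div_pow]
      rw [Finset.prod_div_distrib, Finset.prod_pow_eq_pow_sum, sum_counts hN hS]
    have hnn : (0 : ℝ) < (n : ℝ) ^ n := by positivity
    rw [h3, mul_div_assoc', mul_div_assoc', le_div_iff₀ hnn, one_mul]
    exact_mod_cast h2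
  have h4 : (w : ℂ) • ∑ x ∈ T, (tensorProd fun i => ρ (x i)) ≤
      tensorProd fun _ : Fin n => marginal p ρ := by
    rw [marginal_eq_sum hS, tensorProd_sum, Finset.smul_sum]
    have h5 : ∀ x ∈ T, (w : ℂ) • (tensorProd fun i => ρ (x i)) =
        (∏ k, ((p (x k)).toReal : ℂ)) • tensorProd fun i => ρ (x i) := by
      intro x hx
      rw [prod_of_mem_seqsOfType hx fun a => ((p a).toReal : ℂ), hw]
      push_cast
      rfl
    rw [Finset.sum_congr rfl h5]
    refine Finset.sum_le_sum_of_subset_of_nonneg (Finset.filter_subset _ _) fun x _ _ => ?_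
    rw [← Complex.ofReal_prod]
    exact smul_nonneg' (Finset.prod_nonneg fun _ _ => ENNReal.toReal_nonneg) (hpos x)
  have h6 := smul_le_smul' (c := ((n : ℝ) + 1) ^ S.card) (by positivity) h4
  refine le_trans ?_ h6
  rw [typeOutput_eq hT, Finset.sum_coe_sort T fun x => tensorProd fun i => ρ (x i), smul_smul,
    ← Complex.ofReal_mul, ← sub_nonneg, ← sub_smul, ← Complex.ofReal_sub]
  refine smul_nonneg' ?_ (Finset.sum_nonneg fun x _ => hpos x)
  rw [sub_nonneg, Fintype.card_coe, inv_le_iff_one_le_mul₀ (by exact_mod_cast hTne)]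
  linarith

/-- The strong converse bound for a fixed order. -/
theorem one_le_expectedTraceDist_add [DecidableEq 𝒳] (hn : 0 < n) {N : 𝒳 → ℕ} {S : Finset 𝒳}
    (hN : ∀ x, (n : ℝ≥0∞) * p x = N x) (hS : ∀ x, x ∈ S ↔ p x ≠ 0) (hρ : ∀ x, IsDensity (ρ x))
    {M : ℕ} (hM : 0 < M) {s : ℝ} (h0 : 0 < s) (h1 : s < 1) :
    1 ≤ expectedTraceDist p ρ n M + 6 * (ENNReal.ofReal ((M * ((n : ℝ) + 1) ^ S.card) ^ s) *
      ∏ a ∈ S, trMul (opPow (marginal p ρ) s) (opPow (ρ a) (1 - s)) ^ N a) := by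
  have hT := typeClass_eq hn hN hS
  set T := seqsOfType n S N with hTdef
  have hTne : Nonempty T := (exists_mem_seqsOfType (sum_counts hN hS)).to_subtype
  have hτ : IsDensity (marginal p ρ) := isDensity_marginal hS hρ
  have hτn := isDensity_tensorProd (n := n) fun _ => hτ
  have hle := typeOutput_le hn hN hS hρ
  set δ := ENNReal.ofReal ((M * ((n : ℝ) + 1) ^ S.card) ^ s) *
      ∏ a ∈ S, trMul (opPow (marginal p ρ) s) (opPow (ρ a) (1 - s)) ^ N a
  have hρn : ∀ x : T, IsDensity (tensorProd fun i => ρ (x.1 i)) := fun x =>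
    isDensity_tensorProd fun i => hρ _
  have hσ : 0 ≤ typeOutput p ρ n := by
    rw [typeOutput_eq hT]; exact (isDensity_average hρn).1
  have key := card_pow_le_sum_traceNorm hM hρn (δ := δ) (typeOutput_eq hT ρ) fun x => by
    -- The test compares with the scaled tensor power instead of `M` times the average state: it
    -- dominates the latter, and its trace against a codeword state factors over the sites.
    obtain ⟨Y, hY0, hY1, hY⟩ := exists_test_scaled (hρn x).1 hτn.1 (by rw [(hρn x).2]; simp)
      (by rw [hτn.2]; simp) (c := M * ((n : ℝ) + 1) ^ S.card) (by positivity) h0 h1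
    refine ⟨Y, hY0, hY1, le_trans ?_ (hY.trans_eq ?_)⟩
    · refine add_le_add_right ?_ _
      calc (M : ℝ≥0∞) * trMul (typeOutput p ρ n) Y
          ≤ M * trMul (((((n : ℝ) + 1) ^ S.card : ℝ) : ℂ) •
              tensorProd fun _ : Fin n => marginal p ρ) Y := by
            gcongr
            exact trMul_mono_left hσ hY0 hle
        _ = _ := by
            rw [trMul_smul_left (by positivity) hτn.1 hY0,
              ENNReal.ofReal_mul (Nat.cast_nonneg M : (0 : ℝ) ≤ M), ENNReal.ofReal_natCast,
              mul_assoc]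
    · rw [trMul_opPow_tensorProd (fun _ => hτ.1) (fun i => (hρ _).1) (fun _ => by rw [hτ.2]; simp)
        (fun i => by rw [(hρ _).2]; simp) h0.le (by linarith)]
      congr 1
      exact prod_of_mem_seqsOfType x.2 fun a => trMul (opPow (marginal p ρ) s) (opPow (ρ a) (1 - s))
  have hc0 : (Fintype.card T : ℝ≥0∞) ^ M ≠ 0 :=
    pow_ne_zero _ (Nat.cast_ne_zero.2 Fintype.card_ne_zero)
  have hct : (Fintype.card T : ℝ≥0∞) ^ M ≠ ⊤ := ENNReal.pow_ne_top (by simp)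
  rw [expectedTraceDist_eq hT, ← ENNReal.inv_mul_cancel hc0 hct]
  calc _ ≤ ((Fintype.card T : ℝ≥0∞) ^ M)⁻¹ * _ := mul_le_mul_right key _
    _ = _ := by
      rw [mul_add, ← mul_assoc _ _ (6 * δ), ENNReal.inv_mul_cancel hc0 hct, one_mul]

/-- Needed for finiteness, so that `toReal` loses nothing. -/
theorem expectedTraceDist_le_one [DecidableEq 𝒳] (hn : 0 < n) {N : 𝒳 → ℕ} {S : Finset 𝒳}
    (hN : ∀ x, (n : ℝ≥0∞) * p x = N x) (hS : ∀ x, x ∈ S ↔ p x ≠ 0) (hρ : ∀ x, IsDensity (ρ x))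
    {M : ℕ} (hM : 0 < M) : expectedTraceDist p ρ n M ≤ 1 := by
  have hT := typeClass_eq hn hN hS
  set T := seqsOfType n S N with hTdef
  have hTne : Nonempty T := (exists_mem_seqsOfType (sum_counts hN hS)).to_subtype
  have hσ : IsDensity (typeOutput p ρ n) := by
    rw [typeOutput_eq hT]
    exact isDensity_average fun x : T => isDensity_tensorProd fun i => hρ _
  rw [expectedTraceDist_eq hT]
  have hc0 : (Fintype.card T : ℝ≥0∞) ^ M ≠ 0 :=
    pow_ne_zero _ (Nat.cast_ne_zero.2 Fintype.card_ne_zero)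
  have hct : (Fintype.card T : ℝ≥0∞) ^ M ≠ ⊤ := ENNReal.pow_ne_top (by simp)
  rw [← ENNReal.inv_mul_cancel hc0 hct]
  gcongr
  calc _ ≤ ∑ c : Fin M → T, (1 : ℝ≥0∞) := Finset.sum_le_sum fun c _ =>
        traceNorm_sub_le (codebook_isDensity hM hρ fun m => (c m).1) hσ
    _ = _ := by simp

end TypeOutput


/-! ### The relative entropy as a supremum of Tsallis relative entropies -/

section Scalar

variable {a b s c : ℝ}

/-- The summand of the Tsallis relative entropy of order `1 - s`. -/
def tsallisTerm (s a b : ℝ) : ℝ≥0∞ := ENNReal.ofReal ((a - a ^ (1 - s) * b ^ s) / s - a + b)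

theorem rpow_one_sub_mul_rpow_le (ha : 0 ≤ a) (hb : 0 ≤ b) (h0 : 0 < s) (h1 : s < 1) :
    a ^ (1 - s) * b ^ s ≤ (1 - s) * a + s * b :=
  Real.geom_mean_le_arith_mean2_weighted (by linarith) h0.le ha hb (by ring)

theorem tsallisTerm_nonneg (ha : 0 ≤ a) (hb : 0 ≤ b) (h0 : 0 < s) (h1 : s < 1) :
    0 ≤ (a - a ^ (1 - s) * b ^ s) / s - a + b := by
  have h := rpow_one_sub_mul_rpow_le ha hb h0 h1
  have h2 : a - b ≤ (a - a ^ (1 - s) * b ^ s) / s := by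
    rw [le_div_iff₀ h0]
    linarith
  linarith

theorem rpow_one_sub_mul_rpow_eq (ha : 0 < a) (hb : 0 ≤ b) :
    a ^ (1 - s) * b ^ s = a * (b / a) ^ s := by
  rw [Real.rpow_sub ha, Real.rpow_one, Real.div_rpow hb ha.le]
  ring

theorem log_div_eq (ha : 0 < a) (hb : 0 < b) (h0 : 0 < s) :
    a * Real.log (a / b) = -(a * Real.log ((b / a) ^ s)) / s := by
  rw [Real.log_rpow (by positivity), ← inv_div, Real.log_inv]
  field_simp

/-- The definition of `tsallisTerm` with all subtractions moved across, so that it can be summed in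
`[0, ∞]`. -/
theorem tsallisTerm_add (ha : 0 ≤ a) (hb : 0 ≤ b) (h0 : 0 < s) (h1 : s < 1) :
    tsallisTerm s a b +
      (ENNReal.ofReal s⁻¹ * ENNReal.ofReal (a ^ (1 - s) * b ^ s) + ENNReal.ofReal a) =
        ENNReal.ofReal s⁻¹ * ENNReal.ofReal a + ENNReal.ofReal b := by
  have hi : 0 ≤ s⁻¹ := by positivity
  have h := tsallisTerm_nonneg ha hb h0 h1
  rw [tsallisTerm, ← ENNReal.ofReal_mul hi, ← ENNReal.ofReal_mul hi,
    ← ENNReal.ofReal_add (by positivity) ha, ← ENNReal.ofReal_add h (by positivity),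
    ← ENNReal.ofReal_add (by positivity) hb]
  congr 1
  field_simp
  ring

/-- The tangent line of the logarithm at `c` bounds the relative entropy from below. -/
theorem le_relEntropyTerm_add (ha : 0 ≤ a) (hb : 0 ≤ b) (h0 : 0 < s) (h1 : s < 1) (hc : 0 < c)
    (hc1 : c ≤ 1) :
    ENNReal.ofReal ((1 - Real.log c) / s) * ENNReal.ofReal a + ENNReal.ofReal b ≤
      relEntropyTerm a b + (ENNReal.ofReal (s⁻¹ * c⁻¹) * ENNReal.ofReal (a ^ (1 - s) * b ^ s) +
        ENNReal.ofReal a) := by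
  have hl : 0 ≤ 1 - Real.log c := by linarith [Real.log_nonpos hc.le hc1]
  rw [relEntropyTerm]
  split_ifs with h
  · simp
  rw [← ENNReal.ofReal_mul (by positivity), ← ENNReal.ofReal_mul (by positivity),
    ← ENNReal.ofReal_add (by positivity) hb, ← ENNReal.ofReal_add (by positivity) ha]
  refine (ENNReal.ofReal_le_ofReal ?_).trans ENNReal.ofReal_add_le
  rcases ha.eq_or_lt with rfl | ha
  · rw [Real.zero_rpow (by linarith)]
    simp
  have hb : 0 < b := hb.lt_of_ne fun hb => h ⟨hb.symm, ha.ne'⟩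
  rw [rpow_one_sub_mul_rpow_eq ha hb.le, log_div_eq ha hb h0]
  set y := (b / a) ^ s with hy
  have hy0 : 0 < y := by positivity
  -- The tangent line at `c`: `log y ≤ log c + y / c - 1`, multiplied below by `a / s`.
  have h2 := Real.log_le_sub_one_of_pos (x := y / c) (by positivity)
  rw [Real.log_div hy0.ne' hc.ne'] at h2
  have h3 : a * (1 - Real.log c) ≤ -(a * Real.log y) + a * (y / c) := by nlinarith
  have h4 : a * (1 - Real.log c) / s ≤ (-(a * Real.log y) + a * (y / c)) / s := by gcongr
  have h5 : s⁻¹ * c⁻¹ * (a * y) = a * (y / c) / s := by field_simp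
  have h6 : (1 - Real.log c) / s * a = a * (1 - Real.log c) / s := by ring
  rw [h5, h6]
  rw [add_div] at h4
  linarith

theorem tsallisTerm_le_relEntropyTerm (ha : 0 ≤ a) (hb : 0 ≤ b) (h0 : 0 < s) (h1 : s < 1) :
    tsallisTerm s a b ≤ relEntropyTerm a b := by
  have h := le_relEntropyTerm_add ha hb h0 h1 one_pos le_rfl
  simp only [Real.log_one, sub_zero, one_div, inv_one, mul_one] at h
  rw [← tsallisTerm_add ha hb h0 h1] at h
  refine (ENNReal.add_le_add_iff_right ?_).1 h
  exact ENNReal.add_ne_top.2 ⟨ENNReal.mul_ne_top ENNReal.ofReal_ne_top ENNReal.ofReal_ne_top,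
    ENNReal.ofReal_ne_top⟩

/-- A sequence of orders that tends to `0`. -/
def smallOrder (k : ℕ) : ℝ := 1 / ((k : ℝ) + 2)

theorem smallOrder_pos (k : ℕ) : 0 < smallOrder k := by unfold smallOrder; positivity

theorem smallOrder_lt_one (k : ℕ) : smallOrder k < 1 := by
  rw [smallOrder, div_lt_one (by positivity)]
  linarith [(Nat.cast_nonneg k : (0 : ℝ) ≤ k)]

theorem tendsto_smallOrder : Filter.Tendsto smallOrder Filter.atTop (nhdsWithin 0 {0}ᶜ) := by
  refine tendsto_nhdsWithin_iff.2 ⟨?_, .of_forall fun k => (smallOrder_pos k).ne'⟩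
  refine Filter.Tendsto.const_div_atTop ?_ _
  exact Filter.tendsto_atTop_add_const_right _ _ tendsto_natCast_atTop_atTop

/-- For positive `a`, `b` the quotient is a difference quotient at `0` of `s ↦ -(a * (b / a) ^ s)`.
For `b = 0 < a` the terms are `(k + 1) * a` and diverge, matching the value `⊤`. -/
theorem tendsto_tsallisTerm (ha : 0 ≤ a) (hb : 0 ≤ b) :
    Filter.Tendsto (fun k => tsallisTerm (smallOrder k) a b) Filter.atTop
      (nhds (relEntropyTerm a b)) := by
  rcases ha.eq_or_lt with rfl | ha
  · have h : ∀ k, tsallisTerm (smallOrder k) 0 b = relEntropyTerm 0 b := fun k => by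
      rw [tsallisTerm, relEntropyTerm, Real.zero_rpow (by linarith [smallOrder_lt_one k])]
      simp
    simp_rw [h]
    exact tendsto_const_nhds
  rcases hb.eq_or_lt with rfl | hb
  · have h : ∀ k, tsallisTerm (smallOrder k) a 0 = ENNReal.ofReal ((k + 1) * a) := fun k => by
      rw [tsallisTerm, Real.zero_rpow (smallOrder_pos k).ne', smallOrder]
      congr 1
      field_simp
      ring
    simp_rw [h]
    rw [relEntropyTerm, if_pos ⟨rfl, ha.ne'⟩]
    refine ENNReal.tendsto_ofReal_atTop.comp ?_
    exact (Filter.tendsto_atTop_add_const_right _ _ tendsto_natCast_atTop_atTop).atTop_mul_const ha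
  rw [relEntropyTerm, if_neg (fun h => hb.ne' h.1)]
  refine ENNReal.tendsto_ofReal ?_
  refine Filter.Tendsto.add_const _ (Filter.Tendsto.sub_const ?_ _)
  have hd : HasDerivAt (fun s : ℝ => -(a * (b / a) ^ s)) (a * Real.log (a / b)) 0 := by
    have h := ((Real.hasStrictDerivAt_const_rpow (a := b / a) (by positivity) 0).hasDerivAt.const_mul
      a).neg
    refine h.congr_deriv ?_
    rw [Real.rpow_zero, one_mul, ← inv_div a b, Real.log_inv]
    ring
  have h := hd.tendsto_slope_zero.comp tendsto_smallOrder
  refine h.congr fun k => ?_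
  simp only [Function.comp_apply, zero_add, Real.rpow_zero, smul_eq_mul]
  rw [rpow_one_sub_mul_rpow_eq ha hb.le]
  ring

end Scalar

/-! ### Relative entropy and Rényi traces as sums over pairs of eigenvalues. -/

section EigenSum

variable {K : Type*} [NormedAddCommGroup K] [InnerProductSpace ℂ K] [CompleteSpace K]
variable {ι κ : Type*}

/-- The sum of `g` over pairs of eigenvalues, weighted with the overlaps of the eigenvectors. -/
def eigenSum (e : HilbertBasis ι ℂ K) (a : ι → ℝ) (f : HilbertBasis κ ℂ K) (b : κ → ℝ)
    (g : ℝ → ℝ → ℝ≥0∞) : ℝ≥0∞ :=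
  ∑' i, ∑' j, ENNReal.ofReal (‖inner ℂ (e i) (f j)‖ ^ 2) * g (a i) (b j)

variable {e : HilbertBasis ι ℂ K} {a : ι → ℝ} {f : HilbertBasis κ ℂ K} {b : κ → ℝ}
variable {A B : K →L[ℂ] K} {s : ℝ}

theorem eigenSum_add (g h : ℝ → ℝ → ℝ≥0∞) :
    eigenSum e a f b (fun x y => g x y + h x y) = eigenSum e a f b g + eigenSum e a f b h := by
  simp only [eigenSum, mul_add, ENNReal.tsum_add]

theorem eigenSum_const_mul (c : ℝ≥0∞) (g : ℝ → ℝ → ℝ≥0∞) :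
    eigenSum e a f b (fun x y => c * g x y) = c * eigenSum e a f b g := by
  simp only [eigenSum, ← ENNReal.tsum_mul_left, mul_left_comm]

theorem eigenSum_mono (ha : ∀ i, 0 ≤ a i) (hb : ∀ j, 0 ≤ b j) {g h : ℝ → ℝ → ℝ≥0∞}
    (H : ∀ x y, 0 ≤ x → 0 ≤ y → g x y ≤ h x y) : eigenSum e a f b g ≤ eigenSum e a f b h :=
  ENNReal.tsum_le_tsum fun i => ENNReal.tsum_le_tsum fun j =>
    mul_le_mul_right (H _ _ (ha i) (hb j)) _

theorem eigenSum_left (hA : 0 ≤ A) (ha : IsEigen A e a) :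
    eigenSum e a f b (fun x _ => ENNReal.ofReal x) = ptrace A := by
  rw [ha.ptrace_eq hA]
  refine tsum_congr fun i => ?_
  rw [ENNReal.tsum_mul_right]
  simp_rw [norm_inner_symm (e i)]
  rw [HilbertBasis.tsum_ofReal_norm_inner_sq, norm_hilbertBasis]
  simp

theorem eigenSum_right (hB : 0 ≤ B) (hb : IsEigen B f b) :
    eigenSum e a f b (fun _ y => ENNReal.ofReal y) = ptrace B := by
  rw [hb.ptrace_eq hB, eigenSum, ENNReal.tsum_comm]
  refine tsum_congr fun j => ?_
  rw [ENNReal.tsum_mul_right, HilbertBasis.tsum_ofReal_norm_inner_sq, norm_hilbertBasis]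
  simp

/-- `Tr A ^ (1 - s) B ^ s`. -/
def renyiTrace (s : ℝ) (A B : K →L[ℂ] K) : ℝ≥0∞ := trMul (opPow B s) (opPow A (1 - s))

theorem eigenSum_rpow (hA : 0 ≤ A) (hB : 0 ≤ B) (ha : IsEigen A e a) (hb : IsEigen B f b)
    (h0 : 0 ≤ s) (h1 : s ≤ 1) :
    eigenSum e a f b (fun x y => ENNReal.ofReal (x ^ (1 - s) * y ^ s)) = renyiTrace s A B := by
  rw [renyiTrace, trMul_comm (opPow_nonneg _ _) (opPow_nonneg _ _),
    IsEigen.trMul_eq (opPow_nonneg _ _) (opPow_nonneg _ _) (ha.opPow hA (by linarith))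
      (hb.opPow hB h0)]
  rfl

theorem eigenSum_tsallisTerm_add (hA : IsDensity A) (hB : IsDensity B) (ha : IsEigen A e a)
    (hb : IsEigen B f b) (h0 : 0 < s) (h1 : s < 1) :
    eigenSum e a f b (tsallisTerm s) + (ENNReal.ofReal s⁻¹ * renyiTrace s A B + 1) =
      ENNReal.ofReal s⁻¹ + 1 := by
  have h : eigenSum e a f b (fun x y => tsallisTerm s x y + (ENNReal.ofReal s⁻¹ *
      ENNReal.ofReal (x ^ (1 - s) * y ^ s) + ENNReal.ofReal x)) =
      eigenSum e a f b (fun x y => ENNReal.ofReal s⁻¹ * ENNReal.ofReal x + ENNReal.ofReal y) :=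
    tsum_congr fun i => tsum_congr fun j => by
      beta_reduce
      rw [tsallisTerm_add (ha.nonneg hA.1 i) (hb.nonneg hB.1 j) h0 h1]
  rw [eigenSum_add, eigenSum_add, eigenSum_add, eigenSum_const_mul, eigenSum_const_mul,
    eigenSum_left hA.1 ha, eigenSum_right hB.1 hb, eigenSum_rpow hA.1 hB.1 ha hb h0.le h1.le,
    hA.2, hB.2, mul_one] at h
  exact h

/-- A consequence of the nonnegativity of the Tsallis terms, that is, of the weighted
arithmetic-geometric mean inequality. -/
theorem renyiTrace_le_one (hA : IsDensity A) (hB : IsDensity B) (h0 : 0 < s) (h1 : s < 1) :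
    renyiTrace s A B ≤ 1 := by
  obtain ⟨e⟩ := exists_eigenbasis hA.1 (by rw [hA.2]; simp)
  obtain ⟨f⟩ := exists_eigenbasis hB.1 (by rw [hB.2]; simp)
  have h := eigenSum_tsallisTerm_add hA hB e.apply_basis f.apply_basis h0 h1
  have h2 : ENNReal.ofReal s⁻¹ * renyiTrace s A B + 1 ≤ ENNReal.ofReal s⁻¹ * 1 + 1 := by
    rw [mul_one, ← h]
    exact le_add_self
  rw [ENNReal.add_le_add_iff_right (by simp)] at h2
  refine (ENNReal.mul_le_mul_iff_right ?_ ENNReal.ofReal_ne_top).1 h2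
  rw [ENNReal.ofReal_ne_zero_iff]
  positivity

theorem eigenSum_tsallisTerm (hA : IsDensity A) (hB : IsDensity B) (ha : IsEigen A e a)
    (hb : IsEigen B f b) (h0 : 0 < s) (h1 : s < 1) :
    eigenSum e a f b (tsallisTerm s) = ENNReal.ofReal s⁻¹ * (1 - renyiTrace s A B) := by
  have h := eigenSum_tsallisTerm_add hA hB ha hb h0 h1
  have hq := renyiTrace_le_one hA hB h0 h1
  rw [← add_assoc, ENNReal.add_left_inj (by simp)] at h
  rw [ENNReal.mul_sub fun _ _ => ENNReal.ofReal_ne_top, mul_one]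
  refine ENNReal.eq_sub_of_add_eq ?_ h
  exact ENNReal.mul_ne_top ENNReal.ofReal_ne_top (ne_top_of_le_ne_top (by simp) hq)

/-- Termwise comparison gives one inequality, Fatou's lemma the other. The right side does not
mention the bases, so the infimum in `relEntropy` is over a constant. -/
theorem eigenSum_relEntropyTerm (hA : IsDensity A) (hB : IsDensity B) (ha : IsEigen A e a)
    (hb : IsEigen B f b) : eigenSum e a f b relEntropyTerm =
      ⨆ k, ENNReal.ofReal (smallOrder k)⁻¹ * (1 - renyiTrace (smallOrder k) A B) := by
  have hk : ∀ k, ENNReal.ofReal (smallOrder k)⁻¹ * (1 - renyiTrace (smallOrder k) A B) =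
      eigenSum e a f b (tsallisTerm (smallOrder k)) := fun k =>
    (eigenSum_tsallisTerm hA hB ha hb (smallOrder_pos k) (smallOrder_lt_one k)).symm
  have h1 := fun i => ha.nonneg hA.1 i
  have h2 := fun j => hb.nonneg hB.1 j
  simp_rw [hk]
  refine le_antisymm ?_ (iSup_le fun k => eigenSum_mono h1 h2 fun x y hx hy =>
    tsallisTerm_le_relEntropyTerm hx hy (smallOrder_pos k) (smallOrder_lt_one k))
  -- With every set measurable, the double sum is an integral for the counting measure, to which
  -- Fatou's lemma applies.
  let _ : MeasurableSpace (ι × κ) := ⊤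
  have hE : ∀ g, eigenSum e a f b g = ∫⁻ z : ι × κ, ENNReal.ofReal (‖inner ℂ (e z.1) (f z.2)‖ ^ 2) *
      g (a z.1) (b z.2) ∂MeasureTheory.Measure.count := fun g => by
    rw [MeasureTheory.lintegral_count' measurable_from_top, ENNReal.tsum_prod']
    rfl
  calc eigenSum e a f b relEntropyTerm
      = ∫⁻ z : ι × κ, Filter.liminf (fun k => ENNReal.ofReal (‖inner ℂ (e z.1) (f z.2)‖ ^ 2) *
          tsallisTerm (smallOrder k) (a z.1) (b z.2)) Filter.atTop ∂MeasureTheory.Measure.count := by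
        rw [hE]
        refine MeasureTheory.lintegral_congr fun z => ?_
        exact (ENNReal.Tendsto.const_mul (tendsto_tsallisTerm (h1 _) (h2 _))
          (.inr ENNReal.ofReal_ne_top)).liminf_eq.symm
    _ ≤ Filter.liminf (fun k => eigenSum e a f b (tsallisTerm (smallOrder k))) Filter.atTop := by
        simp_rw [hE]
        exact MeasureTheory.lintegral_liminf_le fun _ => measurable_from_top
    _ ≤ _ := by
        refine Filter.liminf_le_of_frequently_le' (Filter.Frequently.of_forall fun k => ?_)
        exact le_iSup (fun k => eigenSum e a f b (tsallisTerm (smallOrder k))) k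

theorem relEntropy_eq_iSup (hA : IsDensity A) (hB : IsDensity B) : relEntropy A B =
    ⨆ k, ENNReal.ofReal (smallOrder k)⁻¹ * (1 - renyiTrace (smallOrder k) A B) := by
  have : Nonempty (Eigenbasis A) := exists_eigenbasis hA.1 (by rw [hA.2]; simp)
  have : Nonempty (Eigenbasis B) := exists_eigenbasis hB.1 (by rw [hB.2]; simp)
  have h : ∀ (e : Eigenbasis A) (f : Eigenbasis B), ∑' i, ∑' j,
      ENNReal.ofReal (‖inner ℂ (e.basis i) (f.basis j)‖ ^ 2) * relEntropyTerm (e.val i) (f.val j) =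
      ⨆ k, ENNReal.ofReal (smallOrder k)⁻¹ * (1 - renyiTrace (smallOrder k) A B) := fun e f =>
    eigenSum_relEntropyTerm hA hB e.apply_basis f.apply_basis
  simp_rw [relEntropy, h, iInf_const]

theorem relEntropy_eq_eigenSum (hA : IsDensity A) (hB : IsDensity B) (ha : IsEigen A e a)
    (hb : IsEigen B f b) : relEntropy A B = eigenSum e a f b relEntropyTerm := by
  rw [relEntropy_eq_iSup hA hB, eigenSum_relEntropyTerm hA hB ha hb]

/-- The Rényi divergences of order less than one are at most the relative entropy. -/
theorem neg_log_renyiTrace_div_le (hA : IsDensity A) (hB : IsDensity B) (h0 : 0 < s) (h1 : s < 1)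
    (hq : renyiTrace s A B ≠ 0) :
    ENNReal.ofReal (-Real.log (renyiTrace s A B).toReal / s) ≤ relEntropy A B := by
  obtain ⟨e⟩ := exists_eigenbasis hA.1 (by rw [hA.2]; simp)
  obtain ⟨f⟩ := exists_eigenbasis hB.1 (by rw [hB.2]; simp)
  have ha : IsEigen A e.basis e.val := e.apply_basis
  have hb : IsEigen B f.basis f.val := f.apply_basis
  rw [relEntropy_eq_eigenSum hA hB ha hb]
  have hq1 := renyiTrace_le_one hA hB h0 h1
  have hqt : renyiTrace s A B ≠ ⊤ := ne_top_of_le_ne_top (by simp) hq1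
  set c := (renyiTrace s A B).toReal with hc
  have hc0 : 0 < c := ENNReal.toReal_pos hq hqt
  have hc1 : c ≤ 1 := by
    have := ENNReal.toReal_mono (by simp) hq1
    simpa using this
  -- The tangent point `c` is the Rényi trace itself. The correction `s⁻¹ * c⁻¹ * c` is then `s⁻¹`
  -- and cancels, leaving exactly `-log c / s`.
  have h := eigenSum_mono (e := e.basis) (f := f.basis) (fun i => ha.nonneg hA.1 i)
    (fun j => hb.nonneg hB.1 j) fun x y hx hy => le_relEntropyTerm_add hx hy h0 h1 hc0 hc1
  rw [eigenSum_add, eigenSum_add, eigenSum_add, eigenSum_const_mul, eigenSum_const_mul,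
    eigenSum_left hA.1 ha, eigenSum_right hB.1 hb, eigenSum_rpow hA.1 hB.1 ha hb h0.le h1.le,
    hA.2, hB.2, mul_one, ← ENNReal.ofReal_toReal hqt, ← hc, ← ENNReal.ofReal_mul (by positivity),
    inv_mul_cancel_right₀ hc0.ne', ← add_assoc, ENNReal.add_le_add_iff_right (by simp), sub_eq_add_neg,
    add_div, ENNReal.ofReal_add (by positivity)
      (div_nonneg (by linarith [Real.log_nonpos hc0.le hc1]) h0.le), one_div, add_comm] at h
  exact (ENNReal.add_le_add_iff_right ENNReal.ofReal_ne_top).1 h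

end EigenSum


/-! ### Classical-quantum states -/

section CqVec

variable {𝒳 I : Type*}

theorem prodMk_injective (x : 𝒳) : Function.Injective fun i : I => (x, i) := fun i j h => by
  simpa using h

open Classical in
theorem summable_cqVec (x : 𝒳) (v : Ell2 I) :
    Summable fun z : 𝒳 × I => ‖if z.1 = x then v z.2 else 0‖ ^ 2 := by
  refine ((prodMk_injective x).summable_iff ?_).1 ?_
  · rintro ⟨y, i⟩ h
    have : y ≠ x := fun hy => h ⟨i, by rw [hy]⟩
    simp [this]
  · refine (summable_sq v).congr fun i => ?_
    simp

open Classical in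
/-- The vector `|x⟩ ⊗ v`. -/
def cqVec (x : 𝒳) (v : Ell2 I) : Ell2 (𝒳 × I) :=
  ⟨fun z => if z.1 = x then v z.2 else 0, memℓp_two (summable_cqVec x v)⟩

open Classical in
theorem cqVec_apply (x : 𝒳) (v : Ell2 I) (z : 𝒳 × I) :
    cqVec x v z = if z.1 = x then v z.2 else 0 := rfl

theorem cqVec_smul (x : 𝒳) (c : ℂ) (v : Ell2 I) : cqVec x (c • v) = c • cqVec x v := by
  classical
  ext z
  simp [cqVec_apply]

open Classical in
theorem slice_cqVec (x y : 𝒳) (v : Ell2 I) :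
    slice (Equiv.prodComm 𝒳 I) (cqVec x v) y = if y = x then v else 0 := by
  ext i
  rw [slice_apply]
  change cqVec x v (y, i) = _
  rw [cqVec_apply]
  split_ifs <;> rfl

theorem inner_cqVec_left (x : 𝒳) (v : Ell2 I) (F : Ell2 (𝒳 × I)) :
    inner ℂ (cqVec x v) F = inner ℂ v (slice (Equiv.prodComm 𝒳 I) F x) := by
  classical
  rw [lp.inner_eq_tsum, lp.inner_eq_tsum, ← (prodMk_injective x).tsum_eq]
  · refine tsum_congr fun i => ?_
    rw [cqVec_apply, if_pos rfl]
    rfl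
  · rintro ⟨y, i⟩ h
    by_contra hy
    have hy : y ≠ x := fun h => hy ⟨i, by rw [h]⟩
    refine h ?_
    simp [cqVec_apply, hy]

open Classical in
theorem inner_cqVec (x y : 𝒳) (v w : Ell2 I) :
    inner ℂ (cqVec x v) (cqVec y w) = if x = y then inner ℂ v w else 0 := by
  rw [inner_cqVec_left, slice_cqVec]
  split_ifs <;> simp

theorem cqVec_ell2Basis (x : 𝒳) (i : I) : cqVec x (ell2Basis I i) = ell2Basis (𝒳 × I) (x, i) := by
  classical
  ext ⟨y, j⟩
  simp only [cqVec_apply, ell2Basis_apply, Prod.mk.injEq]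
  split_ifs <;> simp_all

/-- The basis in the block of `x` may depend on `x`, as required to diagonalise a classical-quantum
state. -/
theorem exists_cqBasis {ι : 𝒳 → Type*} (e : ∀ x, HilbertBasis (ι x) ℂ (Ell2 I)) :
    ∃ b : HilbertBasis (Σ x, ι x) ℂ (Ell2 (𝒳 × I)), ∀ z, b z = cqVec z.1 (e z.1 z.2) := by
  classical
  have ho : Orthonormal ℂ fun z : Σ x, ι x => cqVec z.1 (e z.1 z.2) := by
    rw [orthonormal_iff_ite]
    rintro ⟨x, i⟩ ⟨y, j⟩
    rw [inner_cqVec]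
    by_cases h : x = y
    · subst h
      rw [if_pos rfl, orthonormal_iff_ite.1 (e x).orthonormal]
      simp
    · simp [h]
  have h1 := orthogonal_span_eq_bot (ell2Basis (𝒳 × I)) ho fun z => by
    obtain ⟨y, j⟩ := z
    rw [ENNReal.tsum_sigma', tsum_eq_single y]
    · simp_rw [← cqVec_ell2Basis, inner_cqVec, if_true]
      rw [HilbertBasis.tsum_ofReal_norm_inner_sq, norm_hilbertBasis]
      simp
    · intro x hx
      simp [← cqVec_ell2Basis, inner_cqVec, hx]
  exact ⟨HilbertBasis.mkOfOrthogonalEqBot ho h1, fun z => by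
    rw [HilbertBasis.coe_mkOfOrthogonalEqBot]⟩

theorem ampl_prodComm_cqVec (A : Ell2 I →L[ℂ] Ell2 I) (x : 𝒳) (v : Ell2 I) :
    ampl (Equiv.prodComm 𝒳 I) A (cqVec x v) = cqVec x (A v) := by
  classical
  ext ⟨y, i⟩
  change A (slice (Equiv.prodComm 𝒳 I) (cqVec x v) y) i = _
  rw [slice_cqVec, cqVec_apply]
  by_cases h : y = x <;> simp [h]

theorem ampl_refl_cqVec {A : Ell2 𝒳 →L[ℂ] Ell2 𝒳} {x : 𝒳} {c : ℂ}
    (hA : A (ell2Basis 𝒳 x) = c • ell2Basis 𝒳 x) (v : Ell2 I) :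
    ampl (Equiv.refl (𝒳 × I)) A (cqVec x v) = c • cqVec x v := by
  classical
  ext ⟨y, i⟩
  change A (slice (Equiv.refl (𝒳 × I)) (cqVec x v) i) y = c • cqVec x v (y, i)
  have h : slice (Equiv.refl (𝒳 × I)) (cqVec x v) i = v i • ell2Basis 𝒳 x := by
    ext y
    rw [slice_apply]
    change cqVec x v (y, i) = v i • ell2Basis 𝒳 x y
    rw [cqVec_apply, ell2Basis_apply]
    simp
  rw [h, map_smul, hA]
  change v i • c • ell2Basis 𝒳 x y = _
  rw [cqVec_apply, ell2Basis_apply]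
  by_cases h : y = x <;> simp [h, mul_comm]

theorem tensor_cqVec {A : Ell2 𝒳 →L[ℂ] Ell2 𝒳} {x : 𝒳} {c : ℂ}
    (hA : A (ell2Basis 𝒳 x) = c • ell2Basis 𝒳 x) (B : Ell2 I →L[ℂ] Ell2 I) (v : Ell2 I) :
    tensor A B (cqVec x v) = c • cqVec x (B v) := by
  rw [tensor, mul_apply_eq_comp, ampl_prodComm_cqVec, ampl_refl_cqVec hA]

open Classical in
theorem ketbra_ell2Basis (x y : 𝒳) :
    ketbra x (ell2Basis 𝒳 y) = (if x = y then 1 else 0 : ℂ) • ell2Basis 𝒳 y := by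
  have h : (lp.single 2 x (1 : ℂ) : Ell2 𝒳) = ell2Basis 𝒳 x := (ell2Basis 𝒳).repr_symm_single x
  rw [ketbra, h, InnerProductSpace.rankOne_apply, orthonormal_iff_ite.1 (ell2Basis 𝒳).orthonormal]
  by_cases hxy : x = y <;> simp [hxy]

end CqVec

section CqState

variable {H : Type*} [NormedAddCommGroup H] [InnerProductSpace ℂ H] [CompleteSpace H]
variable {𝒳 : Type*} {p : PMF 𝒳} {S : Finset 𝒳} {ρ : 𝒳 → H →L[ℂ] H}

theorem sum_pmf_ite [DecidableEq 𝒳] (hS : ∀ x, x ∈ S ↔ p x ≠ 0) (y : 𝒳) :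
    ∑ x ∈ S, ((p x).toReal : ℂ) * (if x = y then 1 else 0) = (p y).toReal := by
  simp only [mul_ite, mul_one, mul_zero, Finset.sum_ite_eq']
  split_ifs with h
  · rfl
  · rw [hS, not_not] at h
    simp [h]

theorem classicalState_ell2Basis (hS : ∀ x, x ∈ S ↔ p x ≠ 0) (y : 𝒳) :
    classicalState p (ell2Basis 𝒳 y) = ((p y).toReal : ℂ) • ell2Basis 𝒳 y := by
  classical
  rw [classicalState, tsum_eq_sum (s := S), sum_apply, ← sum_pmf_ite hS, Finset.sum_smul]
  · refine Finset.sum_congr rfl fun x _ => ?_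
    rw [smul_apply, ketbra_ell2Basis, smul_smul]
  · intro x hx
    rw [hS, not_not] at hx
    simp [hx]

theorem cqState_cqVec (hS : ∀ x, x ∈ S ↔ p x ≠ 0) (y : 𝒳) (v : Ell2 (basisIdx H)) :
    cqState p ρ (cqVec y v) = ((p y).toReal : ℂ) • cqVec y (toEll2 (ρ y) v) := by
  classical
  rw [cqState, tsum_eq_sum (s := S), sum_apply, ← sum_pmf_ite hS, Finset.sum_smul]
  · refine Finset.sum_congr rfl fun x _ => ?_
    rw [smul_apply, tensor_cqVec (ketbra_ell2Basis x y), smul_smul]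
    by_cases h : x = y <;> simp [h]
  · intro x hx
    rw [hS, not_not] at hx
    simp [hx]

variable {ι κ : 𝒳 → Type*} {e : ∀ x, HilbertBasis (ι x) ℂ H} {a : ∀ x, ι x → ℝ}
variable {f : ∀ x, HilbertBasis (κ x) ℂ H} {b : ∀ x, κ x → ℝ} {B : H →L[ℂ] H}

theorem isEigen_cqState (hS : ∀ x, x ∈ S ↔ p x ≠ 0) (he : ∀ x, IsEigen (ρ x) (e x) (a x))
    {E : HilbertBasis (Σ x, ι x) ℂ (Ell2 (𝒳 × basisIdx H))}
    (hE : ∀ z, E z = cqVec z.1 (toEll2Basis (e z.1) z.2)) :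
    IsEigen (cqState p ρ) E fun z => (p z.1).toReal * a z.1 z.2 := fun z => by
  rw [hE, cqState_cqVec hS, (he z.1).toEll2 z.2, cqVec_smul, smul_smul, Complex.ofReal_mul]

theorem isEigen_tensor_classicalState (hS : ∀ x, x ∈ S ↔ p x ≠ 0)
    (hf : ∀ x, IsEigen B (f x) (b x)) {F : HilbertBasis (Σ x, κ x) ℂ (Ell2 (𝒳 × basisIdx H))}
    (hF : ∀ z, F z = cqVec z.1 (toEll2Basis (f z.1) z.2)) :
    IsEigen (tensor (classicalState p) (toEll2 B)) F fun z => (p z.1).toReal * b z.1 z.2 :=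
  fun z => by
    rw [hF, tensor_cqVec (classicalState_ell2Basis hS z.1), (hf z.1).toEll2 z.2, cqVec_smul,
      smul_smul, Complex.ofReal_mul]

theorem isDensity_of_isEigen_sigma {T : Ell2 (𝒳 × basisIdx H) →L[ℂ] Ell2 (𝒳 × basisIdx H)}
    {E : HilbertBasis (Σ x, ι x) ℂ (Ell2 (𝒳 × basisIdx H))}
    (hT : IsEigen T E fun z => (p z.1).toReal * a z.1 z.2) (hρ : ∀ x, IsDensity (ρ x))
    (he : ∀ x, IsEigen (ρ x) (e x) (a x)) : IsDensity T := by
  have h0 : 0 ≤ T := hT.op_nonneg fun z =>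
    mul_nonneg ENNReal.toReal_nonneg ((he z.1).nonneg (hρ z.1).1 z.2)
  refine ⟨h0, ?_⟩
  rw [hT.ptrace_eq h0, ENNReal.tsum_sigma', ← p.tsum_coe]
  refine tsum_congr fun x => ?_
  simp_rw [ENNReal.ofReal_mul ENNReal.toReal_nonneg]
  rw [ENNReal.tsum_mul_left, ← (he x).ptrace_eq (hρ x).1, (hρ x).2, mul_one,
    ENNReal.ofReal_toReal (p.apply_ne_top x)]

/-- Overlaps between different blocks vanish, and within the block of `x` both eigenvalues carry the
factor `p x`. Homogeneity of `g` of degree one pulls this factor out. -/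
theorem eigenSum_cqBasis {E : HilbertBasis (Σ x, ι x) ℂ (Ell2 (𝒳 × basisIdx H))}
    (hE : ∀ z, E z = cqVec z.1 (toEll2Basis (e z.1) z.2))
    {F : HilbertBasis (Σ x, κ x) ℂ (Ell2 (𝒳 × basisIdx H))}
    (hF : ∀ z, F z = cqVec z.1 (toEll2Basis (f z.1) z.2)) (ha : ∀ x i, 0 ≤ a x i)
    (hb : ∀ x j, 0 ≤ b x j) {g : ℝ → ℝ → ℝ≥0∞}
    (hg : ∀ c x y, 0 ≤ c → 0 ≤ x → 0 ≤ y → g (c * x) (c * y) = ENNReal.ofReal c * g x y) :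
    eigenSum E (fun z => (p z.1).toReal * a z.1 z.2) F (fun z => (p z.1).toReal * b z.1 z.2) g =
      ∑' x, p x * eigenSum (e x) (a x) (f x) (b x) g := by
  classical
  rw [eigenSum, ENNReal.tsum_sigma']
  refine tsum_congr fun x => ?_
  rw [eigenSum, ← ENNReal.tsum_mul_left]
  refine tsum_congr fun i => ?_
  rw [ENNReal.tsum_sigma', tsum_eq_single x, ← ENNReal.tsum_mul_left]
  · refine tsum_congr fun j => ?_
    rw [hE, hF, inner_cqVec, if_pos rfl, inner_toEll2Basis,
      hg _ _ _ ENNReal.toReal_nonneg (ha x i) (hb x j), ENNReal.ofReal_toReal (p.apply_ne_top x)]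
    ring
  · intro y hy
    simp [hE, hF, inner_cqVec, hy.symm]

theorem relEntropyTerm_mul (c x y : ℝ) (hc : 0 ≤ c) :
    relEntropyTerm (c * x) (c * y) = ENNReal.ofReal c * relEntropyTerm x y := by
  rcases hc.eq_or_lt with rfl | hc
  · simp [relEntropyTerm]
  have h : (c * y = 0 ∧ c * x ≠ 0) ↔ (y = 0 ∧ x ≠ 0) := by simp [hc.ne']
  rw [relEntropyTerm, relEntropyTerm]
  simp only [h]
  split_ifs
  · rw [ENNReal.mul_top (by simpa using hc)]
  · rw [← ENNReal.ofReal_mul hc.le, mul_div_mul_left _ _ hc.ne']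
    congr 1
    ring

/-- Both states are diagonal in bases adapted to the blocks `|x⟩ ⊗ H`, and both `relEntropyTerm` and
`x ^ (1 - s) * y ^ s` are homogeneous of degree one, so `eigenSum_cqBasis` applies to each. -/
theorem exists_cq_eigenbases (hS : ∀ x, x ∈ S ↔ p x ≠ 0) (hρ : ∀ x, IsDensity (ρ x))
    (hB : IsDensity B) :
    IsDensity (cqState p ρ) ∧ IsDensity (tensor (classicalState p) (toEll2 B)) ∧
      relEntropy (cqState p ρ) (tensor (classicalState p) (toEll2 B)) =
        ∑' x, p x * relEntropy (ρ x) B ∧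
      ∀ s, 0 < s → s < 1 → renyiTrace s (cqState p ρ) (tensor (classicalState p) (toEll2 B)) =
        ∑' x, p x * renyiTrace s (ρ x) B := by
  obtain ⟨e₀⟩ : Nonempty (∀ x, Eigenbasis (ρ x)) :=
    ⟨fun x => (exists_eigenbasis (hρ x).1 (by rw [(hρ x).2]; simp)).some⟩
  obtain ⟨f₀⟩ := exists_eigenbasis hB.1 (by rw [hB.2]; simp)
  obtain ⟨ι, e, a, he⟩ : ∃ (ι : 𝒳 → Set H) (e : ∀ x, HilbertBasis (ι x) ℂ H) (a : ∀ x, ι x → ℝ),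
      ∀ x, IsEigen (ρ x) (e x) (a x) :=
    ⟨fun x => (e₀ x).idx, fun x => (e₀ x).basis, fun x => (e₀ x).val, fun x => (e₀ x).apply_basis⟩
  obtain ⟨κ, f, b, hf⟩ : ∃ (κ : Set H) (f : HilbertBasis κ ℂ H) (b : κ → ℝ), IsEigen B f b :=
    ⟨f₀.idx, f₀.basis, f₀.val, f₀.apply_basis⟩
  obtain ⟨E, hE⟩ := exists_cqBasis fun x => toEll2Basis (e x)
  obtain ⟨F, hF⟩ := exists_cqBasis fun _ : 𝒳 => toEll2Basis f
  have hE' := isEigen_cqState hS he hE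
  have hF' := isEigen_tensor_classicalState (p := p) (f := fun _ => f) (b := fun _ => b) hS
    (fun _ => hf) hF
  have h1 := isDensity_of_isEigen_sigma hE' hρ he
  have h2 := isDensity_of_isEigen_sigma (ρ := fun _ => B) (e := fun _ => f) (a := fun _ => b) hF'
    (fun _ => hB) fun _ => hf
  have ha := fun x i => (he x).nonneg (hρ x).1 i
  have hb := fun (_ : 𝒳) j => hf.nonneg hB.1 j
  have hsum := fun g hg => eigenSum_cqBasis (p := p) (e := e) (a := a) (f := fun _ => f)
    (b := fun _ => b) hE hF ha hb (g := g) hg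
  refine ⟨h1, h2, ?_, fun s h0 hs1 => ?_⟩
  · rw [relEntropy_eq_eigenSum h1 h2 hE' hF', hsum _ fun c x y hc _ _ => relEntropyTerm_mul c x y hc]
    refine tsum_congr fun x => ?_
    rw [relEntropy_eq_eigenSum (hρ x) hB (he x) hf]
  · rw [← eigenSum_rpow h1.1 h2.1 hE' hF' h0.le hs1.le, hsum]
    · refine tsum_congr fun x => ?_
      rw [eigenSum_rpow (hρ x).1 hB.1 (he x) hf h0.le hs1.le]
    · intro c x y hc hx hy
      rw [← ENNReal.ofReal_mul hc, Real.mul_rpow hc hx, Real.mul_rpow hc hy]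
      congr 1
      rcases hc.eq_or_lt with rfl | hc
      · rw [Real.zero_rpow h0.ne']
        ring
      · rw [Real.rpow_sub hc, Real.rpow_one]
        have : c ^ s ≠ 0 := by positivity
        field_simp

end CqState


/-! ### The strong converse exponent -/

section Exponent

variable {H : Type*} [NormedAddCommGroup H] [InnerProductSpace ℂ H] [CompleteSpace H]
variable {𝒳 : Type*} {p : PMF 𝒳} {S : Finset 𝒳} {ρ : 𝒳 → H →L[ℂ] H} {s : ℝ}

/-- `-log Tr (ρ x) ^ (1 - s) ρ_B ^ s`. -/
def negLogTrace (p : PMF 𝒳) (ρ : 𝒳 → H →L[ℂ] H) (s : ℝ) (x : 𝒳) : ℝ :=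
  -Real.log (renyiTrace s (ρ x) (marginal p ρ)).toReal

/-- `-∑ x, p x log Tr (ρ x) ^ (1 - s) ρ_B ^ s`. -/
def augustinFun (S : Finset 𝒳) (p : PMF 𝒳) (ρ : 𝒳 → H →L[ℂ] H) (s : ℝ) : ℝ :=
  ∑ x ∈ S, (p x).toReal * negLogTrace p ρ s x

theorem toReal_pos_of_mem (hS : ∀ x, x ∈ S ↔ p x ≠ 0) {x : 𝒳} (hx : x ∈ S) : 0 < (p x).toReal :=
  ENNReal.toReal_pos ((hS x).1 hx) (p.apply_ne_top x)

/-- Operator monotonicity applied to `p x • ρ x ≤ ρ_B`. This is why the Rényi trace does not vanish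
on the support of `p` and why the exponent is finite. -/
theorem ofReal_rpow_le_renyiTrace (hS : ∀ x, x ∈ S ↔ p x ≠ 0) (hρ : ∀ x, IsDensity (ρ x)) {x : 𝒳}
    (hx : x ∈ S) (h0 : 0 < s) (h1 : s < 1) :
    ENNReal.ofReal ((p x).toReal ^ s) ≤ renyiTrace s (ρ x) (marginal p ρ) := by
  have hp : 0 ≤ (p x).toReal := ENNReal.toReal_nonneg
  have h : opPow (((p x).toReal : ℂ) • ρ x) s ≤ opPow (marginal p ρ) s :=
    CFC.rpow_le_rpow (⟨h0.le, h1.le⟩ : s ∈ Set.Icc 0 1) (smul_le_marginal hS hρ hx)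
  rw [opPow_smul (hρ x).1 (by rw [(hρ x).2]; simp) hp h0.le] at h
  refine le_trans ?_ (trMul_mono_left (smul_nonneg' (by positivity) (opPow_nonneg _ _))
    (opPow_nonneg _ _) h)
  rw [trMul_smul_left (by positivity) (opPow_nonneg _ _) (opPow_nonneg _ _)]
  have h2 : trMul (opPow (ρ x) s) (opPow (ρ x) (1 - s)) = 1 :=
    (trMul_rpow_rpow_one_sub (hρ x).1 h0 h1).trans (hρ x).2
  rw [h2, mul_one]

theorem renyiTrace_ne_zero (hS : ∀ x, x ∈ S ↔ p x ≠ 0) (hρ : ∀ x, IsDensity (ρ x)) {x : 𝒳}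
    (hx : x ∈ S) (h0 : 0 < s) (h1 : s < 1) : renyiTrace s (ρ x) (marginal p ρ) ≠ 0 := by
  refine (lt_of_lt_of_le ?_ (ofReal_rpow_le_renyiTrace hS hρ hx h0 h1)).ne'
  have := toReal_pos_of_mem hS hx
  rw [ENNReal.ofReal_pos]
  positivity

theorem renyiTrace_ne_top (hS : ∀ x, x ∈ S ↔ p x ≠ 0) (hρ : ∀ x, IsDensity (ρ x)) (x : 𝒳)
    (h0 : 0 < s) (h1 : s < 1) : renyiTrace s (ρ x) (marginal p ρ) ≠ ⊤ :=
  ne_top_of_le_ne_top (by simp) (renyiTrace_le_one (hρ x) (isDensity_marginal hS hρ) h0 h1)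

theorem renyiTrace_eq_exp (hS : ∀ x, x ∈ S ↔ p x ≠ 0) (hρ : ∀ x, IsDensity (ρ x)) {x : 𝒳}
    (hx : x ∈ S) (h0 : 0 < s) (h1 : s < 1) :
    renyiTrace s (ρ x) (marginal p ρ) = ENNReal.ofReal (Real.exp (-negLogTrace p ρ s x)) := by
  have ht := renyiTrace_ne_top hS hρ x h0 h1
  rw [negLogTrace, neg_neg, Real.exp_log (ENNReal.toReal_pos (renyiTrace_ne_zero hS hρ hx h0 h1) ht),
    ENNReal.ofReal_toReal ht]

theorem negLogTrace_nonneg (hS : ∀ x, x ∈ S ↔ p x ≠ 0) (hρ : ∀ x, IsDensity (ρ x)) (x : 𝒳)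
    (h0 : 0 < s) (h1 : s < 1) : 0 ≤ negLogTrace p ρ s x := by
  rw [negLogTrace, neg_nonneg]
  refine Real.log_nonpos ENNReal.toReal_nonneg ?_
  simpa using ENNReal.toReal_mono (by simp)
    (renyiTrace_le_one (hρ x) (isDensity_marginal hS hρ) h0 h1)

theorem negLogTrace_le (hS : ∀ x, x ∈ S ↔ p x ≠ 0) (hρ : ∀ x, IsDensity (ρ x)) {x : 𝒳}
    (hx : x ∈ S) (h0 : 0 < s) (h1 : s < 1) :
    negLogTrace p ρ s x ≤ s * -Real.log (p x).toReal := by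
  have hp := toReal_pos_of_mem hS hx
  have h := ENNReal.toReal_mono (renyiTrace_ne_top hS hρ x h0 h1)
    (ofReal_rpow_le_renyiTrace hS hρ hx h0 h1)
  rw [ENNReal.toReal_ofReal (by positivity)] at h
  have h2 := Real.log_le_log (by positivity) h
  rw [Real.log_rpow hp] at h2
  rw [negLogTrace]
  linarith

theorem augustinFun_nonneg (hS : ∀ x, x ∈ S ↔ p x ≠ 0) (hρ : ∀ x, IsDensity (ρ x))
    (h0 : 0 < s) (h1 : s < 1) : 0 ≤ augustinFun S p ρ s :=
  Finset.sum_nonneg fun x _ =>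
    mul_nonneg ENNReal.toReal_nonneg (negLogTrace_nonneg hS hρ x h0 h1)

theorem augustinFun_le (hS : ∀ x, x ∈ S ↔ p x ≠ 0) (hρ : ∀ x, IsDensity (ρ x))
    (h0 : 0 < s) (h1 : s < 1) :
    augustinFun S p ρ s ≤ s * ∑ x ∈ S, (p x).toReal * -Real.log (p x).toReal := by
  rw [Finset.mul_sum]
  refine Finset.sum_le_sum fun x hx => ?_
  rw [mul_left_comm]
  exact mul_le_mul_of_nonneg_left (negLogTrace_le hS hρ hx h0 h1) ENNReal.toReal_nonneg

theorem ereal_coe_sum {ι : Type*} (t : Finset ι) (f : ι → ℝ) :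
    ((∑ i ∈ t, f i : ℝ) : EReal) = ∑ i ∈ t, (f i : EReal) := by
  classical
  induction t using Finset.induction_on with
  | empty => simp
  | insert a t ha ih => rw [Finset.sum_insert ha, Finset.sum_insert ha, EReal.coe_add, ih]

/-- Off the support of `p` the convention `0 * ∞ = 0` removes the term; on the support all
quantities are real. -/
theorem augustinDown_eq (hS : ∀ x, x ∈ S ↔ p x ≠ 0) (hρ : ∀ x, IsDensity (ρ x))
    (h0 : 0 < s) (h1 : s < 1) :
    augustinDown (1 - s) p ρ = ((augustinFun S p ρ s / s : ℝ) : EReal) := by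
  rw [augustinDown, tsum_eq_sum (s := S), augustinFun, Finset.sum_div, ereal_coe_sum]
  · refine Finset.sum_congr rfl fun x hx => ?_
    have hp : ((p x : ℝ≥0∞) : EReal) = ((p x).toReal : EReal) := by
      rw [← EReal.coe_ennreal_toReal (p.apply_ne_top x)]
    have hq : ENNReal.log (trMul (opPow (marginal p ρ) s) (opPow (ρ x) (1 - s))) =
        ((-negLogTrace p ρ s x : ℝ) : EReal) := by
      change ENNReal.log (renyiTrace s (ρ x) (marginal p ρ)) = _
      rw [ENNReal.log_pos_real (renyiTrace_ne_zero hS hρ hx h0 h1)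
        (renyiTrace_ne_top hS hρ x h0 h1), negLogTrace, neg_neg]
    rw [hp, petzDiv_eq_trMul h0.le, hq, ← EReal.coe_mul, ← EReal.coe_mul]
    congr 1
    field_simp
  · intro x hx
    rw [hS, not_not] at hx
    simp [hx]

/-- The map `α ↦ (1 - α) / α` is a bijection from `(1/2, 1)` to `(0, 1)` with inverse `s ↦ 1 / (1 +
s)`, and it sends the order `2 - 1 / α` to `1 - s`. -/
theorem scExponent_eq_iSup (hS : ∀ x, x ∈ S ↔ p x ≠ 0) (hρ : ∀ x, IsDensity (ρ x)) (R : ℝ) :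
    scExponent p ρ R =
      ⨆ s ∈ Set.Ioo (0 : ℝ) 1, ((augustinFun S p ρ s - s * R : ℝ) : EReal) := by
  have key : ∀ s ∈ Set.Ioo (0 : ℝ) 1, ((s : ℝ) : EReal) * (augustinDown (1 - s) p ρ - (R : EReal)) =
      ((augustinFun S p ρ s - s * R : ℝ) : EReal) := by
    intro s hs
    rw [augustinDown_eq hS hρ hs.1 hs.2, ← EReal.coe_sub, ← EReal.coe_mul, mul_sub,
      mul_div_cancel₀ _ hs.1.ne']
  refine le_antisymm (iSup₂_le fun α hα => ?_) (iSup₂_le fun s hs => ?_)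
  · have h0 : 0 < α := by linarith [hα.1]
    have hs : (1 - α) / α ∈ Set.Ioo (0 : ℝ) 1 := by
      refine ⟨div_pos (by linarith [hα.2]) h0, (div_lt_one h0).2 (by linarith [hα.1])⟩
    have h2 : 2 - 1 / α = 1 - (1 - α) / α := by field_simp; ring
    rw [h2, key _ hs]
    exact le_iSup₂ (f := fun s (_ : s ∈ Set.Ioo (0 : ℝ) 1) =>
      ((augustinFun S p ρ s - s * R : ℝ) : EReal)) _ hs
  · have h0 := hs.1
    have h1 := hs.2
    have hα : 1 / (1 + s) ∈ Set.Ioo (1 / 2 : ℝ) 1 := by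
      refine ⟨one_div_lt_one_div_of_lt (by linarith) (by linarith), ?_⟩
      rw [div_lt_one (by linarith)]
      linarith
    have h2 : (1 - 1 / (1 + s)) / (1 / (1 + s)) = s := by field_simp; ring
    have h3 : 2 - 1 / (1 / (1 + s)) = 1 - s := by field_simp; ring
    have h4 := le_iSup₂ (f := fun α (_ : α ∈ Set.Ioo (1 / 2 : ℝ) 1) =>
      (((1 - α) / α : ℝ) : EReal) * (augustinDown (2 - 1 / α) p ρ - (R : EReal))) _ hα
    rw [h2, h3, key s hs] at h4
    exact h4

/-- The second clause records that `E` is at most every upper bound, which is all that the converse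
bound needs; the supremum need not be attained. -/
theorem exists_coe_eq_scExponent (hS : ∀ x, x ∈ S ↔ p x ≠ 0) (hρ : ∀ x, IsDensity (ρ x)) (R : ℝ) :
    ∃ E : ℝ, (E : EReal) = scExponent p ρ R ∧
      ∀ c : ℝ, (∀ s, 0 < s → s < 1 → augustinFun S p ρ s - s * R ≤ c) → E ≤ c := by
  have hle : ∀ c : ℝ, (∀ s, 0 < s → s < 1 → augustinFun S p ρ s - s * R ≤ c) →
      scExponent p ρ R ≤ c := fun c hc => by
    rw [scExponent_eq_iSup hS hρ]
    exact iSup₂_le fun s hs => EReal.coe_le_coe_iff.2 (hc s hs.1 hs.2)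
  have htop : scExponent p ρ R ≠ ⊤ := by
    refine ne_top_of_le_ne_top (EReal.coe_ne_top _)
      (hle (|∑ x ∈ S, (p x).toReal * -Real.log (p x).toReal| + |R|) fun s h0 h1 => ?_)
    have h2 := augustinFun_le hS hρ h0 h1
    have h3 : s * ∑ x ∈ S, (p x).toReal * -Real.log (p x).toReal ≤
        1 * |∑ x ∈ S, (p x).toReal * -Real.log (p x).toReal| :=
      (mul_le_mul_of_nonneg_left (le_abs_self _) h0.le).trans
        (mul_le_mul_of_nonneg_right h1.le (abs_nonneg _))
    have h4 : s * -R ≤ 1 * |R| := (mul_le_mul_of_nonneg_left (neg_le_abs R) h0.le).trans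
      (mul_le_mul_of_nonneg_right h1.le (abs_nonneg _))
    linarith
  have hbot : scExponent p ρ R ≠ ⊥ := by
    rw [scExponent_eq_iSup hS hρ]
    refine ((EReal.bot_lt_coe _).trans_le (le_iSup₂ (f := fun s (_ : s ∈ Set.Ioo (0 : ℝ) 1) =>
      ((augustinFun S p ρ s - s * R : ℝ) : EReal)) (1 / 2) (by norm_num))).ne'
  refine ⟨_, EReal.coe_toReal htop hbot, fun c hc => ?_⟩
  rw [← EReal.coe_le_coe_iff, EReal.coe_toReal htop hbot]
  exact hle c hc

theorem scExponent_pos_iff (hS : ∀ x, x ∈ S ↔ p x ≠ 0) (hρ : ∀ x, IsDensity (ρ x)) (R : ℝ) :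
    0 < scExponent p ρ R ↔ ∃ s, 0 < s ∧ s < 1 ∧ s * R < augustinFun S p ρ s := by
  rw [scExponent_eq_iSup hS hρ]
  simp only [lt_iSup_iff, Set.mem_Ioo, exists_prop, and_assoc]
  refine exists_congr fun s => and_congr_right fun _ => and_congr_right fun _ => ?_
  rw [← EReal.coe_zero, EReal.coe_lt_coe_iff, sub_pos]

theorem ofReal_sum_pmf_mul {c : 𝒳 → ℝ} (hc : ∀ x, 0 ≤ c x) :
    ENNReal.ofReal (∑ x ∈ S, (p x).toReal * c x) = ∑ x ∈ S, p x * ENNReal.ofReal (c x) := by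
  rw [ENNReal.ofReal_sum_of_nonneg fun x _ => mul_nonneg ENNReal.toReal_nonneg (hc x)]
  refine Finset.sum_congr rfl fun x _ => ?_
  rw [ENNReal.ofReal_mul ENNReal.toReal_nonneg, ENNReal.ofReal_toReal (p.apply_ne_top x)]

theorem ofReal_augustinFun_div_le (hS : ∀ x, x ∈ S ↔ p x ≠ 0) (hρ : ∀ x, IsDensity (ρ x))
    (h0 : 0 < s) (h1 : s < 1) : ENNReal.ofReal (augustinFun S p ρ s / s) ≤ mutualInfo p ρ := by
  have hτ := isDensity_marginal hS hρ
  obtain ⟨-, -, hI, -⟩ := exists_cq_eigenbases hS hρ hτ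
  rw [mutualInfo, hI, augustinFun, Finset.sum_div]
  simp_rw [mul_div_assoc]
  rw [ofReal_sum_pmf_mul fun x => div_nonneg (negLogTrace_nonneg hS hρ x h0 h1) h0.le]
  refine le_trans (Finset.sum_le_sum fun x hx => ?_) (ENNReal.sum_le_tsum S)
  exact mul_le_mul_right
    (neg_log_renyiTrace_div_le (hρ x) hτ h0 h1 (renyiTrace_ne_zero hS hρ hx h0 h1)) _

/-- The Tsallis quantities of the classical-quantum state average over the letters, and each is at
most the Rényi one because `1 - exp (-u) ≤ u`. -/
theorem mutualInfo_le_iSup (hS : ∀ x, x ∈ S ↔ p x ≠ 0) (hρ : ∀ x, IsDensity (ρ x)) :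
    mutualInfo p ρ ≤ ⨆ k, ENNReal.ofReal (augustinFun S p ρ (smallOrder k) / smallOrder k) := by
  have hτ := isDensity_marginal hS hρ
  obtain ⟨hA, hB, -, hq⟩ := exists_cq_eigenbases hS hρ hτ
  rw [mutualInfo, relEntropy_eq_iSup hA hB]
  refine iSup_mono fun k => ?_
  have h0 := smallOrder_pos k
  have h1 := smallOrder_lt_one k
  rw [hq _ h0 h1, div_eq_inv_mul, ENNReal.ofReal_mul (by positivity)]
  refine mul_le_mul_right (tsub_le_iff_right.2 ?_) _
  rw [augustinFun, ofReal_sum_pmf_mul fun x => negLogTrace_nonneg hS hρ x h0 h1]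
  calc (1 : ℝ≥0∞) = ∑ x ∈ S, p x * 1 := by simp_rw [mul_one]; exact (sum_pmf_eq_one hS).symm
    _ ≤ ∑ x ∈ S, p x * (ENNReal.ofReal (negLogTrace p ρ (smallOrder k) x) +
        renyiTrace (smallOrder k) (ρ x) (marginal p ρ)) := by
      refine Finset.sum_le_sum fun x hx => mul_le_mul_right ?_ _
      rw [renyiTrace_eq_exp hS hρ hx h0 h1, ← ENNReal.ofReal_add
        (negLogTrace_nonneg hS hρ x h0 h1) (Real.exp_pos _).le, ← ENNReal.ofReal_one]
      refine ENNReal.ofReal_le_ofReal ?_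
      linarith [Real.add_one_le_exp (-negLogTrace p ρ (smallOrder k) x)]
    _ ≤ _ := by
      simp_rw [mul_add, Finset.sum_add_distrib]
      gcongr
      exact ENNReal.sum_le_tsum S

theorem lt_mutualInfo_iff (hS : ∀ x, x ∈ S ↔ p x ≠ 0) (hρ : ∀ x, IsDensity (ρ x)) (R : ℝ) :
    (R : EReal) < ((mutualInfo p ρ : ℝ≥0∞) : EReal) ↔
      ∃ s, 0 < s ∧ s < 1 ∧ s * R < augustinFun S p ρ s := by
  constructor
  · intro h
    rcases lt_or_ge R 0 with hR | hR
    -- A negative rate lies below the nonnegative `augustinFun` at any order; this case is split off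
    -- because `ENNReal.ofReal` would lose the sign.
    · refine ⟨1 / 2, by norm_num, by norm_num, ?_⟩
      have := augustinFun_nonneg hS hρ (s := 1 / 2) (by norm_num) (by norm_num)
      linarith
    have hc : (R : EReal) = (ENNReal.ofReal R : EReal) := by
      rw [EReal.coe_ennreal_ofReal, max_eq_left hR]
    rw [hc, EReal.coe_ennreal_lt_coe_ennreal_iff] at h
    obtain ⟨k, hk⟩ := lt_iSup_iff.1 (h.trans_le (mutualInfo_le_iSup hS hρ))
    refine ⟨smallOrder k, smallOrder_pos k, smallOrder_lt_one k, ?_⟩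
    have h2 := (ENNReal.ofReal_lt_ofReal_iff_of_nonneg hR).1 hk
    rw [lt_div_iff₀ (smallOrder_pos k)] at h2
    linarith
  · rintro ⟨s, h0, h1, h⟩
    have h2 : R < augustinFun S p ρ s / s := by
      rw [lt_div_iff₀ h0]
      linarith
    refine (EReal.coe_lt_coe_iff.2 h2).trans_le (le_trans ?_
      (EReal.coe_ennreal_le_coe_ennreal_iff.2 (ofReal_augustinFun_div_le hS hρ h0 h1)))
    rw [EReal.coe_ennreal_ofReal]
    exact EReal.coe_le_coe_iff.2 (le_max_left _ _)

variable {n M : ℕ} {N : 𝒳 → ℕ}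

theorem one_sub_le_exp [DecidableEq 𝒳] (hn : 0 < n) (hN : ∀ x, (n : ℝ≥0∞) * p x = N x)
    (hS : ∀ x, x ∈ S ↔ p x ≠ 0) (hρ : ∀ x, IsDensity (ρ x)) (hM : 0 < M) (h0 : 0 < s) (h1 : s < 1) :
    1 - (expectedTraceDist p ρ n M).toReal ≤ 6 * ((n : ℝ) + 1) ^ S.card *
      Real.exp (-(n * (augustinFun S p ρ s - s * (1 / n * Real.log M)))) := by
  have hb := one_le_expectedTraceDist_add hn hN hS hρ hM h0 h1
  have ht : expectedTraceDist p ρ n M ≠ ⊤ :=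
    ne_top_of_le_ne_top (by simp) (expectedTraceDist_le_one hn hN hS hρ hM)
  have hprod : ∏ a ∈ S, trMul (opPow (marginal p ρ) s) (opPow (ρ a) (1 - s)) ^ N a =
      ENNReal.ofReal (Real.exp (-(n * augustinFun S p ρ s))) := by
    rw [augustinFun, Finset.mul_sum, ← Finset.sum_neg_distrib, Real.exp_sum,
      ENNReal.ofReal_prod_of_nonneg fun _ _ => (Real.exp_pos _).le]
    refine Finset.prod_congr rfl fun x hx => ?_
    change renyiTrace s (ρ x) (marginal p ρ) ^ N x = _
    rw [renyiTrace_eq_exp hS hρ hx h0 h1, ← ENNReal.ofReal_pow (Real.exp_pos _).le,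
      ← Real.exp_nat_mul, toReal_eq_count_div hn hN]
    congr 2
    field_simp
  have hM' : (0 : ℝ) < M := by exact_mod_cast hM
  have hn' : (0 : ℝ) < n := by exact_mod_cast hn
  rw [hprod, ← ENNReal.ofReal_toReal ht, ← ENNReal.ofReal_mul (by positivity),
    show (6 : ℝ≥0∞) = ENNReal.ofReal 6 by norm_num, ← ENNReal.ofReal_mul (by norm_num),
    ← ENNReal.ofReal_add ENNReal.toReal_nonneg (by positivity), ← ENNReal.ofReal_one,
    ENNReal.ofReal_le_ofReal_iff (by positivity)] at hb
  refine (sub_le_iff_le_add'.2 hb).trans ?_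
  have h2 : (1 : ℝ) ≤ ((n : ℝ) + 1) ^ S.card := one_le_pow₀ (by linarith)
  -- Dropping the exponent `s < 1` makes the polynomial factor independent of the order.
  have h3 : (((n : ℝ) + 1) ^ S.card) ^ s ≤ ((n : ℝ) + 1) ^ S.card := by
    conv_rhs => rw [← Real.rpow_one (((n : ℝ) + 1) ^ S.card)]
    exact Real.rpow_le_rpow_of_exponent_le h2 h1.le
  have h4 : Real.exp (-(n * (augustinFun S p ρ s - s * (1 / n * Real.log M)))) =
      (M : ℝ) ^ s * Real.exp (-(n * augustinFun S p ρ s)) := by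
    rw [Real.rpow_def_of_pos hM', ← Real.exp_add]
    congr 1
    field_simp
    ring
  rw [h4, Real.mul_rpow hM'.le (by positivity), mul_assoc 6]
  refine mul_le_mul_of_nonneg_left ?_ (by norm_num)
  calc _ = (((n : ℝ) + 1) ^ S.card) ^ s * ((M : ℝ) ^ s * Real.exp (-(n * augustinFun S p ρ s))) := by
        ring
    _ ≤ _ := mul_le_mul_of_nonneg_right h3 (by positivity)

theorem six_mul_pow_le (hn : 2 ≤ n) (d : ℕ) :
    6 * ((n : ℝ) + 1) ^ d ≤ (n : ℝ) ^ (2 * d + 3) := by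
  have hn' : (2 : ℝ) ≤ n := by exact_mod_cast hn
  have h1 : (6 : ℝ) ≤ (n : ℝ) ^ 3 := by
    have : (2 : ℝ) ^ 3 ≤ (n : ℝ) ^ 3 := by gcongr
    linarith
  have h2 : (n : ℝ) + 1 ≤ (n : ℝ) ^ 2 := by nlinarith
  calc 6 * ((n : ℝ) + 1) ^ d ≤ (n : ℝ) ^ 3 * ((n : ℝ) ^ 2) ^ d := by gcongr
    _ = _ := by ring

/-- The strong converse bound with the exponent. -/
theorem one_sub_le_expectedTraceDist [DecidableEq 𝒳] (hn : 0 < n)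
    (hN : ∀ x, (n : ℝ≥0∞) * p x = N x) (hS : ∀ x, x ∈ S ↔ p x ≠ 0) (hρ : ∀ x, IsDensity (ρ x))
    (hM : 0 < M) {E : ℝ} (hE : ∀ c : ℝ, (∀ s, 0 < s → s < 1 →
      augustinFun S p ρ s - s * (1 / n * Real.log M) ≤ c) → E ≤ c) :
    1 - (n : ℝ) ^ (2 * S.card + 3) * Real.exp (-(n * E)) ≤
      (expectedTraceDist p ρ n M).toReal := by
  have hn' : (0 : ℝ) < n := by exact_mod_cast hn
  obtain rfl | hn2 : n = 1 ∨ 2 ≤ n := by omega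
  -- For `n = 1` the prefactor `n ^ k` is `1` and cannot absorb the constant `6`. But then `p` is a
  -- point mass with zero entropy, so `E ≤ 0` and the bound is trivial.
  · have hp : ∀ x ∈ S, (p x).toReal = 1 := by
      intro x hx
      have h1 := toReal_pos_of_mem hS hx
      have h2 : (p x).toReal ≤ 1 := by simpa using ENNReal.toReal_mono (by simp) (p.coe_le_one x)
      have h3 := toReal_eq_count_div hn hN x
      rw [Nat.cast_one, div_one] at h3
      rw [h3] at h1 h2 ⊢
      have h4 : 0 < N x := by exact_mod_cast h1
      have h5 : N x ≤ 1 := by exact_mod_cast h2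
      rw [show N x = 1 by omega, Nat.cast_one]
    have hE0 : E ≤ 0 := by
      refine hE 0 fun s h0 h1 => ?_
      have h2 := augustinFun_le hS hρ h0 h1
      rw [Finset.sum_eq_zero fun x hx => by rw [hp x hx]; simp, mul_zero] at h2
      have h3 : 0 ≤ Real.log M := Real.log_natCast_nonneg M
      have h4 : 0 ≤ s * (1 / (1 : ℕ) * Real.log M) := by positivity
      linarith
    have h1 : 1 ≤ Real.exp (-((1 : ℕ) * E)) := Real.one_le_exp (by simpa using hE0)
    have h2 : 0 ≤ (expectedTraceDist p ρ 1 M).toReal := ENNReal.toReal_nonneg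
    simp only [Nat.cast_one, one_pow, one_mul] at h1 ⊢
    linarith
  · set D := (expectedTraceDist p ρ n M).toReal
    set P := (n : ℝ) ^ (2 * S.card + 3)
    have hP : 0 < P := by positivity
    rcases le_or_gt (1 - D) 0 with hD | hD
    · have : 0 ≤ P * Real.exp (-(n * E)) := by positivity
      linarith
    -- Taking logarithms turns the bounds at the individual orders into one common upper bound for
    -- the function whose supremum is `E`.
    have hs : ∀ s, 0 < s → s < 1 → augustinFun S p ρ s - s * (1 / n * Real.log M) ≤
        -Real.log ((1 - D) / P) / n := by
      intro s h0 h1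
      have h2 := (one_sub_le_exp hn hN hS hρ hM h0 h1).trans
        (mul_le_mul_of_nonneg_right (six_mul_pow_le hn2 S.card) (Real.exp_pos _).le)
      rw [← div_le_iff₀' hP, ← Real.log_le_iff_le_exp (by positivity)] at h2
      rw [le_div_iff₀ hn']
      linarith
    have h2 := hE _ hs
    rw [le_div_iff₀ hn'] at h2
    have h3 : Real.log ((1 - D) / P) ≤ -(n * E) := by linarith
    rw [Real.log_le_iff_le_exp (by positivity), div_le_iff₀' hP] at h3
    linarith

end Exponent

end QSoftCovering

end

theorem mainTheorem6 {𝒳 : Type*} (p : PMF 𝒳) :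
    ∃ k : ℝ, 0 < k ∧
      ∀ (H : Type*) [NormedAddCommGroup H] [InnerProductSpace ℂ H] [CompleteSpace H]
        (ρ : 𝒳 → H →L[ℂ] H), (∀ x, QSoftCovering.IsDensity (ρ x)) →
        ∀ n M : ℕ, 0 < n → 0 < M → (∀ x, ∃ j : ℕ, (n : ENNReal) * p x = j) →
        ∀ R : ℝ, R = 1 / (n : ℝ) * Real.log M →
          (∃ E : ℝ, (E : EReal) = QSoftCovering.scExponent p ρ R ∧
            1 - (n : ℝ) ^ k * Real.exp (-(n * E)) ≤ (QSoftCovering.expectedTraceDist p ρ n M).toReal) ∧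
          (0 < QSoftCovering.scExponent p ρ R ↔ (R : EReal) < ((QSoftCovering.mutualInfo p ρ : ENNReal) : EReal)) := by
  classical
  -- If the support is infinite, `ncard` is `0`, but then no `n` satisfies the integrality
  -- condition.
  refine ⟨((2 * p.support.ncard + 3 : ℕ) : ℝ), by positivity, ?_⟩
  intro H _ _ _ ρ hρ n M hn hM hN R hR
  choose N hN using hN
  obtain ⟨S, hS⟩ := QSoftCovering.exists_support_finset hn hN
  have hcard : p.support.ncard = S.card := by
    rw [← Set.ncard_coe_finset]
    congr 1
    ext x
    simp [hS]
  refine ⟨?_, by rw [QSoftCovering.scExponent_pos_iff hS hρ, QSoftCovering.lt_mutualInfo_iff hS hρ]⟩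
  obtain ⟨E, hE, hle⟩ := QSoftCovering.exists_coe_eq_scExponent hS hρ R
  subst hR
  refine ⟨E, hE, ?_⟩
  rw [Real.rpow_natCast, hcard]
  exact QSoftCovering.one_sub_le_expectedTraceDist hn hN hS hρ hM hle
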